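/- Let $d\ge 1$. Let $\widehat R_0:\mathbb R^d\to[0,\infty)$ be integrable, compactly supported and even, let $\mathfrak g:\mathbb R^d\to[0,\infty)$ be measurable and even, and assume $\int \widehat R_0(p)\,|p|/\mathfrak g(p)\,dp<\infty$ and $\widehat R_0(p)/\mathfrak g(p)\sim \sigma_0|p|^{-d-\theta}$ as $p\to0$ for some $\sigma_0>0$, $\theta\in(0,1)$. Put $$\sigma(p)=\frac{2\widehat R_0(p)}{(2\pi)^d\,\mathfrak g(p)},\qquad \mathcal L\varphi(k)=\int \sigma(p-k)\big(\varphi(p)-\varphi(k)\big)\,dp,\qquad \Psi(q)=\int\sigma(p)\big(e^{ip\cdot q}-1\big)\,dp .$$ A weak solution of $$\partial_t W+k\cdot\nabla_x W=\mathcal L W,\qquad W(0,\cdot)=W_0,\qquad (1)$$ where $\mathcal L$ acts on the variable $k$, is a family $W:[0,\infty)\to L^2(\mathbb R^{2d})$, bounded in $L^2$ uniformly in $t$, such that for all $\lambda\in C_c^\infty(\mathbb R^{2d})$ and $t\ge0$ the function $s\mapsto\langle W(s),k\cdot\nabla_x\lambda+\mathcal L\lambda\rangle$ is integrable on $[0,t]$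 and $$\langle W(t),\lambda\rangle-\langle W_0,\lambda\rangle-\int_0^t\langle W(s),k\cdot\nabla_x\lambda+\mathcal L\lambda\rangle\,ds=0 .$$ A classical solution is a family $W:[0,\infty)\to L^2(\mathbb R^{2d})$, bounded in $L^2$ uniformly in $t$, with $W(0)=W_0$ and $W(t)\to W_0$ weakly in $L^2$ as $t\to0$, that for $t>0$ is given by a $C^1$ function of $(t,x,k)\in(0,\infty)\times\mathbb R^{2d}$ satisfying (1) pointwise, with $\mathcal LW$ an absolutely convergent integral. Then there exists, on some probability space, a Lévy process $(L_t)_{t\ge0}$ in $\mathbb R^d$ with $L_0=0$ and characteristic exponent $\Psi$, that is, $\mathbb E[e^{iq\cdot L_t}]=e^{t\Psi(q)}$ for all $t\ge 0$ and $q\in\mathbb R^d$; it is a pure-jump process with jump measure $\sigma(p)\,dp$, in the sense that its Lévy–Khintchine representation has no Gaussian part, no drift and Lévy measure $\sigma(p)\,dp$, where $\int\min(1,|p|)\,\sigma(p)\,dp<\infty$. Moreover, for every $W_0\in L^2(\mathbb R^{2d})$ equation (1) has exactly one weak solution $W$, and for every Lévy process $L$ with $L_0=0$ and characteristic exponent $\Psi$,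 for every $t\ge0$ and almost every $(x,k)\in\mathbb R^{2d}$, the following expectation exists and $$W(t,x,k)=\mathbb E\Big[W_0\Big(x-tk-\int_0^tL_s\,ds,\;k+L_t\Big)\Big].$$ Finally, $W$ is also the unique classical solution of (1). -/

import Mathlib

open MeasureTheory ProbabilityTheory Filter Topology Set
open scoped NNReal ENNReal RealInnerProductSpace ComplexConjugate

noncomputable section

namespace RadiativeTransfer

/-- Euclidean space `ℝ^d`. -/
abbrev Space (d : ℕ) : Type := EuclideanSpace ℝ (Fin d)

/-- Complex-valued `L²(ℝ^{2d})`, with variables `(x, k) ∈ ℝ^d × ℝ^d`. -/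
abbrev PhaseL2 (d : ℕ) : Type := Lp ℂ 2 (volume : Measure (Space d × Space d))

variable {d : ℕ}

/-- The transfer coefficient `σ(p) = 2 R₀(p) / ((2π)^d g(p))`. -/
def transferCoeff (R₀ g : Space d → ℝ) (p : Space d) : ℝ :=
  2 * R₀ p / ((2 * Real.pi) ^ d * g p)

/-- The scattering operator `(ℒφ)(k) = ∫ σ(p - k) (φ(p) - φ(k)) dp`. -/
def scattering (σ : Space d → ℝ) (φ : Space d → ℂ) (k : Space d) : ℂ :=
  ∫ p, (σ (p - k) : ℂ) * (φ p - φ k)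

/-- `k · ∇ₓλ + ℒλ`, where `ℒ` acts on the second variable. -/
def dualGenerator (σ : Space d → ℝ) (lam : Space d × Space d → ℂ) (z : Space d × Space d) : ℂ :=
  fderiv ℝ (fun x => lam (x, z.2)) z.1 z.2 + scattering σ (fun k => lam (z.1, k)) z.2

/-- The pairing `⟨f, φ⟩ = ∫ f(z) conj(φ(z)) dz` on `ℝ^{2d}`. -/
def pairing (f φ : Space d × Space d → ℂ) : ℂ :=
  ∫ z, f z * conj (φ z)

/-- `W` is a weak solution, uniformly bounded in `L²`, of `∂ₜW + k · ∇ₓW = ℒW`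
with initial datum `W₀`. -/
structure IsWeakSolution (σ : Space d → ℝ) (W₀ : PhaseL2 d) (W : ℝ≥0 → PhaseL2 d) : Prop where
  bounded : ∃ C : ℝ, ∀ t, ‖W t‖ ≤ C
  intervalIntegrable : ∀ lam : Space d × Space d → ℂ, ContDiff ℝ ((⊤ : ℕ∞) : WithTop ℕ∞) lam → HasCompactSupport lam →
    ∀ t : ℝ≥0, IntervalIntegrable
      (fun s : ℝ => pairing (W s.toNNReal) (dualGenerator σ lam)) volume 0 t
  weak_eq : ∀ lam : Space d × Space d → ℂ, ContDiff ℝ ((⊤ : ℕ∞) : WithTop ℕ∞) lam → HasCompactSupport lam →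
    ∀ t : ℝ≥0, pairing (W t) lam - pairing W₀ lam
      - (∫ s in (0 : ℝ)..t, pairing (W s.toNNReal) (dualGenerator σ lam)) = 0

/-- `W` is a classical solution, uniformly bounded in `L²`, of `∂ₜW + k · ∇ₓW = ℒW` with initial
datum `W₀`: for positive times `W` is given by a `C¹` function `u(t, x, k)` that satisfies the
equation pointwise, and the initial datum is attained in the weak topology of `L²`. -/
structure IsClassicalSolution (σ : Space d → ℝ) (W₀ : PhaseL2 d) (W : ℝ≥0 → PhaseL2 d) :
    Prop where
  bounded : ∃ C : ℝ, ∀ t, ‖W t‖ ≤ C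
  initial : W 0 = W₀
  weakly_continuous_zero : ∀ φ : PhaseL2 d,
    Tendsto (fun t => inner ℂ φ (W t)) (𝓝 0) (𝓝 (inner ℂ φ W₀))
  classical : ∃ u : ℝ × Space d × Space d → ℂ,
    ContDiffOn ℝ 1 u (Ioi 0 ×ˢ univ) ∧
    (∀ t : ℝ≥0, 0 < t → W t =ᵐ[volume] fun z => u ((t : ℝ), z)) ∧
    ∀ (t : ℝ) (x k : Space d), 0 < t →
      Integrable (fun p => (σ (p - k) : ℂ) * (u (t, x, p) - u (t, x, k))) ∧
      deriv (fun s => u (s, x, k)) t + fderiv ℝ (fun y => u (t, y, k)) x k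
        = scattering σ (fun q => u (t, x, q)) k

/-- Right-continuous paths with left limits. -/
def IsCadlag (f : ℝ≥0 → Space d) : Prop :=
  ∀ t, ContinuousWithinAt f (Ici t) t ∧ ∃ l, Tendsto f (𝓝[<] t) (𝓝 l)

/-- An `ℝ^d`-valued Lévy process started at `0`. Continuity in probability follows from
the stationarity of the increments and the right-continuity of the paths. -/
structure IsLevyProcess {Ω : Type*} [MeasurableSpace Ω] (L : ℝ≥0 → Ω → Space d)
    (P : Measure Ω) : Prop where
  measurable : ∀ t, Measurable (L t)
  zero : ∀ᵐ ω ∂P, L 0 ω = 0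
  indep_increments : HasIndepIncrements L P
  stationary_increments : ∀ s t : ℝ≥0,
    IdentDistrib (fun ω => L (s + t) ω - L s ω) (fun ω => L t ω - L 0 ω) P P
  cadlag : ∀ᵐ ω ∂P, IsCadlag fun t => L t ω

/-- `Ψ` is the characteristic exponent of `L`: `E[exp(i q · L_t)] = exp(t Ψ(q))`. -/
def HasCharExponent {Ω : Type*} [MeasurableSpace Ω] (L : ℝ≥0 → Ω → Space d)
    (P : Measure Ω) (Ψ : Space d → ℂ) : Prop :=
  ∀ (t : ℝ≥0) (q : Space d),
    ∫ ω, Complex.exp (Complex.I * (⟪q, L t ω⟫ : ℝ)) ∂P = Complex.exp ((t : ℝ) * Ψ q)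

/-- `Ψ(q) = ∫ σ(p) (exp(i p · q) - 1) dp`. -/
def levyExponent (σ : Space d → ℝ) (q : Space d) : ℂ :=
  ∫ p, (σ p : ℂ) * (Complex.exp (Complex.I * (⟪p, q⟫ : ℝ)) - 1)

/-- The measure `σ(p) dp`. -/
def jumpMeasure (σ : Space d → ℝ) : Measure (Space d) :=
  volume.withDensity fun p => ENNReal.ofReal (σ p)

/-- A pure-jump Lévy process (with jumps of finite variation) with jump measure `ν`: its
Lévy–Khintchine representation has no Gaussian part, no drift, and Lévy measure `ν`. -/
structure IsPureJumpLevyProcess {Ω : Type*} [MeasurableSpace Ω] (L : ℝ≥0 → Ω → Space d)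
    (P : Measure Ω) (ν : Measure (Space d)) : Prop where
  levy : IsLevyProcess L P
  no_atom_zero : ν {0} = 0
  finite_variation : ∫⁻ p, min 1 ‖p‖ₑ ∂ν < ⊤
  charExponent : HasCharExponent L P
    fun q => ∫ p, (Complex.exp (Complex.I * (⟪p, q⟫ : ℝ)) - 1) ∂ν

end RadiativeTransfer

end

/-!
The Fourier transform turns the equation into a transport equation that is solved explicitly: with
`Ψ` the symbol of `ℒ`, the elementary solution with frequency `ζ = (ξ, q)` is
`exp (i ⟪ζ, (x - t k, k)⟫ + ∫₀ᵗ Ψ(q - s ξ) ds)`. The factor `exp (∫₀ᵗ Ψ(q - s ξ) ds)` is also the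
characteristic function of the displacement `(-∫₀ᵗ L_s ds, L_t)` of any Lévy process with exponent
`Ψ` (`phaseChar_displacementLaw`). Hence the expectation in the theorem depends on the law of the
process only through `Ψ`, and equals a superposition of elementary solutions
(`IsJumpKernel.exists_levySolution_ae_eq_wave`).

Regularity. Near `0` the kernel is comparable to `|p|^(-d-θ)`, so that `-Re Ψ(q) ≥ c |q|^θ - C`.
Since `q - s ξ` cannot stay small on a time interval unless both `q` and `ξ` are small, the
characteristic function of the displacement decays like `exp (-κ |ζ|^θ)` for `t > 0`
(`IsJumpKernel.exists_exp_phaseExponent_le`). The superposition may therefore be differentiated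
under the integral, and it is a classical solution
(`IsJumpKernel.isClassicalSolution_levySolution`); the initial datum is attained because the
displacement tends to `0` almost surely.

Existence of the process. As `∫ |p| σ(p) dp` is finite, a process with exponent `Ψ` is obtained by
summing the jumps of a Poisson random measure on time and jump space
(`isPureJumpLevyProcess_jumpProcess`, `hasCharExponent_jumpProcess`).

Uniqueness. A classical solution is a weak solution, by the Green identity for `k · ∇ₓ + ℒ`
(`IsClassicalSolution.isWeakSolution`). Let `V` be the difference of two weak solutions and `ρ` a
mollifier. The regularization `u = V ⋆ ρ` solves the equation up to the commutator `V ⋆ (y₂ · ∇ₓρ)`,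
which is small in `L²` when `ρ` is concentrated much more in velocity than in position. From
`2 Re (ū ℒu) ≤ ℒ|u|²` and the Green identity, tested with cutoffs that are almost invariant under
the generator, the energy of `u` is bounded by the size of the commutator. Letting `ρ` concentrate
gives `V = 0` (`IsWeakSolution.unique`).
-/

noncomputable section

namespace RadiativeTransfer

variable {d : ℕ}

/-! ### The jump kernel and its Lévy exponent -/

/-- The properties of the transfer coefficient used below: a nonnegative even function of compact
support on `ℝ^d` with `∫ σ(p) |p| dp < ∞`. It need not be integrable at the origin. -/
structure IsJumpKernel (σ : Space d → ℝ) : Prop where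
  nonneg : ∀ p, 0 ≤ σ p
  even : ∀ p, σ (-p) = σ p
  aesm : AEStronglyMeasurable σ volume
  supp : ∃ R : ℝ, 0 < R ∧ ∀ p, R < ‖p‖ → σ p = 0
  int : Integrable fun p => σ p * ‖p‖

/-- The kernel dominates a multiple of the `θ`-stable kernel `|p|^(-d-θ)` near the origin. -/
def HasStableLowerBound (σ : Space d → ℝ) (θ : ℝ) : Prop :=
  ∃ c > 0, ∃ r > 0, ∀ p : Space d, p ≠ 0 → ‖p‖ < r → c * ‖p‖ ^ (-((d : ℝ) + θ)) ≤ σ p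

lemma isJumpKernel_transferCoeff {R₀ g : Space d → ℝ}
    (hR₀_nonneg : ∀ p, 0 ≤ R₀ p) (hR₀_symm : ∀ p, R₀ (-p) = R₀ p)
    (hR₀_int : Integrable R₀) (hR₀_supp : HasCompactSupport R₀)
    (hg_meas : Measurable g) (hg_nonneg : ∀ p, 0 ≤ g p) (hg_symm : ∀ p, g (-p) = g p)
    (h_int : ∫⁻ p, ENNReal.ofReal (R₀ p) * ‖p‖ₑ / ENNReal.ofReal (g p) < ⊤) :
    IsJumpKernel (transferCoeff R₀ g) := by
  have hpi : (0 : ℝ) < (2 * Real.pi) ^ d := by positivity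
  have hnn : ∀ p, 0 ≤ transferCoeff R₀ g p := fun p =>
    div_nonneg (by linarith [hR₀_nonneg p]) (mul_nonneg hpi.le (hg_nonneg p))
  have hm : AEStronglyMeasurable (transferCoeff R₀ g) volume := by
    refine AEMeasurable.aestronglyMeasurable ?_
    exact (hR₀_int.aemeasurable.const_mul 2).div (hg_meas.const_mul _).aemeasurable
  refine ⟨hnn, fun p => by simp [transferCoeff, hR₀_symm, hg_symm], hm, ?_, ?_⟩
  · obtain ⟨R, hR⟩ := hR₀_supp.isCompact.isBounded.subset_closedBall (0 : Space d)
    refine ⟨max R 1, by positivity, fun p hp => ?_⟩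
    have : R₀ p = 0 := by
      by_contra h
      have := hR (subset_tsupport _ (Function.mem_support.2 h))
      rw [mem_closedBall_zero_iff] at this
      exact absurd (lt_of_le_of_lt (le_max_left R 1) hp) (not_lt.2 this)
    simp [transferCoeff, this]
  · refine ⟨hm.mul continuous_norm.aestronglyMeasurable, ?_⟩
    rw [hasFiniteIntegral_iff_enorm]
    have hle : ∀ p, ‖transferCoeff R₀ g p * ‖p‖‖ₑ
        ≤ ENNReal.ofReal (2 / (2 * Real.pi) ^ d)
          * (ENNReal.ofReal (R₀ p) * ‖p‖ₑ / ENNReal.ofReal (g p)) := by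
      intro p
      rcases (hg_nonneg p).eq_or_lt with h0 | hpos
      · simp [transferCoeff, ← h0]
      · rw [enorm_mul, enorm_norm, Real.enorm_eq_ofReal (hnn p)]
        have : transferCoeff R₀ g p = 2 / (2 * Real.pi) ^ d * (R₀ p / g p) := by
          rw [transferCoeff, div_mul_div_comm]
        rw [this, ENNReal.ofReal_mul (by positivity), ENNReal.ofReal_div_of_pos hpos,
          mul_assoc, ENNReal.mul_div_right_comm]
    calc _ ≤ ∫⁻ p, ENNReal.ofReal (2 / (2 * Real.pi) ^ d)
          * (ENNReal.ofReal (R₀ p) * ‖p‖ₑ / ENNReal.ofReal (g p)) := lintegral_mono hle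
      _ = ENNReal.ofReal (2 / (2 * Real.pi) ^ d)
          * ∫⁻ p, (ENNReal.ofReal (R₀ p) * ‖p‖ₑ / ENNReal.ofReal (g p)) :=
        lintegral_const_mul' _ _ ENNReal.ofReal_ne_top
      _ < ⊤ := ENNReal.mul_lt_top ENNReal.ofReal_lt_top h_int

lemma hasStableLowerBound_transferCoeff {R₀ g : Space d → ℝ} {θ σ₀ : ℝ} (hσ₀ : 0 < σ₀)
    (h_asymp : Asymptotics.IsEquivalent (𝓝[≠] 0) (fun p => R₀ p / g p)
      (fun p => σ₀ / ‖p‖ ^ ((d : ℝ) + θ))) :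
    HasStableLowerBound (transferCoeff R₀ g) θ := by
  have h := h_asymp.isLittleO.def (c := 1 / 2) (by norm_num)
  rw [eventually_nhdsWithin_iff, Metric.eventually_nhds_iff] at h
  obtain ⟨r, hr, h⟩ := h
  refine ⟨2 / (2 * Real.pi) ^ d * (σ₀ / 2), by positivity, r, hr, fun p hp hpr => ?_⟩
  have h1 := h (y := p) (by simpa using hpr) (by simpa using hp)
  have hpos : 0 < ‖p‖ ^ ((d : ℝ) + θ) := Real.rpow_pos_of_pos (norm_pos_iff.2 hp) _
  have hq : 0 < σ₀ / ‖p‖ ^ ((d : ℝ) + θ) := by positivity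
  simp only [Pi.sub_apply, Real.norm_eq_abs, abs_of_pos hq] at h1
  have h2 := (abs_le.1 h1).1
  have h3 : transferCoeff R₀ g p = 2 / (2 * Real.pi) ^ d * (R₀ p / g p) := by
    rw [transferCoeff, div_mul_div_comm]
  rw [h3, Real.rpow_neg (norm_nonneg _), mul_assoc, ← div_eq_mul_inv]
  have : σ₀ / 2 / ‖p‖ ^ ((d : ℝ) + θ) = 1 / 2 * (σ₀ / ‖p‖ ^ ((d : ℝ) + θ)) := by ring
  rw [this]
  gcongr
  linarith

lemma norm_exp_I_mul_sub_one_le (x : ℝ) : ‖Complex.exp (Complex.I * (x : ℝ)) - 1‖ ≤ |x| := by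
  simpa using Real.norm_exp_I_mul_ofReal_sub_one_le (x := x)

namespace IsJumpKernel

variable {σ : Space d → ℝ}

lemma exponent_bound (hσ : IsJumpKernel σ) (q p : Space d) :
    ‖(σ p : ℂ) * (Complex.exp (Complex.I * (⟪p, q⟫ : ℝ)) - 1)‖ ≤ σ p * ‖p‖ * ‖q‖ := by
  rw [norm_mul, Complex.norm_real, Real.norm_of_nonneg (hσ.nonneg p), mul_assoc]
  exact mul_le_mul_of_nonneg_left
    ((norm_exp_I_mul_sub_one_le _).trans (abs_real_inner_le_norm p q)) (hσ.nonneg p)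

lemma aesm_exponent (hσ : IsJumpKernel σ) (q : Space d) :
    AEStronglyMeasurable
      (fun p => (σ p : ℂ) * (Complex.exp (Complex.I * (⟪p, q⟫ : ℝ)) - 1)) volume := by
  refine (Complex.continuous_ofReal.comp_aestronglyMeasurable hσ.aesm).mul ?_
  exact Continuous.aestronglyMeasurable (by fun_prop)

lemma integrable_exponent (hσ : IsJumpKernel σ) (q : Space d) :
    Integrable (fun p => (σ p : ℂ) * (Complex.exp (Complex.I * (⟪p, q⟫ : ℝ)) - 1)) :=
  (hσ.int.mul_const ‖q‖).mono' (hσ.aesm_exponent q) (.of_forall (hσ.exponent_bound q))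

lemma norm_levyExponent_le (hσ : IsJumpKernel σ) (q : Space d) :
    ‖levyExponent σ q‖ ≤ (∫ p, σ p * ‖p‖) * ‖q‖ := by
  rw [← integral_mul_const]
  exact norm_integral_le_of_norm_le (hσ.int.mul_const ‖q‖) (.of_forall (hσ.exponent_bound q))

lemma continuous_levyExponent (hσ : IsJumpKernel σ) : Continuous (levyExponent σ) := by
  refine continuous_iff_continuousAt.2 fun q => ?_
  refine continuousAt_of_dominated (bound := fun p => σ p * ‖p‖ * (‖q‖ + 1))
    (.of_forall hσ.aesm_exponent) ?_ (hσ.int.mul_const _) (.of_forall fun p => by fun_prop)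
  filter_upwards [Metric.ball_mem_nhds q one_pos] with q' hq'
  refine .of_forall fun p => (hσ.exponent_bound q' p).trans ?_
  have : ‖q'‖ ≤ ‖q‖ + 1 := by
    have := norm_sub_norm_le q' q
    rw [← dist_eq_norm] at this
    linarith [Metric.mem_ball.1 hq']
  exact mul_le_mul_of_nonneg_left this (mul_nonneg (hσ.nonneg p) (norm_nonneg p))

lemma re_levyExponent (hσ : IsJumpKernel σ) (q : Space d) :
    Integrable (fun p => σ p * (1 - Real.cos ⟪p, q⟫)) ∧
    (levyExponent σ q).re = - ∫ p, σ p * (1 - Real.cos ⟪p, q⟫) := by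
  have hre : ∀ p : Space d,
      ((σ p : ℂ) * (Complex.exp (Complex.I * (⟪p, q⟫ : ℝ)) - 1)).re
        = - (σ p * (1 - Real.cos ⟪p, q⟫)) := by
    intro p
    rw [Complex.re_ofReal_mul, Complex.sub_re, mul_comm Complex.I, Complex.exp_ofReal_mul_I_re,
      Complex.one_re]
    ring
  have h1 : Integrable (fun p => - (σ p * (1 - Real.cos ⟪p, q⟫))) := by
    simpa only [RCLike.re_to_complex, hre] using (hσ.integrable_exponent q).re
  refine ⟨by simpa using h1.neg, ?_⟩
  have h2 := integral_re (hσ.integrable_exponent q)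
  simp only [RCLike.re_to_complex, hre] at h2
  rw [levyExponent, ← h2, integral_neg]

lemma re_levyExponent_nonpos (hσ : IsJumpKernel σ) (q : Space d) : (levyExponent σ q).re ≤ 0 := by
  rw [(hσ.re_levyExponent q).2]
  exact neg_nonpos.2 (integral_nonneg fun p =>
    mul_nonneg (hσ.nonneg p) (sub_nonneg.2 (Real.cos_le_one _)))

/-- Stable growth of the exponent at infinity. The integral defining `-Re Ψ(q)` is bounded from
below by its part over the ball of radius `1/(4|q|)` around `q/(2|q|²)`, on which `p · q` lies
between `1/4` and `1` and `|p|` is of the order of `1/|q|`. -/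
lemma exists_le_neg_re_levyExponent (hσ : IsJumpKernel σ) {θ : ℝ} (hθ : 0 < θ)
    (hlow : HasStableLowerBound σ θ) :
    ∃ c > 0, ∃ C ≥ 0, ∀ q, c * ‖q‖ ^ θ - C ≤ - (levyExponent σ q).re := by
  obtain ⟨c₀, hc₀, r, hr, hlow⟩ := hlow
  set v := volume.real (Metric.ball (0 : Space d) 1) with hv
  have hvpos : 0 < v := ENNReal.toReal_pos
    (Metric.isOpen_ball.measure_pos _ ⟨0, by simp⟩).ne' measure_ball_lt_top.ne
  set c := c₀ * (2 / Real.pi ^ 2 * (1 / 4) ^ 2) * ((1 / 4) ^ d * v) with hc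
  have hcpos : 0 < c := by positivity
  refine ⟨c, hcpos, c * (1 / r) ^ θ, by positivity, fun q => ?_⟩
  rcases le_or_gt ‖q‖ (1 / r) with hq | hq
  · have h1 := hσ.re_levyExponent_nonpos q
    have h2 : c * ‖q‖ ^ θ ≤ c * (1 / r) ^ θ := by gcongr
    linarith
  have hq0 : 0 < ‖q‖ := lt_trans (by positivity) hq
  set a : Space d := (1 / (2 * ‖q‖ ^ 2)) • q with ha
  set B := Metric.ball a (1 / (4 * ‖q‖)) with hB
  have haq : ⟪a, q⟫ = 1 / 2 := by
    rw [ha, real_inner_smul_left, real_inner_self_eq_norm_sq]; field_simp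
  have hna : ‖a‖ = 1 / (2 * ‖q‖) := by
    rw [ha, norm_smul, Real.norm_of_nonneg (by positivity)]; field_simp
  have hpB : ∀ p ∈ B, 1 / 4 ≤ ⟪p, q⟫ ∧ ⟪p, q⟫ ≤ 1 ∧ 0 < ‖p‖ ∧ ‖p‖ ≤ 1 / ‖q‖ := by
    intro p hp
    have hp' : ‖p - a‖ < 1 / (4 * ‖q‖) := by simpa [hB, dist_eq_norm] using hp
    have e1 : ⟪p, q⟫ = 1 / 2 + ⟪p - a, q⟫ := by rw [inner_sub_left, haq]; ring
    have e2 : |⟪p - a, q⟫| ≤ 1 / 4 := by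
      refine (abs_real_inner_le_norm _ _).trans ?_
      calc ‖p - a‖ * ‖q‖ ≤ 1 / (4 * ‖q‖) * ‖q‖ := by gcongr
        _ = 1 / 4 := by field_simp
    have e3 := abs_le.1 e2
    have h1 : 1 / 4 ≤ ⟪p, q⟫ := by linarith
    refine ⟨h1, by linarith, ?_, ?_⟩
    · rw [norm_pos_iff]; rintro rfl; norm_num at h1
    · have : ‖p‖ ≤ ‖p - a‖ + ‖a‖ := by simpa using norm_add_le (p - a) a
      have e4 : 1 / (4 * ‖q‖) + 1 / (2 * ‖q‖) ≤ 1 / ‖q‖ := by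
        rw [div_add_div _ _ (by positivity) (by positivity),
          div_le_div_iff₀ (by positivity) (by positivity)]
        nlinarith [sq_nonneg ‖q‖]
      linarith
  obtain ⟨hint, hre⟩ := hσ.re_levyExponent q
  rw [hre, neg_neg]
  have hvB : volume.real B = (1 / (4 * ‖q‖)) ^ d * v := by
    rw [hB, measureReal_def, Measure.addHaar_ball_of_pos _ _ (by positivity), ENNReal.toReal_mul,
      ENNReal.toReal_ofReal (by positivity)]
    simp [hv, measureReal_def]
  set K := c₀ * ‖q‖ ^ ((d : ℝ) + θ) * (2 / Real.pi ^ 2 * (1 / 4) ^ 2) with hK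
  have hKle : ∀ p ∈ B, K ≤ σ p * (1 - Real.cos ⟪p, q⟫) := by
    intro p hp
    obtain ⟨h1, h2, h3, h4⟩ := hpB p hp
    have hcos := Real.cos_le_one_sub_mul_cos_sq (x := ⟪p, q⟫)
      (abs_le.2 ⟨by linarith [Real.pi_gt_three], by linarith [Real.pi_gt_three]⟩)
    have hcos' : 2 / Real.pi ^ 2 * (1 / 4) ^ 2 ≤ 1 - Real.cos ⟪p, q⟫ := by
      have : 2 / Real.pi ^ 2 * (1 / 4) ^ 2 ≤ 2 / Real.pi ^ 2 * ⟪p, q⟫ ^ 2 := by gcongr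
      linarith
    have hσp : c₀ * ‖q‖ ^ ((d : ℝ) + θ) ≤ σ p := by
      have hpr : ‖p‖ < r := lt_of_le_of_lt h4 (by rw [div_lt_comm₀ hq0 hr]; exact hq)
      refine le_trans ?_ (hlow p (norm_pos_iff.1 h3) hpr)
      rw [Real.rpow_neg (norm_nonneg p), ← Real.inv_rpow (norm_nonneg p)]
      gcongr
      rw [le_inv_comm₀ hq0 h3]
      simpa using h4
    exact mul_le_mul hσp hcos' (by positivity) (hσ.nonneg p)
  calc c * ‖q‖ ^ θ - c * (1 / r) ^ θ ≤ c * ‖q‖ ^ θ := by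
        have : 0 ≤ c * (1 / r) ^ θ := by positivity
        linarith
    _ = K * volume.real B := by
        have h1 : 1 / (4 * ‖q‖) = 1 / 4 * ‖q‖⁻¹ := by rw [one_div_mul_eq_div]; field_simp
        have h2 : ‖q‖ ^ d * ‖q‖⁻¹ ^ d = 1 := by rw [← mul_pow, mul_inv_cancel₀ hq0.ne', one_pow]
        rw [hvB, hK, hc, Real.rpow_add hq0, Real.rpow_natCast, h1, mul_pow]
        linear_combination (- (c₀ * (2 / Real.pi ^ 2 * (1 / 4) ^ 2) * ((1 / 4) ^ d * v)
          * ‖q‖ ^ θ)) * h2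
    _ = ∫ _ in B, K := by rw [setIntegral_const, smul_eq_mul, mul_comm]
    _ ≤ ∫ p in B, σ p * (1 - Real.cos ⟪p, q⟫) :=
        setIntegral_mono_on (integrableOn_const measure_ball_lt_top.ne) hint.integrableOn
          Metric.isOpen_ball.measurableSet hKle
    _ ≤ ∫ p, σ p * (1 - Real.cos ⟪p, q⟫) :=
        setIntegral_le_integral hint (.of_forall fun p =>
          mul_nonneg (hσ.nonneg p) (sub_nonneg.2 (Real.cos_le_one _)))

/-! ### The jump measure -/

lemma aemeasurable_ofReal (hσ : IsJumpKernel σ) :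
    AEMeasurable (fun p => ENNReal.ofReal (σ p)) volume :=
  hσ.aesm.aemeasurable.ennreal_ofReal

lemma jumpMeasure_zero (hd : 1 ≤ d) : jumpMeasure σ {0} = 0 := by
  have : Nonempty (Fin d) := ⟨⟨0, hd⟩⟩
  have : Nontrivial (Space d) := inferInstance
  exact withDensity_absolutelyContinuous _ _ (measure_singleton 0)

lemma lintegral_norm_jumpMeasure (hσ : IsJumpKernel σ) : ∫⁻ p, ‖p‖ₑ ∂jumpMeasure σ < ⊤ := by
  rw [jumpMeasure, lintegral_withDensity_eq_lintegral_mul₀ hσ.aemeasurable_ofReal (by fun_prop)]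
  refine lt_of_le_of_lt (lintegral_mono fun p => ?_) hσ.int.2
  simp [Real.enorm_eq_ofReal (hσ.nonneg p)]

lemma integral_jumpMeasure (hσ : IsJumpKernel σ) (f : Space d → ℂ) :
    ∫ p, f p ∂jumpMeasure σ = ∫ p, (σ p : ℂ) * f p := by
  rw [jumpMeasure, integral_withDensity_eq_integral_toReal_smul₀ hσ.aemeasurable_ofReal
    (.of_forall fun _ => ENNReal.ofReal_lt_top)]
  refine integral_congr_ae (.of_forall fun p => ?_)
  simp [ENNReal.toReal_ofReal (hσ.nonneg p)]

instance : SFinite (jumpMeasure σ) := by unfold jumpMeasure; infer_instance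

end IsJumpKernel

/-! ### Poisson random measures -/

section PoissonRandomMeasure

variable {X : Type*} [MeasurableSpace X]

lemma exists_isProbabilityMeasure_smul_eq [Nonempty X] (m : Measure X) [IsFiniteMeasure m] :
    ∃ ρ : Measure X, IsProbabilityMeasure ρ ∧ m = m univ • ρ := by
  by_cases h : m univ = 0
  · refine ⟨Measure.dirac (Classical.arbitrary X), inferInstance, ?_⟩
    rw [h, zero_smul]
    exact Measure.measure_univ_eq_zero.1 h
  · refine ⟨(m univ)⁻¹ • m, ⟨?_⟩, ?_⟩
    · simp [ENNReal.inv_mul_cancel h (measure_ne_top m univ)]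
    · rw [smul_smul, ENNReal.mul_inv_cancel h (measure_ne_top m univ), one_smul]

/-- The law of a single point of a Poisson random measure with finite intensity `m`: the
normalization of `m` (an arbitrary Dirac mass if `m = 0`). -/
def pointLaw [Nonempty X] (m : Measure X) [IsFiniteMeasure m] : Measure X :=
  (exists_isProbabilityMeasure_smul_eq m).choose

instance [Nonempty X] (m : Measure X) [IsFiniteMeasure m] : IsProbabilityMeasure (pointLaw m) :=
  (exists_isProbabilityMeasure_smul_eq m).choose_spec.1

lemma eq_smul_pointLaw [Nonempty X] (m : Measure X) [IsFiniteMeasure m] :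
    m = m univ • pointLaw m :=
  (exists_isProbabilityMeasure_smul_eq m).choose_spec.2

/-- The law of a Poisson random measure with finite intensity `m`, encoded as a pair `(n, x)` of a
Poisson number `n` and a sequence `x` of independent points, of which the first `n` are used. -/
def blockLaw [Nonempty X] (m : Measure X) [IsFiniteMeasure m] : Measure (ℕ × (ℕ → X)) :=
  (poissonMeasure (m univ).toNNReal).prod (Measure.infinitePi fun _ => pointLaw m)

instance [Nonempty X] (m : Measure X) [IsFiniteMeasure m] : IsProbabilityMeasure (blockLaw m) := by
  unfold blockLaw; infer_instance

/-- The sum of `f` over the points of a configuration `(n, x)`. -/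
def blockSum {V : Type*} [AddCommMonoid V] (f : X → V) (b : ℕ × (ℕ → X)) : V :=
  ∑ i ∈ Finset.range b.1, f (b.2 i)

lemma measurable_blockSum {V : Type*} [AddCommMonoid V] [MeasurableSpace V] [MeasurableAdd₂ V]
    {f : X → V} (hf : Measurable f) : Measurable (blockSum f) := by
  refine measurable_from_prod_countable_right fun n => ?_
  simp only [blockSum]
  exact Finset.measurable_sum _ fun i _ => hf.comp (measurable_pi_apply i)

lemma integral_prod_range_infinitePi {Y : ℕ → Type*} [∀ i, MeasurableSpace (Y i)]
    (P : ∀ i, Measure (Y i)) [∀ i, IsProbabilityMeasure (P i)] (f : ∀ i, Y i → ℂ)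
    (hf : ∀ i, Measurable (f i)) (n : ℕ) :
    ∫ ω, ∏ i ∈ Finset.range n, f i (ω i) ∂(Measure.infinitePi P)
      = ∏ i ∈ Finset.range n, ∫ x, f i x ∂(P i) := by
  have h1 : iIndepFun (fun i (ω : ∀ i, Y i) => f i (ω i)) (Measure.infinitePi P) :=
    iIndepFun_infinitePi hf
  have h2 : iIndepFun (fun (i : Fin n) (ω : ∀ i, Y i) => f i (ω i)) (Measure.infinitePi P) :=
    h1.precomp (g := fun i : Fin n => (i : ℕ)) Fin.val_injective
  have h3 := h2.integral_fun_prod_eq_prod_integral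
    (fun i => ((hf i).comp (measurable_pi_apply (i : ℕ))).aestronglyMeasurable)
  rw [Finset.prod_range]
  simp_rw [Finset.prod_range]
  rw [h3]
  refine Finset.prod_congr rfl fun i _ => ?_
  rw [← integral_map (f := f i) (φ := fun ω : ∀ i, Y i => ω i)
    (measurable_pi_apply _).aemeasurable (hf i).aestronglyMeasurable, Measure.infinitePi_map_eval]

/-- The Laplace functional of a Poisson random measure of finite intensity `m`. -/
lemma integral_prod_blockLaw [Nonempty X] (m : Measure X) [IsFiniteMeasure m] {h : X → ℂ}
    (hm : Measurable h) (hb : ∀ x, ‖h x‖ ≤ 1) :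
    ∫ b, ∏ i ∈ Finset.range b.1, h (b.2 i) ∂(blockLaw m) = Complex.exp (∫ x, (h x - 1) ∂m) := by
  have hmeas : Measurable fun b : ℕ × (ℕ → X) => ∏ i ∈ Finset.range b.1, h (b.2 i) := by
    refine measurable_from_prod_countable_right fun n => ?_
    exact Finset.measurable_prod (Finset.range n) (f := fun i (y : ℕ → X) => h (y i))
      fun i _ => hm.comp (measurable_pi_apply i)
  have hbd : ∀ b : ℕ × (ℕ → X), ‖∏ i ∈ Finset.range b.1, h (b.2 i)‖ ≤ 1 := fun b => by
    rw [norm_prod]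
    exact Finset.prod_le_one (fun _ _ => norm_nonneg _) fun i _ => hb _
  have hint : Integrable (fun b : ℕ × (ℕ → X) => ∏ i ∈ Finset.range b.1, h (b.2 i))
      ((poissonMeasure (m univ).toNNReal).prod (Measure.infinitePi fun _ => pointLaw m)) :=
    (integrable_const (1 : ℝ)).mono' hmeas.aestronglyMeasurable (.of_forall hbd)
  rw [blockLaw, integral_prod _ hint]
  simp only
  simp_rw [integral_prod_range_infinitePi (fun _ => pointLaw m) (fun _ => h) (fun _ => hm),
    Finset.prod_const, Finset.card_range]
  set w := ∫ x, h x ∂(pointLaw m) with hw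
  have hhint : Integrable h (pointLaw m) :=
    (integrable_const (1 : ℝ)).mono' hm.aestronglyMeasurable (.of_forall hb)
  have hexp : ∫ x, (h x - 1) ∂m = (m univ).toReal * (w - 1) := by
    conv_lhs => rw [eq_smul_pointLaw m]
    rw [integral_smul_measure, integral_sub hhint (integrable_const _)]
    simp [hw]
  rw [integral_poissonMeasure, hexp]
  set r := (m univ).toNNReal
  have hr : (m univ).toReal = (r : ℝ) := rfl
  rw [hr]
  calc ∑' n : ℕ, (Real.exp (-r) * r ^ n / n.factorial : ℝ) • w ^ n
      = ∑' n : ℕ, (Real.exp (-r) : ℂ) * ((r * w) ^ n / n.factorial) := by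
        congr with n
        rw [Complex.real_smul]
        push_cast
        ring
    _ = (Real.exp (-r) : ℂ) * Complex.exp (r * w) := by
        rw [tsum_mul_left, (NormedSpace.expSeries_div_hasSum_exp ((r : ℂ) * w)).tsum_eq,
          Complex.exp_eq_exp_ℂ]
    _ = Complex.exp (r * (w - 1)) := by
        rw [Complex.ofReal_exp, ← Complex.exp_add]
        push_cast
        ring_nf

lemma lintegral_id_poissonMeasure (r : ℝ≥0) : ∫⁻ n, (n : ℝ≥0∞) ∂(poissonMeasure r) = r := by
  have hs : HasSum (fun n : ℕ => Real.exp (-r) * r ^ n / n.factorial * n) (r : ℝ) := by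
    rw [← hasSum_nat_add_iff' 1]
    simp only [Finset.range_one, Finset.sum_singleton, Nat.cast_zero, mul_zero, sub_zero]
    have := (hasSum_one_poissonMeasure r).mul_left (r : ℝ)
    rw [mul_one] at this
    convert! this using 2 with n
    rw [Nat.factorial_succ]
    push_cast
    field_simp
    ring
  rw [poissonMeasure, lintegral_sum_measure]
  simp_rw [lintegral_smul_measure, lintegral_dirac, smul_eq_mul]
  have : ∀ n : ℕ, ENNReal.ofReal (Real.exp (-r) * r ^ n / n.factorial) * (n : ℝ≥0∞)
      = ENNReal.ofReal (Real.exp (-r) * r ^ n / n.factorial * n) := fun n => by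
    rw [ENNReal.ofReal_mul (by positivity), ENNReal.ofReal_natCast]
  simp_rw [this]
  rw [← ENNReal.ofReal_tsum_of_nonneg (fun n => by positivity) hs.summable, hs.tsum_eq,
    ENNReal.ofReal_coe_nnreal]

/-- Campbell's formula for a Poisson random measure of finite intensity `m`. -/
lemma lintegral_blockSum [Nonempty X] (m : Measure X) [IsFiniteMeasure m] {f : X → ℝ≥0∞}
    (hf : Measurable f) : ∫⁻ b, blockSum f b ∂(blockLaw m) = ∫⁻ x, f x ∂m := by
  rw [blockLaw, lintegral_prod _ (measurable_blockSum hf).aemeasurable]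
  have h1 : ∀ n : ℕ, ∫⁻ x, blockSum f (n, x) ∂(Measure.infinitePi fun _ : ℕ => pointLaw m)
      = n * ∫⁻ x, f x ∂(pointLaw m) := by
    intro n
    simp only [blockSum]
    rw [lintegral_finsetSum (Finset.range n) (f := fun i (y : ℕ → X) => f (y i))
      fun i _ => hf.comp (measurable_pi_apply i)]
    have : ∀ i : ℕ, ∫⁻ x : ℕ → X, f (x i) ∂(Measure.infinitePi fun _ : ℕ => pointLaw m)
        = ∫⁻ x, f x ∂(pointLaw m) := fun i => by
      rw [← lintegral_map (g := fun x : ℕ → X => x i) hf (measurable_pi_apply i),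
        Measure.infinitePi_map_eval (fun _ : ℕ => pointLaw m) i]
    simp [this]
  simp_rw [h1]
  rw [lintegral_mul_const _ (by fun_prop), lintegral_id_poissonMeasure]
  conv_rhs => rw [eq_smul_pointLaw m]
  rw [lintegral_smul_measure, smul_eq_mul, ENNReal.coe_toNNReal (measure_ne_top m univ)]

/-- The probability space of a Poisson random measure with s-finite intensity `M`: independent
Poisson random measures for the finite pieces of `M`. -/
def poissonLaw [Nonempty X] (M : Measure X) [SFinite M] : Measure (ℕ → ℕ × (ℕ → X)) :=
  Measure.infinitePi fun j => blockLaw (sfiniteSeq M j)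

instance [Nonempty X] (M : Measure X) [SFinite M] : IsProbabilityMeasure (poissonLaw M) := by
  unfold poissonLaw; infer_instance

lemma ae_tsum_blockSum_lt_top [Nonempty X] (M : Measure X) [SFinite M] {f : X → ℝ≥0∞}
    (hf : Measurable f) (hfM : ∫⁻ x, f x ∂M < ⊤) :
    ∀ᵐ ω ∂(poissonLaw M), ∑' j, blockSum f (ω j) < ⊤ := by
  have hm : ∀ j, Measurable fun ω : ℕ → ℕ × (ℕ → X) => blockSum f (ω j) := fun j =>
    (measurable_blockSum hf).comp (measurable_pi_apply j)
  refine ae_lt_top (Measurable.tsum hm) ?_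
  rw [lintegral_tsum fun j => (hm j).aemeasurable]
  have : ∀ j, ∫⁻ ω, blockSum f (ω j) ∂(poissonLaw M) = ∫⁻ x, f x ∂(sfiniteSeq M j) := fun j => by
    rw [poissonLaw, ← lintegral_map (g := fun ω : ℕ → ℕ × (ℕ → X) => ω j)
      (measurable_blockSum hf) (measurable_pi_apply j), Measure.infinitePi_map_eval,
      lintegral_blockSum _ hf]
  simp_rw [this]
  rw [← lintegral_sum_measure, sum_sfiniteSeq]
  exact hfM.ne

lemma enorm_blockSum_le {Y V : Type*} [NormedAddCommGroup V] (f : Y → V) (b : ℕ × (ℕ → Y)) :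
    ‖blockSum f b‖ₑ ≤ blockSum (fun x => ‖f x‖ₑ) b := enorm_sum_le _ _

lemma summable_blockSum {Y V : Type*} [NormedAddCommGroup V] [CompleteSpace V] {f : Y → V}
    {g : Y → ℝ≥0∞} (hfg : ∀ x, ‖f x‖ₑ ≤ g x) {ω : ℕ → ℕ × (ℕ → Y)}
    (h : ∑' j, blockSum g (ω j) < ⊤) : Summable fun j => blockSum f (ω j) := by
  refine Summable.of_enorm (lt_of_le_of_lt (ENNReal.tsum_le_tsum fun j => ?_) h).ne
  exact (enorm_blockSum_le f _).trans (Finset.sum_le_sum fun i _ => hfg _)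

/-- The exponential formula: the characteristic function of the sum of `φ` over the points of a
Poisson random measure with intensity `M`. -/
lemma integral_exp_tsum_blockSum [Nonempty X] (M : Measure X) [SFinite M] {φ : X → ℝ}
    (hφ : Measurable φ) (hφM : ∫⁻ x, ‖φ x‖ₑ ∂M < ⊤) :
    ∫ ω, Complex.exp (Complex.I * ((∑' j, blockSum φ (ω j) : ℝ) : ℂ)) ∂(poissonLaw M)
      = Complex.exp (∫ x, (Complex.exp (Complex.I * (φ x : ℝ)) - 1) ∂M) := by
  set h : X → ℂ := fun x => Complex.exp (Complex.I * (φ x : ℝ)) with hh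
  have hmh : Measurable h := by fun_prop
  have hbh : ∀ x, ‖h x‖ ≤ 1 := fun x => by
    rw [hh]; simp only; rw [mul_comm, Complex.norm_exp_ofReal_mul_I]
  have hexp : ∀ b : ℕ × (ℕ → X), Complex.exp (Complex.I * ((blockSum φ b : ℝ) : ℂ))
      = ∏ i ∈ Finset.range b.1, h (b.2 i) := fun b => by
    rw [hh, ← Complex.exp_sum, blockSum, Complex.ofReal_sum, Finset.mul_sum]
  have hm : Measurable fun b : ℕ × (ℕ → X) => Complex.exp (Complex.I * ((blockSum φ b : ℝ) : ℂ)) := by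
    have := measurable_blockSum hφ
    fun_prop
  have hint : Integrable (fun x => h x - 1) M := by
    refine ⟨(hmh.sub_const 1).aestronglyMeasurable, lt_of_le_of_lt (lintegral_mono fun x => ?_) hφM⟩
    rw [enorm_le_iff_norm_le, Real.norm_eq_abs]
    exact norm_exp_I_mul_sub_one_le _
  have hpart : ∀ N : ℕ, ∫ ω, Complex.exp (Complex.I *
      ((∑ j ∈ Finset.range N, blockSum φ (ω j) : ℝ) : ℂ)) ∂(poissonLaw M)
      = Complex.exp (∑ j ∈ Finset.range N, ∫ x, (h x - 1) ∂(sfiniteSeq M j)) := by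
    intro N
    rw [Complex.exp_sum]
    simp_rw [Complex.ofReal_sum, Finset.mul_sum, Complex.exp_sum]
    rw [poissonLaw, integral_prod_range_infinitePi (fun j => blockLaw (sfiniteSeq M j))
      (fun _ b => Complex.exp (Complex.I * ((blockSum φ b : ℝ) : ℂ))) (fun _ => hm)]
    refine Finset.prod_congr rfl fun j _ => ?_
    simp_rw [hexp]
    exact integral_prod_blockLaw _ hmh hbh
  have hR : Tendsto (fun N : ℕ => Complex.exp (∑ j ∈ Finset.range N,
      ∫ x, (h x - 1) ∂(sfiniteSeq M j))) atTop (𝓝 (Complex.exp (∫ x, (h x - 1) ∂M))) := by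
    have hsum : HasSum (fun j => ∫ x, (h x - 1) ∂(sfiniteSeq M j)) (∫ x, (h x - 1) ∂M) := by
      have := hasSum_integral_measure (μ := sfiniteSeq M) (f := fun x => h x - 1)
        (by rwa [sum_sfiniteSeq])
      rwa [sum_sfiniteSeq] at this
    exact (Complex.continuous_exp.tendsto _).comp hsum.tendsto_sum_nat
  refine tendsto_nhds_unique ?_ hR
  simp_rw [← hpart]
  refine tendsto_integral_of_dominated_convergence (fun _ => (1 : ℝ)) (fun N => ?_)
    (integrable_const _) (fun N => .of_forall fun ω => ?_) ?_
  · have : Measurable fun ω : ℕ → ℕ × (ℕ → X) => ∑ j ∈ Finset.range N, blockSum φ (ω j) :=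
      Finset.measurable_sum _ fun j _ => (measurable_blockSum hφ).comp (measurable_pi_apply j)
    exact Measurable.aestronglyMeasurable (by fun_prop)
  · rw [mul_comm, Complex.norm_exp_ofReal_mul_I]
  · filter_upwards [ae_tsum_blockSum_lt_top M (f := fun x => ‖φ x‖ₑ) hφ.enorm hφM] with ω hω
    have hs : Summable fun j => blockSum φ (ω j) := summable_blockSum (fun _ => le_rfl) hω
    exact ((by fun_prop : Continuous fun x : ℝ => Complex.exp (Complex.I * (x : ℂ))).tendsto _).comp
      hs.hasSum.tendsto_sum_nat

end PoissonRandomMeasure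

/-! ### Construction of the Lévy process -/

/-- The contribution at time `t` of a jump `x.2` that takes place at time `x.1`. -/
def jumpBefore (t : ℝ≥0) (x : ℝ × Space d) : Space d :=
  (Ioc (0 : ℝ) t).indicator (fun _ => x.2) x.1

lemma jumpBefore_of_mem {t : ℝ≥0} {x : ℝ × Space d} (h : x.1 ∈ Ioc (0 : ℝ) t) :
    jumpBefore t x = x.2 := indicator_of_mem h _

lemma jumpBefore_of_notMem {t : ℝ≥0} {x : ℝ × Space d} (h : x.1 ∉ Ioc (0 : ℝ) t) :
    jumpBefore t x = 0 := indicator_of_notMem h _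

/-- The intensity `dt ν(dp)` of the Poisson random measure of jumps. -/
abbrev jumpIntensity (ν : Measure (Space d)) : Measure (ℝ × Space d) :=
  (volume : Measure ℝ).prod ν

/-- The pure-jump process which at time `t` is the sum of all jumps up to time `t`. -/
def jumpProcess (t : ℝ≥0) (ω : ℕ → ℕ × (ℕ → ℝ × Space d)) : Space d :=
  ∑' j, blockSum (jumpBefore t) (ω j)

lemma measurable_jumpBefore (t : ℝ≥0) : Measurable (jumpBefore (d := d) t) := by
  have : (jumpBefore (d := d) t) = ((Ioc (0 : ℝ) t) ×ˢ univ).indicator Prod.snd := by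
    ext1 x
    by_cases h : x.1 ∈ Ioc (0 : ℝ) t
    · rw [jumpBefore_of_mem h, indicator_of_mem (by simpa using h)]
    · rw [jumpBefore_of_notMem h, indicator_of_notMem (by simpa using h)]
  rw [this]
  exact measurable_snd.indicator (measurableSet_Ioc.prod MeasurableSet.univ)

lemma measurable_jumpProcess (t : ℝ≥0) : Measurable (jumpProcess (d := d) t) :=
  Measurable.tsum fun j => (measurable_blockSum (measurable_jumpBefore t)).comp
    (measurable_pi_apply j)

lemma jumpProcess_zero (ω : ℕ → ℕ × (ℕ → ℝ × Space d)) : jumpProcess 0 ω = 0 := by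
  have : (jumpBefore (d := d) 0) = 0 := by ext1 x; simp [jumpBefore]
  simp [jumpProcess, this, blockSum]

lemma lintegral_jumpBefore (ν : Measure (Space d)) [SFinite ν] (t : ℝ≥0) :
    ∫⁻ x, ‖jumpBefore t x‖ₑ ∂(jumpIntensity ν) = t * ∫⁻ p, ‖p‖ₑ ∂ν := by
  have : ∀ x : ℝ × Space d, ‖jumpBefore t x‖ₑ
      = (Ioc (0 : ℝ) t).indicator (fun _ => (1 : ℝ≥0∞)) x.1 * ‖x.2‖ₑ := fun x => by
    by_cases h : x.1 ∈ Ioc (0 : ℝ) t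
    · rw [jumpBefore_of_mem h, indicator_of_mem h, one_mul]
    · rw [jumpBefore_of_notMem h, indicator_of_notMem h, enorm_zero, zero_mul]
  simp_rw [this]
  rw [lintegral_prod_mul (by fun_prop (disch := measurability)) (by fun_prop),
    lintegral_indicator measurableSet_Ioc]
  simp

/-- Almost surely the jumps are summable over every bounded time interval. -/
lemma ae_jumps_summable (ν : Measure (Space d)) [SFinite ν] (hν : ∫⁻ p, ‖p‖ₑ ∂ν < ⊤) :
    ∀ᵐ ω ∂(poissonLaw (jumpIntensity ν)), ∀ N : ℕ,
      ∑' j, blockSum (fun x => ‖jumpBefore (d := d) N x‖ₑ) (ω j) < ⊤ := by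
  rw [ae_all_iff]
  intro N
  refine ae_tsum_blockSum_lt_top _ (measurable_jumpBefore _).enorm ?_
  rw [lintegral_jumpBefore]
  exact ENNReal.mul_lt_top ENNReal.coe_lt_top hν

lemma enorm_jumpBefore_mono {s t : ℝ≥0} (h : s ≤ t) (x : ℝ × Space d) :
    ‖jumpBefore s x‖ₑ ≤ ‖jumpBefore t x‖ₑ := by
  by_cases hs : x.1 ∈ Ioc (0 : ℝ) s
  · rw [jumpBefore_of_mem hs, jumpBefore_of_mem ⟨hs.1, hs.2.trans (by exact_mod_cast h)⟩]
  · rw [jumpBefore_of_notMem hs]; simp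

lemma summable_jumps {ω : ℕ → ℕ × (ℕ → ℝ × Space d)}
    (hω : ∀ N : ℕ, ∑' j, blockSum (fun x => ‖jumpBefore (d := d) N x‖ₑ) (ω j) < ⊤) (t : ℝ≥0) :
    Summable fun j => blockSum (jumpBefore t) (ω j) := by
  obtain ⟨N, hN⟩ := exists_nat_ge t
  exact summable_blockSum (enorm_jumpBefore_mono hN) (hω N)

/-- Limits of the jump process are computed jump by jump, by dominated convergence. -/
lemma exists_tendsto_jumpProcess {ω : ℕ → ℕ × (ℕ → ℝ × Space d)}
    (hω : ∀ N : ℕ, ∑' j, blockSum (fun x => ‖jumpBefore (d := d) N x‖ₑ) (ω j) < ⊤) (t : ℝ≥0)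
    {l : Filter ℝ≥0} (hl : l ≤ 𝓝 t) (g : ℝ × Space d → Space d)
    (hg : ∀ x, Tendsto (fun s => jumpBefore s x) l (𝓝 (g x))) :
    Tendsto (fun s => jumpProcess s ω) l (𝓝 (∑' j, blockSum g (ω j))) := by
  obtain ⟨N, hN⟩ := exists_nat_gt t
  have hsum : Summable fun j => (blockSum (fun x => ‖jumpBefore (d := d) N x‖ₑ) (ω j)).toReal :=
    ENNReal.summable_toReal (hω N).ne
  refine tendsto_tsum_of_dominated_convergence hsum (fun j => ?_) ?_
  · exact tendsto_finsetSum _ fun i _ => hg _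
  · filter_upwards [hl (Iic_mem_nhds hN)] with s hs j
    have hfin : blockSum (fun x => ‖jumpBefore (d := d) N x‖ₑ) (ω j) ≠ ⊤ :=
      ((ENNReal.le_tsum j).trans_lt (hω N)).ne
    rw [← toReal_enorm]
    refine ENNReal.toReal_mono hfin ((enorm_blockSum_le _ _).trans ?_)
    exact Finset.sum_le_sum fun i _ => enorm_jumpBefore_mono hs _

lemma isCadlag_jumpProcess {ω : ℕ → ℕ × (ℕ → ℝ × Space d)}
    (hω : ∀ N : ℕ, ∑' j, blockSum (fun x => ‖jumpBefore (d := d) N x‖ₑ) (ω j) < ⊤) :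
    IsCadlag fun t => jumpProcess t ω := by
  intro t
  constructor
  · refine exists_tendsto_jumpProcess hω t nhdsWithin_le_nhds _ fun x => ?_
    refine tendsto_const_nhds.congr' ?_
    by_cases hx : x.1 ≤ t
    · filter_upwards [self_mem_nhdsWithin] with s hs
      have hs' : (t : ℝ) ≤ s := by exact_mod_cast hs
      by_cases h0 : 0 < x.1
      · rw [jumpBefore_of_mem ⟨h0, hx⟩, jumpBefore_of_mem ⟨h0, hx.trans hs'⟩]
      · rw [jumpBefore_of_notMem fun h => h0 h.1, jumpBefore_of_notMem fun h => h0 h.1]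
    · have : ∀ᶠ s : ℝ≥0 in 𝓝 t, (s : ℝ) < x.1 :=
        (NNReal.continuous_coe.tendsto t).eventually (gt_mem_nhds (not_le.1 hx))
      filter_upwards [nhdsWithin_le_nhds this] with s hs
      rw [jumpBefore_of_notMem fun h => hx h.2,
        jumpBefore_of_notMem fun h => (not_le.2 hs) h.2]
  · refine ⟨_, exists_tendsto_jumpProcess hω t nhdsWithin_le_nhds
      (fun x => (Ioo (0 : ℝ) t).indicator (fun _ => x.2) x.1) fun x => ?_⟩
    refine tendsto_const_nhds.congr' ?_
    by_cases hx : x.1 < t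
    · have : ∀ᶠ s : ℝ≥0 in 𝓝 t, x.1 < (s : ℝ) :=
        (NNReal.continuous_coe.tendsto t).eventually (lt_mem_nhds hx)
      filter_upwards [nhdsWithin_le_nhds this] with s hs
      by_cases h0 : 0 < x.1
      · rw [jumpBefore_of_mem ⟨h0, hs.le⟩, indicator_of_mem (show x.1 ∈ Ioo (0 : ℝ) t from ⟨h0, hx⟩)]
      · rw [jumpBefore_of_notMem fun h => h0 h.1, indicator_of_notMem fun h : x.1 ∈ Ioo (0 : ℝ) t => h0 h.1]
    · filter_upwards [self_mem_nhdsWithin] with s hs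
      have hs' : (s : ℝ) < t := by exact_mod_cast hs
      rw [jumpBefore_of_notMem fun h => hx (h.2.trans_lt hs'),
        indicator_of_notMem fun h : x.1 ∈ Ioo (0 : ℝ) t => hx h.2]

/-- The joint characteristic function of the increments of the jump process. The phase, as a
function of the jump time, is constant on each of the disjoint intervals `(tᵢ, tᵢ₊₁]`. -/
lemma integral_exp_increments (ν : Measure (Space d)) [SFinite ν] (hν : ∫⁻ p, ‖p‖ₑ ∂ν < ⊤)
    (n : ℕ) (t : Fin (n + 1) → ℝ≥0) (ht : Monotone t) (q : Fin n → Space d) :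
    ∫ ω, Complex.exp (Complex.I *
        ((∑ i, ⟪q i, jumpProcess (t i.succ) ω - jumpProcess (t i.castSucc) ω⟫ : ℝ) : ℂ))
        ∂(poissonLaw (jumpIntensity ν))
      = ∏ i, Complex.exp (((t i.succ : ℝ) - t i.castSucc : ℝ) *
          ∫ p, (Complex.exp (Complex.I * (⟪p, q i⟫ : ℝ)) - 1) ∂ν) := by
  set A : Fin n → Set ℝ := fun i => Ioc (t i.castSucc : ℝ) (t i.succ) with hA
  set φ : ℝ × Space d → ℝ := fun x =>
    ∑ i, ⟪q i, jumpBefore (t i.succ) x - jumpBefore (t i.castSucc) x⟫ with hφ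
  have hdiff : ∀ i x, jumpBefore (d := d) (t i.succ) x - jumpBefore (t i.castSucc) x
      = (A i).indicator (fun _ => x.2) x.1 := by
    intro i x
    have hle : (t i.castSucc : ℝ) ≤ t i.succ := by exact_mod_cast ht (Fin.castSucc_le_succ i)
    have h0 : (0 : ℝ) ≤ t i.castSucc := NNReal.coe_nonneg _
    simp only [jumpBefore, hA, indicator, mem_Ioc]
    split_ifs <;> first | (simp; done) | (exfalso; grind)
  have hmφ : Measurable φ := by
    refine Finset.measurable_sum _ fun i _ => ?_
    have h1 := measurable_jumpBefore (d := d) (t i.succ)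
    have h2 := measurable_jumpBefore (d := d) (t i.castSucc)
    exact measurable_const.inner (h1.sub h2)
  have hφint : ∫⁻ x, ‖φ x‖ₑ ∂(jumpIntensity ν) < ⊤ := by
    have hle : ∀ x, ‖φ x‖ₑ ≤ ∑ i, ‖q i‖ₑ *
        (‖jumpBefore (d := d) (t i.succ) x‖ₑ + ‖jumpBefore (d := d) (t i.castSucc) x‖ₑ) := by
      intro x
      refine (enorm_sum_le _ _).trans (Finset.sum_le_sum fun i _ => ?_)
      refine le_trans ?_ (mul_le_mul_right (enorm_sub_le) _)
      rw [← enorm_norm (q i), ← enorm_norm (_ - _), ← enorm_mul, enorm_le_iff_norm_le]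
      rw [Real.norm_of_nonneg (mul_nonneg (norm_nonneg (q i)) (norm_nonneg _))]
      exact norm_inner_le_norm _ _
    refine (lintegral_mono hle).trans_lt ?_
    have hm : ∀ s, Measurable fun x => ‖jumpBefore (d := d) s x‖ₑ :=
      fun s => (measurable_jumpBefore s).enorm
    rw [lintegral_finsetSum _ fun i _ => by fun_prop]
    refine ENNReal.sum_lt_top.2 fun i _ => ?_
    rw [lintegral_const_mul _ (by fun_prop), lintegral_add_left (hm _),
      lintegral_jumpBefore, lintegral_jumpBefore]
    exact ENNReal.mul_lt_top enorm_lt_top (ENNReal.add_lt_top.2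
      ⟨ENNReal.mul_lt_top ENNReal.coe_lt_top hν, ENNReal.mul_lt_top ENNReal.coe_lt_top hν⟩)
  have hsum : ∀ᵐ ω ∂(poissonLaw (jumpIntensity ν)),
      ∑ i, ⟪q i, jumpProcess (t i.succ) ω - jumpProcess (t i.castSucc) ω⟫
        = ∑' j, blockSum φ (ω j) := by
    filter_upwards [ae_jumps_summable ν hν] with ω hω
    have hs := summable_jumps hω
    have h1 : ∀ i, HasSum (fun j => ⟪q i, blockSum (jumpBefore (t i.succ)) (ω j)
        - blockSum (jumpBefore (t i.castSucc)) (ω j)⟫)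
        ⟪q i, jumpProcess (t i.succ) ω - jumpProcess (t i.castSucc) ω⟫ := fun i =>
      ((hs _).hasSum.sub (hs _).hasSum).mapL (innerSL ℝ (q i))
    rw [← (hasSum_sum fun i _ => h1 i).tsum_eq]
    refine tsum_congr fun j => ?_
    simp only [blockSum, hφ]
    rw [Finset.sum_comm]
    refine Finset.sum_congr rfl fun i _ => ?_
    rw [← Finset.sum_sub_distrib, inner_sum]
  rw [integral_congr_ae (hsum.mono fun ω h => by rw [h]),
    integral_exp_tsum_blockSum _ hmφ hφint, ← Complex.exp_sum]
  congr 1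
  have hdisj : ∀ x : ℝ × Space d, Complex.exp (Complex.I * (φ x : ℝ)) - 1
      = ∑ i, (A i).indicator (fun _ => (1 : ℂ)) x.1
          * (Complex.exp (Complex.I * (⟪x.2, q i⟫ : ℝ)) - 1) := by
    intro x
    simp only [hφ, hdiff]
    by_cases h : ∃ i, x.1 ∈ A i
    · obtain ⟨i, hi⟩ := h
      have hne : ∀ j, j ≠ i → x.1 ∉ A j := by
        intro j hji hj
        have h1 := hj.1; have h2 := hj.2; have h3 := hi.1; have h4 := hi.2
        rcases lt_or_gt_of_ne hji with hlt | hlt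
        · have : (t j.succ : ℝ) ≤ t i.castSucc := by
            exact_mod_cast ht (Fin.succ_le_castSucc_iff.2 hlt)
          linarith
        · have : (t i.succ : ℝ) ≤ t j.castSucc := by
            exact_mod_cast ht (Fin.succ_le_castSucc_iff.2 hlt)
          linarith
      rw [Finset.sum_eq_single i, Finset.sum_eq_single i]
      · simp [hi, real_inner_comm]
      · intro j _ hj; simp [hne j hj]
      · simp
      · intro j _ hj; simp [hne j hj]
      · simp
    · push Not at h
      simp [h]
  simp_rw [hdisj]
  have hνint : ∀ i, Integrable (fun p => Complex.exp (Complex.I * (⟪p, q i⟫ : ℝ)) - 1) ν := by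
    intro i
    refine ⟨Continuous.aestronglyMeasurable (by fun_prop), ?_⟩
    refine (lintegral_mono (g := fun p => ‖q i‖ₑ * ‖p‖ₑ) fun p => ?_).trans_lt ?_
    · show _ ≤ ‖q i‖ₑ * ‖p‖ₑ
      rw [← enorm_norm (q i), ← enorm_norm p, ← enorm_mul, enorm_le_iff_norm_le,
        Real.norm_of_nonneg (by positivity), mul_comm]
      exact (norm_exp_I_mul_sub_one_le _).trans (abs_real_inner_le_norm p (q i))
    · rw [lintegral_const_mul _ (by fun_prop)]
      exact ENNReal.mul_lt_top enorm_lt_top hν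
  have hAint : ∀ i, Integrable ((A i).indicator fun _ => (1 : ℂ)) (volume : Measure ℝ) := fun i =>
    (integrable_indicator_iff measurableSet_Ioc).2
      (integrableOn_const measure_Ioc_lt_top.ne)
  rw [integral_finsetSum _ fun i _ => (hAint i).mul_prod (hνint i)]
  refine Finset.sum_congr rfl fun i _ => ?_
  rw [integral_prod_mul (fun s => (A i).indicator (fun _ => (1 : ℂ)) s)
    (fun p => Complex.exp (Complex.I * (⟪p, q i⟫ : ℝ)) - 1), integral_indicator measurableSet_Ioc]
  have hle : (t i.castSucc : ℝ) ≤ t i.succ := by exact_mod_cast ht (Fin.castSucc_le_succ i)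
  simp [hle]

lemma charFun_increment (ν : Measure (Space d)) [SFinite ν] (hν : ∫⁻ p, ‖p‖ₑ ∂ν < ⊤)
    {s t : ℝ≥0} (hst : s ≤ t) (q : Space d) :
    ∫ ω, Complex.exp (Complex.I * (⟪q, jumpProcess t ω - jumpProcess s ω⟫ : ℝ))
        ∂(poissonLaw (jumpIntensity ν))
      = Complex.exp (((t : ℝ) - s : ℝ) * ∫ p, (Complex.exp (Complex.I * (⟪p, q⟫ : ℝ)) - 1) ∂ν) := by
  have hmono : Monotone ![s, t] := by
    refine Fin.monotone_iff_le_succ.2 fun i => ?_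
    fin_cases i
    simpa using hst
  simpa using integral_exp_increments ν hν 1 ![s, t] hmono fun _ => q

lemma charFun_map_eq {Ω : Type*} [MeasurableSpace Ω] {P : Measure Ω} {Y : Ω → Space d}
    (hY : AEMeasurable Y P) (q : Space d) :
    charFun (P.map Y) q = ∫ ω, Complex.exp (Complex.I * (⟪q, Y ω⟫ : ℝ)) ∂P := by
  rw [charFun_apply, integral_map hY (Continuous.aestronglyMeasurable (by fun_prop))]
  simp_rw [mul_comm Complex.I, real_inner_comm]

lemma isLevyProcess_jumpProcess (ν : Measure (Space d)) [SFinite ν] (hν : ∫⁻ p, ‖p‖ₑ ∂ν < ⊤) :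
    IsLevyProcess jumpProcess (poissonLaw (jumpIntensity ν)) where
  measurable := measurable_jumpProcess
  zero := .of_forall jumpProcess_zero
  cadlag := (ae_jumps_summable ν hν).mono fun ω hω => isCadlag_jumpProcess hω
  stationary_increments s t := by
    have hm : ∀ s t : ℝ≥0, Measurable fun ω => jumpProcess (d := d) t ω - jumpProcess s ω :=
      fun s t => (measurable_jumpProcess t).sub (measurable_jumpProcess s)
    refine ⟨(hm _ _).aemeasurable, (hm _ _).aemeasurable, ?_⟩
    have := Measure.isProbabilityMeasure_map (μ := poissonLaw (jumpIntensity ν))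
      (hm s (s + t)).aemeasurable
    have := Measure.isProbabilityMeasure_map (μ := poissonLaw (jumpIntensity ν))
      (hm 0 t).aemeasurable
    refine Measure.ext_of_charFun (funext fun q => ?_)
    rw [charFun_map_eq (hm _ _).aemeasurable, charFun_map_eq (hm _ _).aemeasurable,
      charFun_increment ν hν le_self_add, charFun_increment ν hν zero_le]
    simp
  indep_increments := by
    intro n t ht
    have hm : ∀ i : Fin n, Measurable fun ω =>
        jumpProcess (d := d) (t i.succ) ω - jumpProcess (t i.castSucc) ω :=
      fun i => (measurable_jumpProcess _).sub (measurable_jumpProcess _)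
    rw [iIndepFun_iff_charFun_pi fun i => (hm i).aemeasurable]
    intro q
    have hm' : Measurable fun ω => WithLp.toLp 2 fun i : Fin n =>
        jumpProcess (d := d) (t i.succ) ω - jumpProcess (t i.castSucc) ω :=
      (WithLp.measurable_toLp _ _).comp (measurable_pi_lambda _ hm)
    rw [charFun_apply, integral_map hm'.aemeasurable (Continuous.aestronglyMeasurable (by fun_prop))]
    rw [Finset.prod_congr rfl fun i _ => (charFun_map_eq (hm i).aemeasurable (q i)).trans
      (charFun_increment ν hν (ht (Fin.castSucc_le_succ i)) (q i)),
      ← integral_exp_increments ν hν n t ht fun i => q i]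
    refine integral_congr_ae (.of_forall fun ω => ?_)
    simp only [PiLp.inner_apply, mul_comm Complex.I]
    congr 3
    exact Finset.sum_congr rfl fun i _ => Finset.sum_congr rfl fun j _ => real_inner_comm _ _

lemma isPureJumpLevyProcess_jumpProcess (hd : 1 ≤ d) {σ : Space d → ℝ} (hσ : IsJumpKernel σ) :
    IsPureJumpLevyProcess jumpProcess (poissonLaw (jumpIntensity (jumpMeasure σ)))
      (jumpMeasure σ) where
  levy := isLevyProcess_jumpProcess _ hσ.lintegral_norm_jumpMeasure
  no_atom_zero := IsJumpKernel.jumpMeasure_zero hd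
  finite_variation :=
    (lintegral_mono fun p => min_le_right _ _).trans_lt hσ.lintegral_norm_jumpMeasure
  charExponent t q := by
    simpa [jumpProcess_zero] using
      charFun_increment (jumpMeasure σ) hσ.lintegral_norm_jumpMeasure (zero_le (a := t)) q

lemma hasCharExponent_jumpProcess (hd : 1 ≤ d) {σ : Space d → ℝ} (hσ : IsJumpKernel σ) :
    HasCharExponent jumpProcess (poissonLaw (jumpIntensity (jumpMeasure σ)))
      (levyExponent σ) := by
  intro t q
  rw [(isPureJumpLevyProcess_jumpProcess hd hσ).charExponent t q]
  simp only [hσ.integral_jumpMeasure, levyExponent]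

/-! ### The joint law of a Lévy process and its time integral -/

/-- Right-hand Riemann sums of a bounded right-continuous function converge to its integral. -/
lemma tendsto_riemannSum {V : Type*} [NormedAddCommGroup V] [NormedSpace ℝ V] [CompleteSpace V]
    {f : ℝ → V} {t : ℝ} (ht : 0 < t) {C : ℝ} (hC : ∀ s ∈ Icc 0 t, ‖f s‖ ≤ C)
    (hf : ∀ s ∈ Ioo 0 t, ContinuousWithinAt f (Ici s) s) :
    Tendsto (fun n : ℕ => (t / (n + 1)) • ∑ i ∈ Finset.range (n + 1), f ((i + 1) * (t / (n + 1))))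
      atTop (𝓝 (∫ s in (0 : ℝ)..t, f s)) := by
  set pt : ℕ → ℝ → ℝ := fun n s => ⌈s / (t / (n + 1))⌉₊ * (t / (n + 1)) with hpt
  have hpos : ∀ n : ℕ, 0 < t / ((n : ℝ) + 1) := fun n => by positivity
  have hsm : ∀ n, StronglyMeasurable fun s => f (pt n s) := fun n => by
    have h1 : StronglyMeasurable fun k : ℕ => f (k * (t / (n + 1))) := .of_discrete
    exact h1.comp_measurable (Nat.measurable_ceil.comp (measurable_id.div_const _))
  have hge : ∀ n s, s ≤ pt n s := fun n s => by
    rw [hpt, ← div_le_iff₀ (hpos n)]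
    exact Nat.le_ceil _
  have hle : ∀ n, ∀ s, 0 ≤ s → pt n s ≤ s + t / (n + 1) := fun n s hs => by
    have := (Nat.ceil_lt_add_one (div_nonneg hs (hpos n).le)).le
    calc pt n s ≤ (s / (t / (n + 1)) + 1) * (t / (n + 1)) :=
          mul_le_mul_of_nonneg_right this (hpos n).le
      _ = s + t / (n + 1) := by rw [add_mul, div_mul_cancel₀ _ (hpos n).ne', one_mul]
  have hmem : ∀ n, ∀ s ∈ Ioc 0 t, pt n s ∈ Icc 0 t := fun n s hs => by
    refine ⟨hs.1.le.trans (hge n s), ?_⟩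
    have h1 : s / (t / (n + 1)) ≤ ((n + 1 : ℕ) : ℝ) := by
      rw [div_le_iff₀ (hpos n)]
      push_cast
      rw [mul_div_cancel₀ _ (by positivity)]
      exact hs.2
    have h2 : (⌈s / (t / (n + 1))⌉₊ : ℝ) ≤ ((n + 1 : ℕ) : ℝ) := by
      exact_mod_cast Nat.ceil_le.2 h1
    calc pt n s ≤ ((n + 1 : ℕ) : ℝ) * (t / (n + 1)) := mul_le_mul_of_nonneg_right h2 (hpos n).le
      _ = t := by push_cast; exact mul_div_cancel₀ _ (by positivity)
  have hint : ∀ n, IntegrableOn (fun s => f (pt n s)) (Ioc 0 t) := fun n =>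
    Measure.integrableOn_of_bounded measure_Ioc_lt_top.ne (hsm n).aestronglyMeasurable
      (M := C) ((ae_restrict_iff' measurableSet_Ioc).2 (.of_forall fun s hs => hC _ (hmem n s hs)))
  have hsum : ∀ n : ℕ, ∫ s in (0 : ℝ)..t, f (pt n s)
      = (t / (n + 1)) • ∑ i ∈ Finset.range (n + 1), f ((i + 1) * (t / (n + 1))) := by
    intro n
    set a : ℕ → ℝ := fun i => i * (t / (n + 1)) with ha
    have ha0 : a 0 = 0 := by simp [ha]
    have ha1 : a (n + 1) = t := by
      simp only [ha]; push_cast; exact mul_div_cancel₀ _ (by positivity)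
    have hmono : Monotone a := fun i j hij => by
      simp only [ha]; exact mul_le_mul_of_nonneg_right (by exact_mod_cast hij) (hpos n).le
    have hii : ∀ k < n + 1, IntervalIntegrable (fun s => f (pt n s)) volume (a k) (a (k + 1)) := by
      intro k hk
      rw [intervalIntegrable_iff_integrableOn_Ioc_of_le (hmono k.le_succ)]
      refine (hint n).mono_set (Ioc_subset_Ioc ?_ ?_)
      · rw [← ha0]; exact hmono (Nat.zero_le _)
      · rw [← ha1]; exact hmono hk
    have h0 := intervalIntegral.sum_integral_adjacent_intervals hii
    rw [ha0, ha1] at h0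
    rw [← h0, Finset.smul_sum]
    refine Finset.sum_congr rfl fun i _ => ?_
    have hcongr : ∀ s ∈ Ioc (a i) (a (i + 1)), f (pt n s) = f ((i + 1) * (t / (n + 1))) := by
      intro s hs
      have hceil : ⌈s / (t / (n + 1))⌉₊ = i + 1 := by
        rw [Nat.ceil_eq_iff (by omega), lt_div_iff₀ (hpos n), div_le_iff₀ (hpos n)]
        simpa [ha] using hs
      simp only [hpt, hceil]
      push_cast
      rfl
    rw [intervalIntegral.integral_of_le (hmono i.le_succ),
      setIntegral_congr_fun measurableSet_Ioc hcongr, setIntegral_const]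
    congr 1
    rw [measureReal_def, Real.volume_Ioc, ENNReal.toReal_ofReal (sub_nonneg.2 (hmono i.le_succ))]
    simp only [ha]
    push_cast
    ring
  simp_rw [← hsum, intervalIntegral.integral_of_le ht.le]
  refine tendsto_integral_of_dominated_convergence (fun _ => C)
    (fun n => (hsm n).aestronglyMeasurable) (integrableOn_const measure_Ioc_lt_top.ne)
    (fun n => (ae_restrict_iff' measurableSet_Ioc).2 (.of_forall fun s hs => hC _ (hmem n s hs))) ?_
  have hne : ∀ᵐ s : ℝ, s ≠ t := by simp [ae_iff]
  rw [ae_restrict_iff' measurableSet_Ioc]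
  filter_upwards [hne] with s hst hs
  refine (hf s ⟨hs.1, lt_of_le_of_ne hs.2 hst⟩).tendsto.comp ?_
  refine tendsto_nhdsWithin_iff.2 ⟨?_, .of_forall fun n => hge n s⟩
  have hlim : Tendsto (fun n : ℕ => s + t / ((n : ℝ) + 1)) atTop (𝓝 (s + 0)) :=
    tendsto_const_nhds.add (tendsto_const_div_atTop_nhds_zero_nat t |>.comp (tendsto_add_atTop_nat 1)
      |>.congr fun n => by simp)
  rw [add_zero] at hlim
  exact tendsto_of_tendsto_of_tendsto_of_le_of_le tendsto_const_nhds hlim (fun n => hge n s)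
    fun n => hle n s hs.1.le

lemma IsCadlag.bddOn {f : ℝ≥0 → Space d} (hf : IsCadlag f) (T : ℝ≥0) :
    ∃ C, ∀ s ≤ T, ‖f s‖ ≤ C := by
  have key : ∃ C, ∀ s ∈ Icc 0 T, ‖f s‖ ≤ C := by
    refine isCompact_Icc.induction_on (p := fun S => ∃ C, ∀ s ∈ S, ‖f s‖ ≤ C) ⟨0, by simp⟩ ?_ ?_ ?_
    · rintro S S' hS ⟨C, hC⟩
      exact ⟨C, fun s hs => hC s (hS hs)⟩
    · rintro S S' ⟨C, hC⟩ ⟨C', hC'⟩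
      refine ⟨max C C', fun s hs => ?_⟩
      rcases hs with hs | hs
      · exact (hC s hs).trans (le_max_left _ _)
      · exact (hC' s hs).trans (le_max_right _ _)
    · intro t _
      obtain ⟨hr, l, hl⟩ := hf t
      have h1 : ∀ᶠ s in 𝓝[≥] t, ‖f s‖ < ‖f t‖ + 1 :=
        hr.norm.tendsto.eventually (gt_mem_nhds (by linarith))
      have h2 : ∀ᶠ s in 𝓝[<] t, ‖f s‖ < ‖l‖ + 1 :=
        hl.norm.eventually (gt_mem_nhds (by linarith))
      have h3 : ∀ᶠ s in 𝓝 t, ‖f s‖ ≤ max (‖f t‖ + 1) (‖l‖ + 1) := by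
        rw [← nhdsLT_sup_nhdsGE, eventually_sup]
        exact ⟨h2.mono fun s hs => hs.le.trans (le_max_right _ _),
          h1.mono fun s hs => hs.le.trans (le_max_left _ _)⟩
      exact ⟨_, nhdsWithin_le_nhds h3, _, fun s hs => hs⟩
  obtain ⟨C, hC⟩ := key
  exact ⟨C, fun s hs => hC s ⟨zero_le, hs⟩⟩

lemma IsCadlag.continuousWithinAt_toNNReal {f : ℝ≥0 → Space d} (hf : IsCadlag f) (s : ℝ) :
    ContinuousWithinAt (fun s : ℝ => f s.toNNReal) (Ici s) s :=
  (hf s.toNNReal).1.comp continuous_real_toNNReal.continuousWithinAt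
    fun _ h => Real.toNNReal_le_toNNReal h

lemma IsCadlag.tendsto_riemannSum {f : ℝ≥0 → Space d} (hf : IsCadlag f) {t : ℝ≥0} (ht : 0 < t) :
    Tendsto (fun n : ℕ => ((t : ℝ) / (n + 1)) • ∑ i ∈ Finset.range (n + 1),
      f ((((i + 1 : ℕ) : ℝ≥0)) * (t / (n + 1)))) atTop (𝓝 (∫ s in (0 : ℝ)..t, f s.toNNReal)) := by
  obtain ⟨C, hC⟩ := hf.bddOn t
  have h := RadiativeTransfer.tendsto_riemannSum (f := fun s : ℝ => f s.toNNReal) (t := t)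
    (by exact_mod_cast ht) (C := C) (fun s hs => hC _ (Real.toNNReal_le_iff_le_coe.2 hs.2))
    fun s _ => hf.continuousWithinAt_toNNReal s
  refine h.congr fun n => ?_
  congr 1
  refine Finset.sum_congr rfl fun i _ => ?_
  congr 1
  rw [← NNReal.coe_inj, Real.coe_toNNReal _ (by positivity)]
  push_cast
  ring

lemma sum_range_succ_eq_sum_increments {V : Type*} [AddCommGroup V] [Module ℝ V] {x : ℕ → V}
    (hx : x 0 = 0) (N : ℕ) :
    ∑ i ∈ Finset.range N, x (i + 1)
      = ∑ j ∈ Finset.range N, ((N : ℝ) - j) • (x (j + 1) - x j) := by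
  induction N with
  | zero => simp
  | succ N ih =>
    rw [Finset.sum_range_succ, ih, Finset.sum_range_succ _ N]
    have h1 : ∑ j ∈ Finset.range N, (((N + 1 : ℕ) : ℝ) - j) • (x (j + 1) - x j)
        = ∑ j ∈ Finset.range N, ((N : ℝ) - j) • (x (j + 1) - x j) + x N := by
      have h2 : x N = ∑ j ∈ Finset.range N, (x (j + 1) - x j) := by
        rw [Finset.sum_range_sub, hx, sub_zero]
      conv_rhs => rw [h2]
      rw [← Finset.sum_add_distrib]
      refine Finset.sum_congr rfl fun j _ => ?_
      push_cast
      module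
    rw [h1]
    push_cast
    module

section LevyLaw

variable {Ω : Type*} [MeasurableSpace Ω] {P : Measure Ω} {L : ℝ≥0 → Ω → Space d}
  {Ψ : Space d → ℂ}

/-- The displacement `(-∫₀ᵗ L_s ds, L_t)` of the phase space point. -/
def displacement (L : ℝ≥0 → Ω → Space d) (t : ℝ≥0) (ω : Ω) : Space d × Space d :=
  (- ∫ s in (0 : ℝ)..t, L s.toNNReal ω, L t ω)

/-- The right-hand Riemann sums approximating the time integral of the process. -/
def riemannSum (L : ℝ≥0 → Ω → Space d) (t : ℝ≥0) (n : ℕ) (ω : Ω) : Space d :=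
  ((t : ℝ) / (n + 1)) • ∑ i ∈ Finset.range (n + 1), L (((i + 1 : ℕ) : ℝ≥0) * (t / (n + 1))) ω

lemma measurable_riemannSum (hL : IsLevyProcess L P) (t : ℝ≥0) (n : ℕ) :
    Measurable (riemannSum L t n) :=
  (Finset.measurable_sum _ fun _ _ => hL.measurable _).const_smul ((t : ℝ) / (n + 1))

lemma ae_tendsto_riemannSum (hL : IsLevyProcess L P) {t : ℝ≥0} (ht : 0 < t) :
    ∀ᵐ ω ∂P, Tendsto (fun n => riemannSum L t n ω) atTop
      (𝓝 (∫ s in (0 : ℝ)..t, L s.toNNReal ω)) :=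
  hL.cadlag.mono fun _ hω => hω.tendsto_riemannSum ht

lemma aemeasurable_displacement (hL : IsLevyProcess L P) (t : ℝ≥0) :
    AEMeasurable (displacement L t) P := by
  refine AEMeasurable.prodMk (AEMeasurable.neg ?_) (hL.measurable t).aemeasurable
  rcases eq_zero_or_pos t with rfl | ht
  · simp
  · exact aemeasurable_of_tendsto_metrizable_ae atTop
      (fun n => (measurable_riemannSum hL t n).aemeasurable) (ae_tendsto_riemannSum hL ht)

lemma integral_exp_increment (hL : IsLevyProcess L P) (hΨ : HasCharExponent L P Ψ)
    (s t : ℝ≥0) (q : Space d) :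
    ∫ ω, Complex.exp (Complex.I * (⟪q, L (s + t) ω - L s ω⟫ : ℝ)) ∂P
      = Complex.exp ((t : ℝ) * Ψ q) := by
  rw [← hΨ t q]
  have h1 := ((hL.stationary_increments s t).comp (u := fun y : Space d =>
    Complex.exp (Complex.I * (⟪q, y⟫ : ℝ))) (by fun_prop)).integral_eq
  simp only [Function.comp_def] at h1
  rw [h1]
  refine integral_congr_ae (hL.zero.mono fun ω h0 => ?_)
  simp only [h0, sub_zero]

lemma integral_exp_riemannSum (hL : IsLevyProcess L P) (hΨ : HasCharExponent L P Ψ)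
    (t : ℝ≥0) (n : ℕ) (ξ q : Space d) :
    ∫ ω, Complex.exp (Complex.I * ((⟪ξ, - riemannSum L t n ω⟫ + ⟪q, L t ω⟫ : ℝ) : ℂ)) ∂P
      = Complex.exp (((t : ℝ) / (n + 1)) • ∑ i ∈ Finset.range (n + 1),
          Ψ (q - ((i + 1) * ((t : ℝ) / (n + 1))) • ξ)) := by
  set a : ℝ := (t : ℝ) / (n + 1) with ha
  set τ : ℕ → ℝ≥0 := fun i => (i : ℝ≥0) * (t / (n + 1)) with hτ
  have hτ0 : τ 0 = 0 := by simp [hτ]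
  have hτN : τ (n + 1) = t := by
    simp only [hτ]; push_cast; exact mul_div_cancel₀ _ (by positivity)
  have hτs : ∀ i, τ (i + 1) = τ i + t / (n + 1) := fun i => by
    simp only [hτ]; push_cast; ring
  have hmono : Monotone τ := fun i j hij => by
    simp only [hτ]; gcongr
  set c : ℕ → Space d := fun j => q - (a * (((n + 1 : ℕ) : ℝ) - j)) • ξ with hc
  set Y : ℕ → Ω → Space d := fun j ω => L (τ (j + 1)) ω - L (τ j) ω with hY
  have hYm : ∀ j, Measurable (Y j) := fun j => (hL.measurable _).sub (hL.measurable _)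
  have hsum : ∀ᵐ ω ∂P, ⟪ξ, - riemannSum L t n ω⟫ + ⟪q, L t ω⟫
      = ∑ j ∈ Finset.range (n + 1), ⟪c j, Y j ω⟫ := by
    filter_upwards [hL.zero] with ω h0
    have hx0 : (fun j => L (τ j) ω) 0 = 0 := by simp [hτ0, h0]
    have h1 := sum_range_succ_eq_sum_increments (x := fun j => L (τ j) ω) hx0 (n + 1)
    have h2 : L t ω = ∑ j ∈ Finset.range (n + 1), Y j ω := by
      have := Finset.sum_range_sub (fun j => L (τ j) ω) (n + 1)
      rw [show L (τ 0) ω = 0 from hx0, sub_zero, hτN] at this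
      exact this.symm
    have h3 : riemannSum L t n ω = a • ∑ j ∈ Finset.range (n + 1),
        (((n + 1 : ℕ) : ℝ) - j) • Y j ω := congrArg (a • ·) h1
    rw [h3, h2, inner_neg_right, real_inner_smul_right, inner_sum, inner_sum, Finset.mul_sum,
      ← Finset.sum_neg_distrib, ← Finset.sum_add_distrib]
    refine Finset.sum_congr rfl fun j _ => ?_
    simp only [hc, inner_sub_left, real_inner_smul_left, real_inner_smul_right]
    ring
  rw [integral_congr_ae (hsum.mono fun ω h => by rw [h])]
  have hind : iIndepFun (fun (j : Fin (n + 1)) ω => Y j ω) P :=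
    (hL.indep_increments.nat hmono).precomp (g := fun i : Fin (n + 1) => (i : ℕ)) Fin.val_injective
  have hprod := iIndepFun.integral_fun_prod_comp (X := fun j : Fin (n + 1) => Y j) hind
    (f := fun j y => Complex.exp (Complex.I * (⟪c j, y⟫ : ℝ))) (fun j => (hYm j).aemeasurable)
    fun j => Continuous.aestronglyMeasurable (by fun_prop)
  simp_rw [← Complex.exp_sum, ← Finset.mul_sum, ← Complex.ofReal_sum] at hprod
  simp_rw [Finset.sum_range]
  rw [hprod]
  have hfac : ∀ j : Fin (n + 1), ∫ ω, Complex.exp (Complex.I * (⟪c j, Y j ω⟫ : ℝ)) ∂P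
      = Complex.exp (a * Ψ (c j)) := fun j => by
    have := integral_exp_increment hL hΨ (τ j) (t / (n + 1)) (c j)
    rw [← hτs] at this
    rw [this, ha]
    push_cast
    rfl
  simp_rw [hfac]
  rw [← Complex.exp_sum, Complex.real_smul, Finset.mul_sum]
  rw [← Equiv.sum_comp Fin.revPerm]
  congr 1
  refine Finset.sum_congr rfl fun j _ => ?_
  simp only [hc, Fin.revPerm_apply, Fin.val_rev]
  have hj : (j : ℕ) + 1 ≤ n + 1 := j.2
  rw [Nat.cast_sub hj]
  congr 3
  push_cast
  congr 1
  ring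

/-- The characteristic function of `(-∫₀ᵗ L_s ds, L_t)`. Since the increment of `L` at time `s`
enters the time integral with weight `t - s`, the exponents `Ψ(q - (t - s) ξ)` add up. -/
lemma integral_exp_displacement [IsProbabilityMeasure P]
    (hL : IsLevyProcess L P) (hΨ : HasCharExponent L P Ψ) (hc : Continuous Ψ)
    (t : ℝ≥0) (ξ q : Space d) :
    ∫ ω, Complex.exp (Complex.I *
        ((⟪ξ, (displacement L t ω).1⟫ + ⟪q, (displacement L t ω).2⟫ : ℝ) : ℂ)) ∂P
      = Complex.exp (∫ s in (0 : ℝ)..t, Ψ (q - s • ξ)) := by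
  simp only [displacement]
  rcases eq_zero_or_pos t with rfl | ht
  · have := hΨ 0 q
    simpa using this
  have hcont : Continuous fun s : ℝ => Ψ (q - s • ξ) := by fun_prop
  obtain ⟨C, hC⟩ := isCompact_Icc.exists_bound_of_continuousOn
    (s := Icc (0 : ℝ) t) hcont.continuousOn
  have hR := tendsto_riemannSum (by exact_mod_cast ht) hC
    fun s _ => hcont.continuousWithinAt
  refine tendsto_nhds_unique ?_ ((Complex.continuous_exp.tendsto _).comp hR)
  simp only [Function.comp_def]
  simp_rw [← integral_exp_riemannSum hL hΨ]
  refine tendsto_integral_of_dominated_convergence (fun _ => (1 : ℝ)) (fun n => ?_)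
    (integrable_const _) (fun n => .of_forall fun ω => ?_) ?_
  · have h1 := measurable_riemannSum hL t n
    have h2 := hL.measurable t
    exact Measurable.aestronglyMeasurable (by fun_prop)
  · rw [mul_comm, Complex.norm_exp_ofReal_mul_I]
  · filter_upwards [ae_tendsto_riemannSum hL ht] with ω hω
    exact ((by fun_prop : Continuous fun y : Space d =>
      Complex.exp (Complex.I * ((⟪ξ, -y⟫ + ⟪q, L t ω⟫ : ℝ) : ℂ))).tendsto _).comp hω

end LevyLaw

/-! ### Averaging over random translations -/

section Averaging

variable {V : Type*} [NormedAddCommGroup V] [MeasurableSpace V] [BorelSpace V]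
  [SecondCountableTopology V] {ν : Measure V} [SFinite ν] [ν.IsAddRightInvariant]
  (μ : Measure V) [IsFiniteMeasure μ]

lemma sq_eLpNorm_two {α : Type*} [MeasurableSpace α] {m : Measure α} (f : α → ℂ) :
    eLpNorm f 2 m ^ 2 = ∫⁻ x, ‖f x‖ₑ ^ 2 ∂m := by
  have := eLpNorm_nnreal_pow_eq_lintegral (μ := m) (f := f) (p := 2) (by norm_num)
  simpa using this

lemma sq_lintegral_le {α : Type*} [MeasurableSpace α] (m : Measure α) {g : α → ℝ≥0∞}
    (hg : AEMeasurable g m) : (∫⁻ x, g x ∂m) ^ 2 ≤ m univ * ∫⁻ x, g x ^ 2 ∂m := by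
  have h := ENNReal.lintegral_mul_le_Lp_mul_Lq m Real.HolderConjugate.two_two
    (aemeasurable_const (b := (1 : ℝ≥0∞))) hg
  simp only [Pi.mul_apply, one_mul, ENNReal.rpow_ofNat, one_pow, lintegral_const] at h
  calc (∫⁻ x, g x ∂m) ^ 2
      ≤ ((m univ) ^ (1 / 2 : ℝ) * (∫⁻ x, g x ^ 2 ∂m) ^ (1 / 2 : ℝ)) ^ 2 := by gcongr
    _ = m univ * ∫⁻ x, g x ^ 2 ∂m := by
      rw [mul_pow, ← ENNReal.rpow_ofNat, ← ENNReal.rpow_ofNat, ← ENNReal.rpow_mul,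
        ← ENNReal.rpow_mul]
      norm_num

lemma measurePreserving_skew_add :
    MeasurePreserving (fun p : V × V => (p.1, p.2 + p.1)) (μ.prod ν) (μ.prod ν) :=
  MeasurePreserving.skew_product (f := id) (g := fun η z => z + η) (MeasurePreserving.id μ)
    (by fun_prop) (.of_forall fun η => map_add_right_eq_self ν η)

lemma quasiMeasurePreserving_add :
    Measure.QuasiMeasurePreserving (fun p : V × V => p.1 + p.2) (ν.prod μ) ν := by
  have h1 := (measurePreserving_skew_add μ (ν := ν)).quasiMeasurePreserving.comp
    (Measure.measurePreserving_swap (μ := ν) (ν := μ)).quasiMeasurePreserving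
  exact Measure.quasiMeasurePreserving_snd.comp h1

lemma lintegral_lintegral_add {g : V → ℝ≥0∞} (hg : AEMeasurable g ν) :
    ∫⁻ z, ∫⁻ η, g (z + η) ∂μ ∂ν = μ univ * ∫⁻ z, g z ∂ν := by
  have hm : AEMeasurable (fun p : V × V => g (p.1 + p.2)) (ν.prod μ) :=
    hg.comp_quasiMeasurePreserving (quasiMeasurePreserving_add μ)
  rw [lintegral_lintegral_swap hm]
  have : ∀ η, ∫⁻ z, g (z + η) ∂ν = ∫⁻ z, g z ∂ν := fun η => lintegral_add_right_eq_self g η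
  simp_rw [this]
  rw [lintegral_const, mul_comm]

/-- Young's inequality in the form needed here: averaging translates of an `L²` function over a
finite measure is bounded on `L²`. -/
lemma lintegral_sq_lintegral_add_le {f : V → ℂ} (hf : AEStronglyMeasurable f ν) :
    ∫⁻ z, (∫⁻ η, ‖f (z + η)‖ₑ ∂μ) ^ 2 ∂ν ≤ μ univ ^ 2 * ∫⁻ z, ‖f z‖ₑ ^ 2 ∂ν := by
  have hm : AEStronglyMeasurable (fun p : V × V => f (p.1 + p.2)) (ν.prod μ) :=
    hf.comp_quasiMeasurePreserving (quasiMeasurePreserving_add μ)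
  have hsec : ∀ᵐ z ∂ν, AEStronglyMeasurable (fun η => f (z + η)) μ := hm.prodMk_left
  calc ∫⁻ z, (∫⁻ η, ‖f (z + η)‖ₑ ∂μ) ^ 2 ∂ν
      ≤ ∫⁻ z, μ univ * ∫⁻ η, ‖f (z + η)‖ₑ ^ 2 ∂μ ∂ν :=
        lintegral_mono_ae (hsec.mono fun z hz => sq_lintegral_le μ hz.enorm)
    _ = μ univ * (μ univ * ∫⁻ z, ‖f z‖ₑ ^ 2 ∂ν) := by
        rw [lintegral_const_mul' _ _ (measure_ne_top μ univ),
          lintegral_lintegral_add μ (g := fun z => ‖f z‖ₑ ^ 2) (hf.enorm.pow_const 2)]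
    _ = _ := by ring

lemma ae_integrable_add {f : V → ℂ} (hf : MemLp f 2 ν) :
    ∀ᵐ z ∂ν, Integrable (fun η => f (z + η)) μ := by
  have hm : AEStronglyMeasurable (fun p : V × V => f (p.1 + p.2)) (ν.prod μ) :=
    hf.1.comp_quasiMeasurePreserving (quasiMeasurePreserving_add μ)
  have hfin : ∫⁻ z, (∫⁻ η, ‖f (z + η)‖ₑ ∂μ) ^ 2 ∂ν ≠ ⊤ := by
    refine ((lintegral_sq_lintegral_add_le μ hf.1).trans_lt ?_).ne
    rw [← sq_eLpNorm_two]
    exact ENNReal.mul_lt_top (ENNReal.pow_lt_top (measure_lt_top μ univ))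
      (ENNReal.pow_lt_top hf.2)
  have hmeas : AEMeasurable (fun z => (∫⁻ η, ‖f (z + η)‖ₑ ∂μ) ^ 2) ν :=
    (hm.enorm.lintegral_prod_right').pow_const 2
  filter_upwards [ae_lt_top' hmeas hfin, hm.prodMk_left] with z hz hz'
  refine ⟨hz', ?_⟩
  rw [hasFiniteIntegral_iff_enorm]
  exact (ENNReal.pow_lt_top_iff.1 hz).resolve_right (by norm_num)

lemma aestronglyMeasurable_integral_add {f : V → ℂ} (hf : AEStronglyMeasurable f ν) :
    AEStronglyMeasurable (fun z => ∫ η, f (z + η) ∂μ) ν :=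
  (hf.comp_quasiMeasurePreserving (quasiMeasurePreserving_add μ)).integral_prod_right'

lemma eLpNorm_integral_add_le {f : V → ℂ} (hf : AEStronglyMeasurable f ν) :
    eLpNorm (fun z => ∫ η, f (z + η) ∂μ) 2 ν ≤ μ univ * eLpNorm f 2 ν := by
  rw [← ENNReal.pow_le_pow_left_iff (n := 2) (by norm_num), mul_pow, sq_eLpNorm_two, sq_eLpNorm_two]
  refine le_trans (lintegral_mono fun z => ?_) (lintegral_sq_lintegral_add_le μ hf)
  gcongr
  exact enorm_integral_le_lintegral_enorm _

lemma memLp_integral_add {f : V → ℂ} (hf : MemLp f 2 ν) :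
    MemLp (fun z => ∫ η, f (z + η) ∂μ) 2 ν :=
  ⟨aestronglyMeasurable_integral_add μ hf.1, (eLpNorm_integral_add_le μ hf.1).trans_lt
    (ENNReal.mul_lt_top (measure_lt_top μ univ) hf.2)⟩

lemma integral_add_congr_ae {f g : V → ℂ} (h : f =ᵐ[ν] g) :
    (fun z => ∫ η, f (z + η) ∂μ) =ᵐ[ν] fun z => ∫ η, g (z + η) ∂μ := by
  have := Measure.ae_ae_of_ae_prod ((quasiMeasurePreserving_add μ (ν := ν)).ae h)
  filter_upwards [this] with z hz using integral_congr_ae hz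

/-- The linear map `f ↦ ∫ f(· + η) dμ(η)` on `L²`. -/
def averageLin (ν : Measure V) [SFinite ν] [ν.IsAddRightInvariant] : Lp ℂ 2 ν →ₗ[ℂ] Lp ℂ 2 ν where
  toFun f := (memLp_integral_add μ (Lp.memLp f)).toLp _
  map_add' f g := by
    rw [← MemLp.toLp_add, MemLp.toLp_eq_toLp_iff]
    refine (integral_add_congr_ae μ (Lp.coeFn_add f g)).trans ?_
    filter_upwards [ae_integrable_add μ (Lp.memLp f), ae_integrable_add μ (Lp.memLp g)] with z hf hg
    exact integral_add hf hg
  map_smul' c f := by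
    rw [RingHom.id_apply, ← MemLp.toLp_const_smul, MemLp.toLp_eq_toLp_iff]
    refine (integral_add_congr_ae μ (Lp.coeFn_smul c f)).trans (.of_forall fun z => ?_)
    exact integral_smul c _

lemma norm_averageLin_le (f : Lp ℂ 2 ν) : ‖averageLin μ ν f‖ ≤ (μ univ).toReal * ‖f‖ := by
  have h : ‖averageLin μ ν f‖ = (eLpNorm (fun z => ∫ η, f (z + η) ∂μ) 2 ν).toReal :=
    Lp.norm_toLp _ (memLp_integral_add μ (Lp.memLp f))
  rw [h, Lp.norm_def, ← ENNReal.toReal_mul]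
  exact ENNReal.toReal_mono (ENNReal.mul_ne_top (measure_ne_top μ univ) (Lp.eLpNorm_ne_top f))
    (eLpNorm_integral_add_le μ (Lp.aestronglyMeasurable f))

/-- The bounded operator `f ↦ ∫ f(· + η) dμ(η)` on `L²`. -/
def averageL (ν : Measure V) [SFinite ν] [ν.IsAddRightInvariant] : Lp ℂ 2 ν →L[ℂ] Lp ℂ 2 ν :=
  (averageLin μ ν).mkContinuous (μ univ).toReal (norm_averageLin_le μ)

lemma coeFn_averageL (f : Lp ℂ 2 ν) : averageL μ ν f =ᵐ[ν] fun z => ∫ η, f (z + η) ∂μ :=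
  MemLp.coeFn_toLp (memLp_integral_add μ (Lp.memLp f))

lemma norm_averageL_le (μ : Measure V) [IsProbabilityMeasure μ] (f : Lp ℂ 2 ν) :
    ‖averageL μ ν f‖ ≤ ‖f‖ := by
  simpa [averageL] using norm_averageLin_le μ f

end Averaging

/-! ### Averages in Fourier variables -/

section Fourier

open FourierTransform

variable {V : Type*} [NormedAddCommGroup V] [InnerProductSpace ℝ V] [FiniteDimensional ℝ V]
  [MeasurableSpace V] [BorelSpace V] (μ : Measure V) [IsProbabilityMeasure μ]

/-- In Fourier variables, averaging over translations is multiplication by the characteristic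
function. -/
lemma integral_add_schwartz_eq (f : SchwartzMap V ℂ) (z : V) :
    ∫ η, f (z + η) ∂μ = ∫ v, Complex.exp ((2 * Real.pi * ⟪v, z⟫ : ℝ) * Complex.I)
      * charFun μ ((2 * Real.pi) • v) * (𝓕 f) v := by
  have hinv : ∀ w, f w = ∫ v, Complex.exp ((2 * Real.pi * ⟪v, w⟫ : ℝ) * Complex.I) • (𝓕 f) v := by
    intro w
    rw [← Real.fourierInv_eq', ← SchwartzMap.fourierInv_coe, FourierPair.fourierInv_fourier_eq]
  simp_rw [hinv]
  have hint : Integrable (fun p : V × V =>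
      Complex.exp ((2 * Real.pi * ⟪p.2, z + p.1⟫ : ℝ) * Complex.I) • (𝓕 f) p.2) (μ.prod volume) := by
    have h1 : Integrable (fun p : V × V => (1 : ℂ) * (𝓕 f) p.2) (μ.prod volume) :=
      (integrable_const (1 : ℂ)).mul_prod (𝓕 f).integrable
    refine h1.mono ?_ (.of_forall fun p => ?_)
    · have : Continuous (𝓕 f : SchwartzMap V ℂ) := (𝓕 f : SchwartzMap V ℂ).continuous
      exact Continuous.aestronglyMeasurable (by fun_prop)
    · rw [norm_smul, Complex.norm_exp_ofReal_mul_I, one_mul, one_mul]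
  rw [integral_integral_swap hint]
  refine integral_congr_ae (.of_forall fun v => ?_)
  simp only [smul_eq_mul]
  rw [integral_mul_const]
  congr 1
  rw [charFun_apply, ← integral_const_mul]
  refine integral_congr_ae (.of_forall fun η => ?_)
  simp only
  rw [← Complex.exp_add, inner_add_right, real_inner_smul_right, real_inner_comm v η]
  congr 1
  push_cast
  ring

lemma averageL_ae_eq_fourier (hμ : MemLp (fun v => charFun μ ((2 * Real.pi) • v)) 2 volume)
    (f : Lp ℂ 2 (volume : Measure V)) :
    averageL μ volume f =ᵐ[volume] fun z => ∫ v,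
      Complex.exp ((2 * Real.pi * ⟪v, z⟫ : ℝ) * Complex.I) * charFun μ ((2 * Real.pi) • v)
        * (𝓕 f : Lp ℂ 2 (volume : Measure V)) v := by
  set m : V → V → ℂ := fun z v =>
    Complex.exp ((2 * Real.pi * ⟪v, z⟫ : ℝ) * Complex.I) * charFun μ ((2 * Real.pi) • v) with hm
  have hmem : ∀ z, MemLp (fun v => conj (m z v)) 2 volume := fun z => by
    refine hμ.of_le ?_ (.of_forall fun v => ?_)
    · refine Complex.continuous_conj.comp_aestronglyMeasurable ?_
      exact (Continuous.aestronglyMeasurable (by fun_prop)).mul hμ.1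
    · rw [RCLike.norm_conj, norm_mul, Complex.norm_exp_ofReal_mul_I, one_mul]
  have hinner : ∀ z (F : Lp ℂ 2 (volume : Measure V)),
      ∫ v, m z v * F v = inner ℂ ((hmem z).toLp _) F := fun z F => by
    rw [L2.inner_def]
    refine integral_congr_ae ?_
    filter_upwards [(hmem z).coeFn_toLp] with v hv
    rw [hv]
    simp [mul_comm]
  have hcont : ∀ z, Continuous fun f : Lp ℂ 2 (volume : Measure V) =>
      ∫ v, m z v * (𝓕 f : Lp ℂ 2 (volume : Measure V)) v := fun z => by
    simp_rw [hinner]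
    exact continuous_const.inner (Lp.fourierTransformₗᵢ V ℂ).continuous
  refine DenseRange.induction_on
    (p := fun f => averageL μ volume f =ᵐ[volume] fun z =>
      ∫ v, m z v * (𝓕 f : Lp ℂ 2 (volume : Measure V)) v)
    (SchwartzMap.denseRange_toLpCLM (E := V) (F := ℂ) (p := 2) (μ := volume)
      ENNReal.ofNat_ne_top) f ?_ fun g => ?_
  · refine IsSeqClosed.isClosed fun u a hu hlim => ?_
    have h1 : Tendsto (fun n => averageL μ volume (u n)) atTop (𝓝 (averageL μ volume a)) :=
      ((averageL μ volume).continuous.tendsto a).comp hlim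
    obtain ⟨ns, hns, hae⟩ := (tendstoInMeasure_of_tendsto_Lp h1).exists_seq_tendsto_ae
    filter_upwards [hae, ae_all_iff.2 hu] with z hz hz'
    refine tendsto_nhds_unique hz ?_
    simp_rw [hz']
    exact (((hcont z).tendsto a).comp hlim).comp hns.tendsto_atTop
  · rw [SchwartzMap.toLpCLM_apply]
    have h1 := (coeFn_averageL μ (g.toLp 2 volume)).trans
      (integral_add_congr_ae μ (SchwartzMap.coeFn_toLp g 2 volume))
    refine h1.trans (.of_forall fun z => ?_)
    simp only
    rw [integral_add_schwartz_eq, SchwartzMap.toLp_fourier_eq]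
    refine integral_congr_ae ?_
    filter_upwards [SchwartzMap.coeFn_toLp (𝓕 g) 2 volume] with v hv
    rw [hv]

end Fourier

/-! ### Phase space -/

instance : (volume : Measure (Space d × Space d)).IsAddHaarMeasure :=
  inferInstanceAs ((volume : Measure (Space d)).prod volume).IsAddHaarMeasure

/-- The free transport `(x, k) ↦ (x - t k, k)`. -/
def shear (t : ℝ) (z : Space d × Space d) : Space d × Space d := (z.1 - t • z.2, z.2)

@[fun_prop]
lemma continuous_shear (t : ℝ) : Continuous (shear (d := d) t) := by
  unfold shear; fun_prop

lemma measurePreserving_shear (t : ℝ) :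
    MeasurePreserving (shear (d := d) t) volume volume := by
  have h1 : MeasurePreserving (fun p : Space d × Space d => (p.1, p.2 - t • p.1))
      ((volume : Measure (Space d)).prod volume) (volume.prod volume) :=
    MeasurePreserving.skew_product (f := id) (g := fun k x => x - t • k) (MeasurePreserving.id _)
      (by fun_prop) (.of_forall fun k => (measurePreserving_sub_right volume (t • k)).map_eq)
  exact (Measure.measurePreserving_swap.comp h1).comp Measure.measurePreserving_swap

/-- The Euclidean inner product on phase space (which as a product carries the sup norm). -/
def phaseInner (ζ z : Space d × Space d) : ℝ := ⟪ζ.1, z.1⟫ + ⟪ζ.2, z.2⟫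

@[fun_prop]
lemma Continuous.phaseInner {α : Type*} [TopologicalSpace α] {f g : α → Space d × Space d}
    (hf : Continuous f) (hg : Continuous g) :
    Continuous fun a => RadiativeTransfer.phaseInner (f a) (g a) := by
  unfold RadiativeTransfer.phaseInner; fun_prop

/-- The characteristic function of a measure on phase space. -/
def phaseChar (μ : Measure (Space d × Space d)) (ζ : Space d × Space d) : ℂ :=
  ∫ η, Complex.exp (Complex.I * (phaseInner ζ η : ℝ)) ∂μ

lemma ext_of_phaseChar {μ ν : Measure (Space d × Space d)} [IsFiniteMeasure μ] [IsFiniteMeasure ν]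
    (h : ∀ ζ, phaseChar μ ζ = phaseChar ν ζ) : μ = ν := by
  refine Measure.ext_of_charFunDual (funext fun ℓ => ?_)
  set ζ : Space d × Space d :=
    ((InnerProductSpace.toDual ℝ (Space d)).symm (ℓ.comp (.inl ℝ (Space d) (Space d))),
      (InnerProductSpace.toDual ℝ (Space d)).symm (ℓ.comp (.inr ℝ (Space d) (Space d)))) with hζ
  have hℓ : ∀ η, ℓ η = phaseInner ζ η := fun η => by
    simp only [phaseInner, hζ, InnerProductSpace.toDual_symm_apply,
      ContinuousLinearMap.comp_apply, ContinuousLinearMap.inl_apply, ContinuousLinearMap.inr_apply]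
    rw [← map_add]
    simp
  have := h ζ
  simp only [phaseChar, mul_comm Complex.I] at this
  simpa only [charFunDual_apply, hℓ] using this

/-- Free transport composed with averaging over the random displacement: the solution operator. -/
def evolve (μ : Measure (Space d × Space d)) [IsFiniteMeasure μ] (t : ℝ) (f : PhaseL2 d) :
    PhaseL2 d :=
  Lp.compMeasurePreserving (shear t) (measurePreserving_shear t) (averageL μ volume f)

lemma coeFn_evolve (μ : Measure (Space d × Space d)) [IsFiniteMeasure μ] (t : ℝ) (f : PhaseL2 d) :
    evolve μ t f =ᵐ[volume] fun z => ∫ η, f (shear t z + η) ∂μ :=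
  (Lp.coeFn_compMeasurePreserving _ _).trans
    ((measurePreserving_shear t).quasiMeasurePreserving.ae (coeFn_averageL μ f))

lemma norm_evolve_le (μ : Measure (Space d × Space d)) [IsProbabilityMeasure μ] (t : ℝ)
    (f : PhaseL2 d) : ‖evolve μ t f‖ ≤ ‖f‖ := by
  rw [evolve, Lp.norm_compMeasurePreserving]
  exact norm_averageL_le μ f

lemma evolve_sub (μ : Measure (Space d × Space d)) [IsFiniteMeasure μ] (t : ℝ)
    (f g : PhaseL2 d) : evolve μ t (f - g) = evolve μ t f - evolve μ t g := by
  rw [evolve, map_sub, map_sub]; rfl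

section PhaseFourier

open FourierTransform

/-- The Fourier representation of averages on phase space. It is obtained from the one on the
Euclidean space `WithLp 2 (ℝ^d × ℝ^d)`; the rescaling by `2π` turns Mathlib's normalization of the
Fourier transform into the one of the characteristic function. -/
lemma exists_fourier_average (f : PhaseL2 d) : ∃ F : Space d × Space d → ℂ, MemLp F 2 volume ∧
    ∀ (μ : Measure (Space d × Space d)) [IsProbabilityMeasure μ], MemLp (phaseChar μ) 2 volume →
      (fun z => ∫ η, f (z + η) ∂μ) =ᵐ[volume]
        fun z => ∫ ζ, Complex.exp (Complex.I * (phaseInner ζ z : ℝ)) * phaseChar μ ζ * F ζ := by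
  set toV : Space d × Space d → WithLp 2 (Space d × Space d) := WithLp.toLp 2 with htoV
  have hto : MeasurePreserving toV volume volume := WithLp.volume_preserving_toLp _ _
  have hof : MeasurePreserving (WithLp.ofLp : WithLp 2 (Space d × Space d) → _) volume volume :=
    WithLp.volume_preserving_ofLp _ _
  have hemb : MeasurableEmbedding toV :=
    (MeasurableEquiv.toLp 2 (Space d × Space d)).measurableEmbedding
  have hembof : MeasurableEmbedding (WithLp.ofLp : WithLp 2 (Space d × Space d) → _) :=
    (MeasurableEquiv.toLp 2 (Space d × Space d)).symm.measurableEmbedding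
  set f' : Lp ℂ 2 (volume : Measure (WithLp 2 (Space d × Space d))) :=
    Lp.compMeasurePreserving _ hof f with hf'
  set G : Lp ℂ 2 (volume : Measure (WithLp 2 (Space d × Space d))) := 𝓕 f' with hG
  have hpi : (2 * Real.pi) ≠ 0 := by positivity
  set c : ℝ := |((2 * Real.pi) ^ Module.finrank ℝ (Space d × Space d))⁻¹| with hc
  have hinner : ∀ ζ z : Space d × Space d, ⟪toV ζ, toV z⟫ = phaseInner ζ z := fun ζ z => by
    simp [htoV, phaseInner, WithLp.prod_inner_apply]
  have hscale : Measure.QuasiMeasurePreserving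
      (fun ζ : Space d × Space d => (2 * Real.pi)⁻¹ • ζ) volume volume := by
    refine ⟨by fun_prop, ?_⟩
    rw [Measure.map_addHaar_smul _ (inv_ne_zero hpi)]
    exact Measure.smul_absolutelyContinuous
  refine ⟨fun ζ => c * G (toV ((2 * Real.pi)⁻¹ • ζ)), ?_, ?_⟩
  · have h1 : MemLp (G ∘ toV) 2 volume := (Lp.memLp G).comp_measurePreserving hto
    have h2 : MemLp ((G ∘ toV) ∘ fun ζ => (2 * Real.pi)⁻¹ • ζ) 2 volume := by
      refine ⟨h1.1.comp_quasiMeasurePreserving hscale, ?_⟩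
      rw [← eLpNorm_map_measure (f := fun ζ : Space d × Space d => (2 * Real.pi)⁻¹ • ζ) ?_
        (by fun_prop), Measure.map_addHaar_smul _ (inv_ne_zero hpi)]
      · exact (h1.smul_measure ENNReal.ofReal_ne_top).2
      · rw [Measure.map_addHaar_smul _ (inv_ne_zero hpi)]
        exact h1.1.smul_measure _
    exact h2.const_mul (c : ℂ)
  · intro μ _ hμ
    set μ' : Measure (WithLp 2 (Space d × Space d)) := μ.map toV with hμ'
    have : IsProbabilityMeasure μ' := Measure.isProbabilityMeasure_map hto.measurable.aemeasurable
    have hchar : ∀ ζ, charFun μ' (toV ζ) = phaseChar μ ζ := fun ζ => by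
      rw [charFun_apply, hμ', hemb.integral_map, phaseChar]
      refine integral_congr_ae (.of_forall fun η => ?_)
      show Complex.exp ((⟪toV η, toV ζ⟫ : ℝ) * Complex.I) = _
      rw [mul_comm, real_inner_comm, hinner]
    have hmem : MemLp (fun v => charFun μ' ((2 * Real.pi) • v)) 2 volume := by
      have h1 : MemLp (fun ζ => phaseChar μ ((2 * Real.pi) • ζ)) 2 volume := by
        have hmap := Measure.map_addHaar_smul (volume : Measure (Space d × Space d)) hpi
        have h0 : MemLp (phaseChar μ) 2
            (Measure.map (fun ζ : Space d × Space d => (2 * Real.pi) • ζ) volume) := by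
          rw [hmap]
          exact hμ.smul_measure ENNReal.ofReal_ne_top
        exact h0.comp_of_map (by fun_prop)
      have h2 := h1.comp_measurePreserving hof
      refine (memLp_congr_ae (.of_forall fun v => ?_)).1 h2
      simp only [Function.comp_apply]
      rw [← hchar]
      rfl
    have h1 := (coeFn_averageL μ' f').symm.trans (averageL_ae_eq_fourier μ' hmem f')
    have h2 := (integral_add_congr_ae μ' (Lp.coeFn_compMeasurePreserving f hof)).symm.trans h1
    filter_upwards [hto.quasiMeasurePreserving.ae h2] with z hz
    simp only [Function.comp_apply] at hz
    rw [hμ', hemb.integral_map] at hz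
    have e1 : ∀ η, WithLp.ofLp (toV z + toV η) = z + η := fun η => rfl
    simp_rw [e1, ← hμ'] at hz
    rw [hz, ← hto.integral_comp hemb]
    set H : Space d × Space d → ℂ := fun ζ =>
      Complex.exp (Complex.I * (phaseInner ζ z : ℝ)) * phaseChar μ ζ
        * (c * G (toV ((2 * Real.pi)⁻¹ • ζ))) with hH
    have e2 : ∀ ζ, Complex.exp ((2 * Real.pi * ⟪toV ζ, toV z⟫ : ℝ) * Complex.I)
        * charFun μ' ((2 * Real.pi) • toV ζ) * G (toV ζ) = c⁻¹ • H ((2 * Real.pi) • ζ) := fun ζ => by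
      have hcne : (c : ℂ) ≠ 0 := by
        have : c ≠ 0 := abs_ne_zero.2 (inv_ne_zero (pow_ne_zero _ hpi))
        exact_mod_cast this
      have e3 : (2 * Real.pi) • toV ζ = toV ((2 * Real.pi) • ζ) := rfl
      have e4 : phaseInner ((2 * Real.pi) • ζ) z = 2 * Real.pi * phaseInner ζ z := by
        simp only [phaseInner, Prod.smul_fst, Prod.smul_snd, real_inner_smul_left]
        ring
      simp only [hH]
      rw [e3, hchar, hinner, e4, smul_smul, inv_mul_cancel₀ hpi, one_smul, mul_comm Complex.I,
        Complex.real_smul, Complex.ofReal_inv]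
      field_simp
    rw [integral_congr_ae (.of_forall e2), integral_smul, Measure.integral_comp_smul, ← hc, smul_smul,
      inv_mul_cancel₀ (abs_ne_zero.2 (inv_ne_zero (pow_ne_zero _ hpi))), one_smul]

end PhaseFourier

/-! ### Decay of the characteristic function of the displacement -/

/-- The exponent `∫₀ᵗ Ψ(q - s ξ) ds` of the characteristic function of the displacement. -/
def phaseExponent (Ψ : Space d → ℂ) (t : ℝ) (ζ : Space d × Space d) : ℂ :=
  ∫ s in (0 : ℝ)..t, Ψ (ζ.2 - s • ζ.1)

lemma continuous_phaseExponent {Ψ : Space d → ℂ} (hΨ : Continuous Ψ) (t : ℝ) :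
    Continuous (phaseExponent Ψ t) := by
  refine intervalIntegral.continuous_parametric_intervalIntegral_of_continuous' ?_ 0 t
  fun_prop

lemma hasDerivAt_phaseExponent {Ψ : Space d → ℂ} (hΨ : Continuous Ψ) (t : ℝ)
    (ζ : Space d × Space d) :
    HasDerivAt (fun s => phaseExponent Ψ s ζ) (Ψ (ζ.2 - t • ζ.1)) t := by
  have hc : Continuous fun s : ℝ => Ψ (ζ.2 - s • ζ.1) := by fun_prop
  exact intervalIntegral.integral_hasDerivAt_right (hc.intervalIntegrable _ _)
    (hc.stronglyMeasurableAtFilter _ _) hc.continuousAt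

/-- The law of the displacement of a Lévy process at time `t`. -/
def displacementLaw {Ω : Type*} [MeasurableSpace Ω] (P : Measure Ω) (L : ℝ≥0 → Ω → Space d)
    (t : ℝ≥0) : Measure (Space d × Space d) := P.map (displacement L t)

lemma isProbabilityMeasure_displacementLaw {Ω : Type*} [MeasurableSpace Ω] {P : Measure Ω}
    [IsProbabilityMeasure P] {L : ℝ≥0 → Ω → Space d} (hL : IsLevyProcess L P) (t : ℝ≥0) :
    IsProbabilityMeasure (displacementLaw P L t) :=
  Measure.isProbabilityMeasure_map (aemeasurable_displacement hL t)

lemma phaseChar_displacementLaw {Ω : Type*} [MeasurableSpace Ω] {P : Measure Ω}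
    [IsProbabilityMeasure P] {L : ℝ≥0 → Ω → Space d} {Ψ : Space d → ℂ} (hL : IsLevyProcess L P)
    (hΨ : HasCharExponent L P Ψ) (hc : Continuous Ψ) (t : ℝ≥0) (ζ : Space d × Space d) :
    phaseChar (displacementLaw P L t) ζ = Complex.exp (phaseExponent Ψ t ζ) := by
  rw [phaseChar, displacementLaw, integral_map (aemeasurable_displacement hL t)
    (Continuous.aestronglyMeasurable (by fun_prop))]
  exact integral_exp_displacement hL hΨ hc t ζ.1 ζ.2

/-- The velocity `q - s ξ` cannot stay small: its values at times `s` and `s + t/2` differ by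
`(t/2) ξ`, which controls `ξ`, and then `q`. -/
lemma exists_le_integral_norm_rpow {θ t : ℝ} (hθ : 0 < θ) (hθ1 : θ ≤ 1) (ht : 0 < t) :
    ∃ κ > 0, ∀ ζ : Space d × Space d, κ * ‖ζ‖ ^ θ ≤ ∫ s in (0 : ℝ)..t, ‖ζ.2 - s • ζ.1‖ ^ θ := by
  set a : ℝ := (t / 2) ^ (1 + θ) with ha
  have hapos : 0 < a := by positivity
  set K : ℝ := 1 / a + (1 + t ^ (1 + θ) / a) / t with hK
  have hKpos : 0 < K := by positivity
  refine ⟨1 / K, by positivity, fun ζ => ?_⟩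
  set I := ∫ s in (0 : ℝ)..t, ‖ζ.2 - s • ζ.1‖ ^ θ with hI
  have hsub : ∀ u v : Space d, ‖u - v‖ ^ θ ≤ ‖u‖ ^ θ + ‖v‖ ^ θ := fun u v =>
    (Real.rpow_le_rpow (norm_nonneg _) (norm_sub_le u v) hθ.le).trans
      (Real.rpow_add_le_add_rpow (norm_nonneg _) (norm_nonneg _) hθ.le hθ1)
  have hcont : Continuous fun s : ℝ => ‖ζ.2 - s • ζ.1‖ ^ θ :=
    (by fun_prop : Continuous fun s : ℝ => ‖ζ.2 - s • ζ.1‖).rpow_const fun _ => Or.inr hθ.le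
  have hcont2 : Continuous fun s : ℝ => ‖ζ.2 - (s + t / 2) • ζ.1‖ ^ θ :=
    (by fun_prop : Continuous fun s : ℝ => ‖ζ.2 - (s + t / 2) • ζ.1‖).rpow_const
      fun _ => Or.inr hθ.le
  have hA : a * ‖ζ.1‖ ^ θ ≤ I := by
    have hsplit : I = ∫ s in (0 : ℝ)..(t / 2),
        (‖ζ.2 - s • ζ.1‖ ^ θ + ‖ζ.2 - (s + t / 2) • ζ.1‖ ^ θ) := by
      rw [intervalIntegral.integral_add (hcont.intervalIntegrable _ _)
        (hcont2.intervalIntegrable _ _),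
        intervalIntegral.integral_comp_add_right (fun s => ‖ζ.2 - s • ζ.1‖ ^ θ), zero_add,
        add_halves, intervalIntegral.integral_add_adjacent_intervals
        (hcont.intervalIntegrable _ _) (hcont.intervalIntegrable _ _)]
    have hconst : ∫ _ in (0 : ℝ)..(t / 2), (t / 2) ^ θ * ‖ζ.1‖ ^ θ = a * ‖ζ.1‖ ^ θ := by
      rw [intervalIntegral.integral_const, smul_eq_mul, sub_zero, ha,
        Real.rpow_add (by positivity), Real.rpow_one, mul_assoc]
    rw [hsplit, ← hconst]
    refine intervalIntegral.integral_mono_on (by positivity) (by simp)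
      ((hcont.add hcont2).intervalIntegrable _ _) fun s _ => ?_
    have := hsub (ζ.2 - s • ζ.1) (ζ.2 - (s + t / 2) • ζ.1)
    have e : ζ.2 - s • ζ.1 - (ζ.2 - (s + t / 2) • ζ.1) = (t / 2) • ζ.1 := by module
    rwa [e, norm_smul, Real.norm_of_nonneg (by positivity),
      Real.mul_rpow (by positivity) (norm_nonneg _)] at this
  have hB : t * ‖ζ.2‖ ^ θ ≤ I + t ^ (1 + θ) * ‖ζ.1‖ ^ θ := by
    have hconst : ∫ _ in (0 : ℝ)..t, ‖ζ.2‖ ^ θ = t * ‖ζ.2‖ ^ θ := by simp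
    have hright : ∫ s in (0 : ℝ)..t, (‖ζ.2 - s • ζ.1‖ ^ θ + t ^ θ * ‖ζ.1‖ ^ θ)
        = I + t ^ (1 + θ) * ‖ζ.1‖ ^ θ := by
      rw [intervalIntegral.integral_add (hcont.intervalIntegrable _ _) (by simp),
        intervalIntegral.integral_const, smul_eq_mul, sub_zero,
        Real.rpow_add ht, Real.rpow_one, mul_assoc]
    rw [← hconst, ← hright]
    refine intervalIntegral.integral_mono_on ht.le (by simp)
      ((hcont.add continuous_const).intervalIntegrable _ _) fun s hs => ?_
    have := hsub (ζ.2 - s • ζ.1) (-(s • ζ.1))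
    rw [sub_neg_eq_add, sub_add_cancel, norm_neg, norm_smul, Real.norm_of_nonneg hs.1,
      Real.mul_rpow hs.1 (norm_nonneg _)] at this
    refine this.trans ?_
    gcongr
    exacts [hs.1, hs.2]
  have h1 : ‖ζ.1‖ ^ θ ≤ I / a := by rwa [le_div_iff₀ hapos, mul_comm]
  have hI0 : 0 ≤ I := le_trans (by positivity) hA
  have h2 : ‖ζ.2‖ ^ θ ≤ (1 + t ^ (1 + θ) / a) / t * I := by
    rw [div_mul_eq_mul_div, le_div_iff₀ ht, mul_comm]
    calc t * ‖ζ.2‖ ^ θ ≤ I + t ^ (1 + θ) * (I / a) := hB.trans (by gcongr)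
      _ = _ := by ring
  have h3 : ‖ζ‖ ^ θ ≤ K * I := by
    have e1 : (1 / a) * I = I / a := by ring
    have e2 : 0 ≤ (1 + t ^ (1 + θ) / a) / t * I := by positivity
    have e3 : 0 ≤ I / a := by positivity
    rw [hK, add_mul, e1]
    rcases max_choice ‖ζ.1‖ ‖ζ.2‖ with h | h <;> rw [Prod.norm_def, h] <;> linarith
  rw [one_div, inv_mul_le_iff₀ hKpos]
  exact h3

lemma one_add_pow_le_exp {θ a : ℝ} (hθ : 0 < θ) (ha : 0 < a) (N : ℕ) :
    ∃ C ≥ 0, ∀ x : ℝ, 0 ≤ x → (1 + x) ^ N ≤ C * Real.exp (a * x ^ θ) := by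
  obtain ⟨n, hn⟩ := exists_nat_ge (N / θ)
  rw [div_le_iff₀ hθ] at hn
  refine ⟨2 ^ N * (1 + n.factorial / a ^ n), by positivity, fun x hx => ?_⟩
  have hexp1 : 1 ≤ Real.exp (a * x ^ θ) := Real.one_le_exp (by positivity)
  rcases le_or_gt x 1 with h1 | h1
  · calc (1 + x) ^ N ≤ 2 ^ N * 1 := by rw [mul_one]; gcongr; linarith
      _ ≤ 2 ^ N * (1 + n.factorial / a ^ n) * Real.exp (a * x ^ θ) := by
        rw [mul_assoc]
        have : (0 : ℝ) ≤ n.factorial / a ^ n := by positivity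
        gcongr
        nlinarith
  · have h2 : x ^ N ≤ (x ^ θ) ^ n := by
      rw [← Real.rpow_natCast, ← Real.rpow_natCast, ← Real.rpow_mul hx]
      exact Real.rpow_le_rpow_of_exponent_le h1.le (by linarith)
    have h3 := Real.pow_div_factorial_le_exp (a * x ^ θ) (by positivity) n
    have h4 : (x ^ θ) ^ n ≤ n.factorial / a ^ n * Real.exp (a * x ^ θ) := by
      rw [mul_pow, div_le_iff₀ (by positivity)] at h3
      rw [div_mul_eq_mul_div, le_div_iff₀ (by positivity)]
      linarith
    calc (1 + x) ^ N ≤ (2 * x) ^ N := by gcongr; linarith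
      _ = 2 ^ N * x ^ N := mul_pow _ _ _
      _ ≤ 2 ^ N * (n.factorial / a ^ n * Real.exp (a * x ^ θ)) := by gcongr; exact h2.trans h4
      _ ≤ 2 ^ N * (1 + n.factorial / a ^ n) * Real.exp (a * x ^ θ) := by
        rw [mul_assoc]
        gcongr
        linarith

/-- For positive times the characteristic function of the displacement decays rapidly. -/
lemma IsJumpKernel.exists_exp_phaseExponent_le {σ : Space d → ℝ} (hσ : IsJumpKernel σ) {θ : ℝ}
    (hθ : 0 < θ) (hθ1 : θ ≤ 1) (hlow : HasStableLowerBound σ θ) {t₀ : ℝ} (ht₀ : 0 < t₀) (N : ℕ) :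
    ∃ C ≥ 0, ∀ t ≥ t₀, ∀ ζ, (1 + ‖ζ‖) ^ N * ‖Complex.exp (phaseExponent (levyExponent σ) t ζ)‖
      ≤ C := by
  obtain ⟨c, hc, C₁, hC₁, hΨ⟩ := hσ.exists_le_neg_re_levyExponent hθ hlow
  obtain ⟨κ, hκ, hκ'⟩ := exists_le_integral_norm_rpow (d := d) hθ hθ1 ht₀
  obtain ⟨C₂, hC₂, hexp⟩ := one_add_pow_le_exp hθ (mul_pos hc hκ) N
  refine ⟨C₂ * Real.exp (C₁ * t₀), by positivity, fun t ht ζ => ?_⟩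
  have hcont : Continuous fun s : ℝ => levyExponent σ (ζ.2 - s • ζ.1) :=
    hσ.continuous_levyExponent.comp (by fun_prop)
  have hre : (phaseExponent (levyExponent σ) t ζ).re
      = ∫ s in (0 : ℝ)..t, (levyExponent σ (ζ.2 - s • ζ.1)).re := by
    have := Complex.reCLM.intervalIntegral_comp_comm (hcont.intervalIntegrable (μ := volume) 0 t)
    simpa [phaseExponent] using this.symm
  have hrec : Continuous fun s : ℝ => (levyExponent σ (ζ.2 - s • ζ.1)).re :=
    Complex.continuous_re.comp hcont
  have hneg : ∫ s in t₀..t, (levyExponent σ (ζ.2 - s • ζ.1)).re ≤ 0 := by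
    rw [intervalIntegral.integral_of_le ht]
    exact integral_nonpos fun s => hσ.re_levyExponent_nonpos _
  have hrpow : Continuous fun s : ℝ => ‖ζ.2 - s • ζ.1‖ ^ θ :=
    (by fun_prop : Continuous fun s : ℝ => ‖ζ.2 - s • ζ.1‖).rpow_const fun _ => Or.inr hθ.le
  have hmain : ∫ s in (0 : ℝ)..t₀, (levyExponent σ (ζ.2 - s • ζ.1)).re
      ≤ C₁ * t₀ - c * κ * ‖ζ‖ ^ θ := by
    have h1 : ∫ s in (0 : ℝ)..t₀, (levyExponent σ (ζ.2 - s • ζ.1)).re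
        ≤ ∫ s in (0 : ℝ)..t₀, (C₁ - c * ‖ζ.2 - s • ζ.1‖ ^ θ) :=
      intervalIntegral.integral_mono_on ht₀.le (hrec.intervalIntegrable _ _)
        ((continuous_const.sub (hrpow.const_mul c)).intervalIntegrable _ _)
        fun s _ => by linarith [hΨ (ζ.2 - s • ζ.1)]
    rw [intervalIntegral.integral_sub (by simp) ((hrpow.const_mul c).intervalIntegrable _ _),
      intervalIntegral.integral_const_mul] at h1
    have h2 := mul_le_mul_of_nonneg_left (hκ' ζ) hc.le
    simp only [intervalIntegral.integral_const, sub_zero, smul_eq_mul] at h1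
    linarith
  have hle : (phaseExponent (levyExponent σ) t ζ).re ≤ C₁ * t₀ - c * κ * ‖ζ‖ ^ θ := by
    rw [hre, ← intervalIntegral.integral_add_adjacent_intervals
      (hrec.intervalIntegrable 0 t₀) (hrec.intervalIntegrable t₀ t)]
    linarith
  rw [Complex.norm_exp]
  calc (1 + ‖ζ‖) ^ N * Real.exp (phaseExponent (levyExponent σ) t ζ).re
      ≤ C₂ * Real.exp (c * κ * ‖ζ‖ ^ θ) * Real.exp (C₁ * t₀ - c * κ * ‖ζ‖ ^ θ) := by
        gcongr
        exact hexp _ (norm_nonneg ζ)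
    _ = C₂ * Real.exp (C₁ * t₀) := by
        rw [mul_assoc, ← Real.exp_add]
        congr 2
        ring

lemma exists_memLp_one_add_norm_pow :
    ∃ K : ℕ, MemLp (fun ζ : Space d × Space d => ((1 + ‖ζ‖) ^ K)⁻¹) 2 volume := by
  set n := Module.finrank ℝ (Space d × Space d) with hn
  have hcont : Continuous fun ζ : Space d × Space d => ((1 + ‖ζ‖) ^ (n + 1))⁻¹ :=
    Continuous.inv₀ (by fun_prop) fun ζ => by positivity
  refine ⟨n + 1, (memLp_two_iff_integrable_sq hcont.aestronglyMeasurable).2 ?_⟩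
  have h := integrable_one_add_norm (E := Space d × Space d) (μ := volume) (r := (2 * (n + 1) : ℕ))
    (by rw [← hn]; push_cast; linarith [(Nat.cast_nonneg n : (0 : ℝ) ≤ n)])
  refine h.congr (.of_forall fun ζ => ?_)
  simp only
  rw [Real.rpow_neg (by positivity), Real.rpow_natCast, inv_pow, ← pow_mul, mul_comm 2]

/-- The integrable majorant that justifies all differentiations of the Fourier representation. -/
lemma IsJumpKernel.exists_integrable_bound {σ : Space d → ℝ} (hσ : IsJumpKernel σ) {θ : ℝ}
    (hθ : 0 < θ) (hθ1 : θ ≤ 1) (hlow : HasStableLowerBound σ θ) {F : Space d × Space d → ℂ}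
    (hF : MemLp F 2 volume) {t₀ : ℝ} (ht₀ : 0 < t₀) (M : ℕ) :
    ∃ g : Space d × Space d → ℝ, Integrable g ∧ ∀ t ≥ t₀, ∀ ζ, (1 + ‖ζ‖) ^ M *
      ‖Complex.exp (phaseExponent (levyExponent σ) t ζ) * F ζ‖ ≤ g ζ := by
  obtain ⟨K, hK⟩ := exists_memLp_one_add_norm_pow (d := d)
  obtain ⟨C, hC, hb⟩ := hσ.exists_exp_phaseExponent_le hθ hθ1 hlow ht₀ (M + K)
  refine ⟨fun ζ => C * (((1 + ‖ζ‖) ^ K)⁻¹ * ‖F ζ‖), (hK.integrable_mul hF.norm).const_mul C,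
    fun t ht ζ => ?_⟩
  have h1 := hb t ht ζ
  have hpos : 0 < (1 + ‖ζ‖) ^ K := by positivity
  simp only
  rw [norm_mul, ← mul_assoc, ← mul_assoc]
  refine mul_le_mul_of_nonneg_right ?_ (norm_nonneg _)
  rw [← div_eq_mul_inv, le_div_iff₀ hpos]
  calc _ = (1 + ‖ζ‖) ^ (M + K) * ‖Complex.exp (phaseExponent (levyExponent σ) t ζ)‖ := by
        rw [pow_add]; ring
    _ ≤ C := h1

/-! ### The Fourier representation is a classical solution -/

section Wave

variable {σ : Space d → ℝ} {F : Space d × Space d → ℂ}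

/-- The exponent of the elementary solution with frequency `ζ = (ξ, q)`, as a function of
`y = (t, x, k)`. -/
def wavePhase (Ψ : Space d → ℂ) (ζ : Space d × Space d) (y : ℝ × Space d × Space d) : ℂ :=
  Complex.I * (phaseInner ζ (shear y.1 y.2) : ℝ) + phaseExponent Ψ y.1 ζ

/-- The derivative of `wavePhase` in `(t, x, k)`. -/
def wavePhaseDeriv (Ψ : Space d → ℂ) (ζ : Space d × Space d) (y : ℝ × Space d × Space d) :
    (ℝ × Space d × Space d) →L[ℝ] ℂ :=
  (ContinuousLinearMap.fst ℝ ℝ (Space d × Space d)).smulRight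
      (Ψ (ζ.2 - y.1 • ζ.1) - Complex.I * (⟪ζ.1, y.2.2⟫ : ℝ))
    + Complex.I • Complex.ofRealCLM.comp
      ((innerSL ℝ ζ.1).comp ((ContinuousLinearMap.fst ℝ (Space d) (Space d)).comp
          (ContinuousLinearMap.snd ℝ ℝ (Space d × Space d)))
        + (innerSL ℝ (ζ.2 - y.1 • ζ.1)).comp ((ContinuousLinearMap.snd ℝ (Space d) (Space d)).comp
          (ContinuousLinearMap.snd ℝ ℝ (Space d × Space d))))

lemma wavePhaseDeriv_apply (Ψ : Space d → ℂ) (ζ : Space d × Space d)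
    (y v : ℝ × Space d × Space d) :
    wavePhaseDeriv Ψ ζ y v = v.1 * (Ψ (ζ.2 - y.1 • ζ.1) - Complex.I * (⟪ζ.1, y.2.2⟫ : ℝ))
      + Complex.I * ((⟪ζ.1, v.2.1⟫ + ⟪ζ.2 - y.1 • ζ.1, v.2.2⟫ : ℝ) : ℂ) := by
  simp only [wavePhaseDeriv]
  simp [inner_sub_left, real_inner_smul_left]
  ring

lemma hasFDerivAt_wavePhase {Ψ : Space d → ℂ} (hΨ : Continuous Ψ) (ζ : Space d × Space d)
    (y : ℝ × Space d × Space d) :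
    HasFDerivAt (wavePhase Ψ ζ) (wavePhaseDeriv Ψ ζ y) y := by
  have ht : HasFDerivAt (fun y : ℝ × Space d × Space d => y.1)
      (ContinuousLinearMap.fst ℝ ℝ (Space d × Space d)) y := hasFDerivAt_fst
  have hx : HasFDerivAt (fun y : ℝ × Space d × Space d => ⟪ζ.1, y.2.1⟫)
      ((innerSL ℝ ζ.1).comp ((ContinuousLinearMap.fst ℝ (Space d) (Space d)).comp
          (ContinuousLinearMap.snd ℝ ℝ (Space d × Space d)))) y :=
    ((innerSL ℝ ζ.1).comp ((ContinuousLinearMap.fst ℝ (Space d) (Space d)).comp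
      (ContinuousLinearMap.snd ℝ ℝ (Space d × Space d)))).hasFDerivAt
  have hk : ∀ w : Space d, HasFDerivAt (fun y : ℝ × Space d × Space d => ⟪w, y.2.2⟫)
      ((innerSL ℝ w).comp ((ContinuousLinearMap.snd ℝ (Space d) (Space d)).comp
          (ContinuousLinearMap.snd ℝ ℝ (Space d × Space d)))) y := fun w =>
    ((innerSL ℝ w).comp ((ContinuousLinearMap.snd ℝ (Space d) (Space d)).comp
      (ContinuousLinearMap.snd ℝ ℝ (Space d × Space d)))).hasFDerivAt
  have hreal := (hx.sub (ht.mul (hk ζ.1))).add (hk ζ.2)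
  have h1 := (Complex.ofRealCLM.hasFDerivAt.comp y hreal).const_mul Complex.I
  have h2 := (hasDerivAt_phaseExponent hΨ y.1 ζ).hasFDerivAt.comp y ht
  have h3 := h1.add h2
  have hfun : (wavePhase Ψ ζ) = fun y : ℝ × Space d × Space d => Complex.I *
      (Complex.ofRealCLM ∘ fun y : ℝ × Space d × Space d =>
        ⟪ζ.1, y.2.1⟫ - y.1 * ⟪ζ.1, y.2.2⟫ + ⟪ζ.2, y.2.2⟫) y
      + ((fun s => phaseExponent Ψ s ζ) ∘ fun y : ℝ × Space d × Space d => y.1) y := by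
    ext y
    simp only [wavePhase, phaseInner, shear, inner_sub_right, real_inner_smul_right,
      Function.comp_apply, Complex.ofRealCLM_apply]
  rw [hfun]
  refine h3.congr_fderiv ?_
  ext v <;> simp [wavePhaseDeriv_apply, inner_sub_left, real_inner_smul_left] <;> ring

lemma norm_exp_wavePhase (Ψ : Space d → ℂ) (ζ : Space d × Space d) (y : ℝ × Space d × Space d) :
    ‖Complex.exp (wavePhase Ψ ζ y)‖ = ‖Complex.exp (phaseExponent Ψ y.1 ζ)‖ := by
  rw [wavePhase, Complex.exp_add, norm_mul, mul_comm Complex.I, Complex.norm_exp_ofReal_mul_I,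
    one_mul]

lemma continuous_wavePhase {Ψ : Space d → ℂ} (hΨ : Continuous Ψ) (y : ℝ × Space d × Space d) :
    Continuous fun ζ => wavePhase Ψ ζ y := by
  have := continuous_phaseExponent hΨ y.1
  unfold wavePhase
  fun_prop

lemma continuous_wavePhaseDeriv {Ψ : Space d → ℂ} (hΨ : Continuous Ψ) :
    Continuous fun p : (Space d × Space d) × (ℝ × Space d × Space d) =>
      wavePhaseDeriv Ψ p.1 p.2 := by
  have hv : Continuous fun p : (Space d × Space d) × (ℝ × Space d × Space d) =>
      p.1.2 - p.2.1 • p.1.1 := by fun_prop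
  have h1 : Continuous fun p : (Space d × Space d) × (ℝ × Space d × Space d) =>
      Ψ (p.1.2 - p.2.1 • p.1.1) - Complex.I * (⟪p.1.1, p.2.2.2⟫ : ℝ) := by fun_prop
  have h2 : Continuous fun p : (Space d × Space d) × (ℝ × Space d × Space d) =>
      innerSL ℝ p.1.1 := (innerSL ℝ).continuous.comp (by fun_prop)
  have h3 : Continuous fun p : (Space d × Space d) × (ℝ × Space d × Space d) =>
      innerSL ℝ (p.1.2 - p.2.1 • p.1.1) := (innerSL ℝ).continuous.comp hv
  exact ((ContinuousLinearMap.smulRightL ℝ _ ℂ (ContinuousLinearMap.fst ℝ ℝ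
      (Space d × Space d))).continuous.comp h1).add ((continuous_const_smul Complex.I).comp
      (continuous_const.clm_comp ((h2.clm_comp continuous_const).add
        (h3.clm_comp continuous_const))))

lemma norm_sub_smul_le (t : ℝ) (ζ : Space d × Space d) :
    ‖ζ.2 - t • ζ.1‖ ≤ (1 + |t|) * ‖ζ‖ := by
  refine (norm_sub_le _ _).trans ?_
  rw [norm_smul, Real.norm_eq_abs, add_mul, one_mul]
  gcongr
  exacts [norm_snd_le ζ, norm_fst_le ζ]

lemma norm_wavePhaseDeriv_le {Ψ : Space d → ℂ} {C : ℝ} (hC : ∀ q, ‖Ψ q‖ ≤ C * ‖q‖)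
    (ζ : Space d × Space d) (y : ℝ × Space d × Space d) :
    ‖wavePhaseDeriv Ψ ζ y‖ ≤ (C + 1) * ‖ζ.2 - y.1 • ζ.1‖ + (1 + ‖y.2.2‖) * ‖ζ‖ := by
  refine ContinuousLinearMap.opNorm_le_bound _ ?_ fun v => ?_
  · have h1 := (norm_nonneg (Ψ (ζ.2 - y.1 • ζ.1))).trans (hC _)
    have := norm_nonneg (ζ.2 - y.1 • ζ.1)
    nlinarith [mul_nonneg (add_nonneg zero_le_one (norm_nonneg y.2.2)) (norm_nonneg ζ)]
  rw [wavePhaseDeriv_apply]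
  have hv1 : |v.1| ≤ ‖v‖ := norm_fst_le v
  have hv2 : ‖v.2.1‖ ≤ ‖v‖ := (norm_fst_le _).trans (norm_snd_le v)
  have hv3 : ‖v.2.2‖ ≤ ‖v‖ := (norm_snd_le _).trans (norm_snd_le v)
  have hζ : ‖ζ.1‖ ≤ ‖ζ‖ := norm_fst_le ζ
  have e1 : ‖(v.1 : ℂ) * (Ψ (ζ.2 - y.1 • ζ.1) - Complex.I * (⟪ζ.1, y.2.2⟫ : ℝ))‖
      ≤ ‖v‖ * (C * ‖ζ.2 - y.1 • ζ.1‖ + ‖ζ‖ * ‖y.2.2‖) := by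
    rw [norm_mul, Complex.norm_real, Real.norm_eq_abs]
    refine mul_le_mul hv1 ((norm_sub_le _ _).trans (add_le_add (hC _) ?_)) (norm_nonneg _)
      (norm_nonneg _)
    rw [norm_mul, Complex.norm_I, one_mul, Complex.norm_real, Real.norm_eq_abs]
    exact (abs_real_inner_le_norm _ _).trans (by gcongr)
  have e2 : ‖Complex.I * ((⟪ζ.1, v.2.1⟫ + ⟪ζ.2 - y.1 • ζ.1, v.2.2⟫ : ℝ) : ℂ)‖
      ≤ ‖ζ‖ * ‖v‖ + ‖ζ.2 - y.1 • ζ.1‖ * ‖v‖ := by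
    rw [norm_mul, Complex.norm_I, one_mul, Complex.norm_real, Real.norm_eq_abs]
    refine (abs_add_le _ _).trans (add_le_add ?_ ?_)
    · exact (abs_real_inner_le_norm _ _).trans (by gcongr)
    · exact (abs_real_inner_le_norm _ _).trans (by gcongr)
  refine (norm_add_le _ _).trans ((add_le_add e1 e2).trans (le_of_eq ?_))
  ring

/-- The superposition of the elementary solutions with amplitude `F`. -/
def wave (Ψ : Space d → ℂ) (F : Space d × Space d → ℂ) (y : ℝ × Space d × Space d) : ℂ :=
  ∫ ζ, Complex.exp (wavePhase Ψ ζ y) * F ζ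

lemma IsJumpKernel.exists_wave_bound (hσ : IsJumpKernel σ) {θ : ℝ}
    (hθ : 0 < θ) (hθ1 : θ ≤ 1) (hlow : HasStableLowerBound σ θ)
    (hF : MemLp F 2 volume) {y₀ : ℝ × Space d × Space d} (hy₀ : 0 < y₀.1) :
    ∃ g : Space d × Space d → ℝ, Integrable g ∧ ∃ s ∈ 𝓝 y₀, ∀ y ∈ s, ∀ ζ,
      ‖Complex.exp (wavePhase (levyExponent σ) ζ y) * F ζ‖ ≤ g ζ ∧
      ‖(Complex.exp (wavePhase (levyExponent σ) ζ y) * F ζ)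
        • wavePhaseDeriv (levyExponent σ) ζ y‖ ≤ g ζ ∧
      ‖ζ.2 - y.1 • ζ.1‖ * ‖Complex.exp (wavePhase (levyExponent σ) ζ y) * F ζ‖ ≤ g ζ := by
  obtain ⟨g, hg, hb⟩ := hσ.exists_integrable_bound hθ hθ1 hlow hF (half_pos hy₀) 1
  set C := ∫ p, σ p * ‖p‖ with hC
  have hC0 : 0 ≤ C := integral_nonneg fun p => mul_nonneg (hσ.nonneg p) (norm_nonneg p)
  set A := (C + 1) * (2 + |y₀.1|) + (2 + ‖y₀.2.2‖) with hA
  have hA1 : 1 ≤ A := by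
    have : 0 ≤ (C + 1) * (2 + |y₀.1|) := by positivity
    linarith [norm_nonneg y₀.2.2]
  refine ⟨fun ζ => A * g ζ, hg.const_mul A, {y | y₀.1 / 2 < y.1} ∩ Metric.ball y₀ 1,
    inter_mem ((isOpen_lt continuous_const continuous_fst).mem_nhds (half_lt_self hy₀))
      (Metric.ball_mem_nhds _ one_pos), fun y hy ζ => ?_⟩
  obtain ⟨hy1, hy2⟩ := hy
  have hb' := hb y.1 (le_of_lt hy1) ζ
  have hyd : ‖y - y₀‖ < 1 := by simpa [dist_eq_norm] using hy2
  have ht : |y.1| ≤ 1 + |y₀.1| := by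
    have h1 : |y.1 - y₀.1| ≤ ‖y - y₀‖ := norm_fst_le (y - y₀)
    have h2 := abs_sub_abs_le_abs_sub y.1 y₀.1
    linarith
  have hk : ‖y.2.2‖ ≤ 1 + ‖y₀.2.2‖ := by
    have h1 : ‖y.2.2 - y₀.2.2‖ ≤ ‖y - y₀‖ := (norm_snd_le (y - y₀).2).trans (norm_snd_le (y - y₀))
    have h2 := norm_sub_norm_le y.2.2 y₀.2.2
    linarith
  rw [norm_mul, ← norm_exp_wavePhase, ← norm_mul, pow_one] at hb'
  set e := ‖Complex.exp (wavePhase (levyExponent σ) ζ y) * F ζ‖ with he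
  have he0 : 0 ≤ e := norm_nonneg _
  have hζ := norm_nonneg ζ
  have hg0 : 0 ≤ g ζ := le_trans (by positivity) hb'
  have hv : ‖ζ.2 - y.1 • ζ.1‖ ≤ (2 + |y₀.1|) * ‖ζ‖ :=
    (norm_sub_smul_le _ _).trans (mul_le_mul_of_nonneg_right (by linarith) hζ)
  have hAζ : ∀ a, a ≤ A * ‖ζ‖ → a * e ≤ A * g ζ := fun a ha => by
    calc a * e ≤ (A * ‖ζ‖) * e := mul_le_mul_of_nonneg_right ha he0
      _ ≤ A * ((1 + ‖ζ‖) * e) := by rw [mul_assoc]; gcongr; linarith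
      _ ≤ A * g ζ := by gcongr
  refine ⟨?_, ?_, ?_⟩
  · calc e = 1 * (1 * e) := by ring
      _ ≤ A * ((1 + ‖ζ‖) * e) := by gcongr; linarith
      _ ≤ A * g ζ := by gcongr
  · rw [norm_smul, mul_comm]
    refine hAζ _ ((norm_wavePhaseDeriv_le hσ.norm_levyExponent_le ζ y).trans ?_)
    have h1 := mul_le_mul_of_nonneg_left hv (by positivity : 0 ≤ C + 1)
    have h2 : (1 + ‖y.2.2‖) * ‖ζ‖ ≤ (2 + ‖y₀.2.2‖) * ‖ζ‖ :=
      mul_le_mul_of_nonneg_right (by linarith) hζ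
    calc _ ≤ _ := add_le_add h1 h2
      _ = A * ‖ζ‖ := by rw [hA]; ring
  · refine hAζ _ (hv.trans ?_)
    gcongr
    rw [hA]
    have : 0 ≤ C * (2 + |y₀.1|) := by positivity
    linarith [norm_nonneg y₀.2.2]

variable {θ : ℝ}

lemma IsJumpKernel.aestronglyMeasurable_wave (hσ : IsJumpKernel σ) (hF : MemLp F 2 volume)
    (y : ℝ × Space d × Space d) : AEStronglyMeasurable
      (fun ζ => Complex.exp (wavePhase (levyExponent σ) ζ y) * F ζ) volume := by
  have := continuous_wavePhase hσ.continuous_levyExponent y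
  exact (Continuous.aestronglyMeasurable (by fun_prop)).mul hF.1

lemma IsJumpKernel.aestronglyMeasurable_waveDeriv (hσ : IsJumpKernel σ) (hF : MemLp F 2 volume)
    (y : ℝ × Space d × Space d) : AEStronglyMeasurable
      (fun ζ => (Complex.exp (wavePhase (levyExponent σ) ζ y) * F ζ)
        • wavePhaseDeriv (levyExponent σ) ζ y) volume :=
  (hσ.aestronglyMeasurable_wave hF y).smul
    ((continuous_wavePhaseDeriv hσ.continuous_levyExponent).comp
      (by fun_prop : Continuous fun ζ : Space d × Space d => (ζ, y))).aestronglyMeasurable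

lemma IsJumpKernel.hasFDerivAt_wave (hσ : IsJumpKernel σ)
    (hθ : 0 < θ) (hθ1 : θ ≤ 1) (hlow : HasStableLowerBound σ θ)
    (hF : MemLp F 2 volume) {y : ℝ × Space d × Space d} (hy : 0 < y.1) :
    HasFDerivAt (wave (levyExponent σ) F)
      (∫ ζ, (Complex.exp (wavePhase (levyExponent σ) ζ y) * F ζ)
        • wavePhaseDeriv (levyExponent σ) ζ y) y := by
  obtain ⟨g, hg, s, hs, hb⟩ := hσ.exists_wave_bound hθ hθ1 hlow hF hy
  refine hasFDerivAt_integral_of_dominated_of_fderiv_le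
    (F' := fun y ζ => (Complex.exp (wavePhase (levyExponent σ) ζ y) * F ζ)
      • wavePhaseDeriv (levyExponent σ) ζ y) hs
    (.of_forall (hσ.aestronglyMeasurable_wave hF)) ?_ (hσ.aestronglyMeasurable_waveDeriv hF y)
    (.of_forall fun ζ y' hy' => (hb y' hy' ζ).2.1) hg (.of_forall fun ζ y' _ => ?_)
  · exact hg.mono' (hσ.aestronglyMeasurable_wave hF y)
      (.of_forall fun ζ => (hb y (mem_of_mem_nhds hs) ζ).1)
  · refine (((hasFDerivAt_wavePhase hσ.continuous_levyExponent ζ y').cexp).mul_const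
      (F ζ)).congr_fderiv ?_
    ext v <;> simp <;> ring

lemma IsJumpKernel.contDiffOn_wave (hσ : IsJumpKernel σ)
    (hθ : 0 < θ) (hθ1 : θ ≤ 1) (hlow : HasStableLowerBound σ θ) (hF : MemLp F 2 volume) :
    ContDiffOn ℝ 1 (wave (levyExponent σ) F) (Ioi 0 ×ˢ univ) := by
  intro y hy
  have hy0 : 0 < y.1 := hy.1
  refine ContDiffAt.contDiffWithinAt (contDiffAt_one_iff.2 ⟨_, {y | 0 < y.1},
    (isOpen_lt continuous_const continuous_fst).mem_nhds hy0, ?_,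
    fun y' hy' => hσ.hasFDerivAt_wave hθ hθ1 hlow hF hy'⟩)
  intro y' hy'
  obtain ⟨g, hg, s, hs, hb⟩ := hσ.exists_wave_bound hθ hθ1 hlow hF hy'
  refine ContinuousAt.continuousWithinAt (continuousAt_of_dominated
    (.of_forall (hσ.aestronglyMeasurable_waveDeriv hF)) ?_ hg (.of_forall fun ζ => ?_))
  · filter_upwards [hs] with z hz using .of_forall fun ζ => (hb z hz ζ).2.1
  · have h1 : ContinuousAt (fun y => Complex.exp (wavePhase (levyExponent σ) ζ y) * F ζ) y' :=
      ((hasFDerivAt_wavePhase hσ.continuous_levyExponent ζ y').continuousAt.cexp).mul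
        continuousAt_const
    have h2 : ContinuousAt (fun y => wavePhaseDeriv (levyExponent σ) ζ y) y' :=
      ((continuous_wavePhaseDeriv hσ.continuous_levyExponent).comp
        (by fun_prop : Continuous fun y : ℝ × Space d × Space d => (ζ, y))).continuousAt
    exact h1.smul h2

lemma wavePhase_translate (Ψ : Space d → ℂ) (ζ : Space d × Space d) (t : ℝ) (x k p : Space d) :
    Complex.exp (wavePhase Ψ ζ (t, x, k + p))
      = Complex.exp (wavePhase Ψ ζ (t, x, k))
        * Complex.exp (Complex.I * (⟪p, ζ.2 - t • ζ.1⟫ : ℝ)) := by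
  rw [← Complex.exp_add, wavePhase, wavePhase]
  congr 1
  simp only [phaseInner, shear, smul_add, inner_sub_right, inner_add_right, real_inner_smul_right,
    real_inner_comm p]
  push_cast
  ring

/-- The scattering operator acts on the elementary solution with frequency `(ξ, q)` at time `t` as
multiplication by `Ψ(q - t ξ)`. -/
lemma IsJumpKernel.scattering_wave (hσ : IsJumpKernel σ)
    (hθ : 0 < θ) (hθ1 : θ ≤ 1) (hlow : HasStableLowerBound σ θ)
    (hF : MemLp F 2 volume) {t : ℝ} (ht : 0 < t) (x k : Space d) :
    Integrable (fun p => (σ (p - k) : ℂ) *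
      (wave (levyExponent σ) F (t, x, p) - wave (levyExponent σ) F (t, x, k))) ∧
    scattering σ (fun q => wave (levyExponent σ) F (t, x, q)) k
      = ∫ ζ, levyExponent σ (ζ.2 - t • ζ.1)
        * (Complex.exp (wavePhase (levyExponent σ) ζ (t, x, k)) * F ζ) := by
  set Ψ := levyExponent σ with hΨ
  set e : Space d × Space d → ℂ := fun ζ => Complex.exp (wavePhase Ψ ζ (t, x, k)) * F ζ with he
  have hint : ∀ p, Integrable fun ζ => Complex.exp (wavePhase Ψ ζ (t, x, p)) * F ζ := fun p => by
    obtain ⟨g, hg, s, hs, hb⟩ := hσ.exists_wave_bound hθ hθ1 hlow hF (y₀ := (t, x, p)) ht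
    exact hg.mono' (hσ.aestronglyMeasurable_wave hF _)
      (.of_forall fun ζ => (hb _ (mem_of_mem_nhds hs) ζ).1)
  obtain ⟨g, hg, s, hs, hb⟩ := hσ.exists_wave_bound hθ hθ1 hlow hF (y₀ := (t, x, k)) ht
  set G : Space d → Space d × Space d → ℂ := fun p ζ =>
    (σ p : ℂ) * (Complex.exp (Complex.I * (⟪p, ζ.2 - t • ζ.1⟫ : ℝ)) - 1) * e ζ with hG
  have hGint : Integrable (Function.uncurry G) (volume.prod volume) := by
    refine (hσ.int.mul_prod hg).mono' ?_ (.of_forall fun w => ?_)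
    · refine AEStronglyMeasurable.mul (AEStronglyMeasurable.mul ?_ ?_) ?_
      · exact (Complex.continuous_ofReal.comp_aestronglyMeasurable hσ.aesm).comp_fst
      · exact Continuous.aestronglyMeasurable (by fun_prop)
      · exact (hσ.aestronglyMeasurable_wave hF (t, x, k)).comp_snd
    · have h1 := (hb _ (mem_of_mem_nhds hs) w.2).2.2
      have h2 := hσ.exponent_bound (w.2.2 - t • w.2.1) w.1
      simp only [Function.uncurry, hG]
      rw [norm_mul]
      calc _ ≤ σ w.1 * ‖w.1‖ * ‖w.2.2 - t • w.2.1‖ * ‖e w.2‖ := by gcongr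
        _ = σ w.1 * ‖w.1‖ * (‖w.2.2 - t • w.2.1‖ * ‖e w.2‖) := by ring
        _ ≤ _ := mul_le_mul_of_nonneg_left h1 (mul_nonneg (hσ.nonneg _) (norm_nonneg _))
  have hinner : ∀ p, ∫ ζ, G p ζ = (σ p : ℂ) * (wave Ψ F (t, x, k + p) - wave Ψ F (t, x, k)) := by
    intro p
    rw [wave, wave, ← integral_sub (hint _) (hint _), ← integral_const_mul]
    refine integral_congr_ae (.of_forall fun ζ => ?_)
    simp only [hG, he, wavePhase_translate]
    ring
  have h1 : Integrable fun p => (σ p : ℂ) * (wave Ψ F (t, x, k + p) - wave Ψ F (t, x, k)) := by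
    have := hGint.integral_prod_left
    simpa only [Function.uncurry, hinner] using this
  have htr : (fun p => (σ (p - k) : ℂ) * (wave Ψ F (t, x, p) - wave Ψ F (t, x, k)))
      = fun p => (fun p => (σ p : ℂ) * (wave Ψ F (t, x, k + p) - wave Ψ F (t, x, k))) (p - k) := by
    ext p
    simp
  refine ⟨by rw [htr]; exact h1.comp_sub_right k, ?_⟩
  rw [scattering, htr, integral_sub_right_eq_self
    (fun p => (σ p : ℂ) * (wave Ψ F (t, x, k + p) - wave Ψ F (t, x, k))) k]
  simp_rw [← hinner]
  rw [integral_integral_swap hGint]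
  refine integral_congr_ae (.of_forall fun ζ => ?_)
  simp only [hG]
  rw [integral_mul_const]
  rfl

lemma IsJumpKernel.wave_equation (hσ : IsJumpKernel σ)
    (hθ : 0 < θ) (hθ1 : θ ≤ 1) (hlow : HasStableLowerBound σ θ)
    (hF : MemLp F 2 volume) {t : ℝ} (ht : 0 < t) (x k : Space d) :
    deriv (fun s => wave (levyExponent σ) F (s, x, k)) t
        + fderiv ℝ (fun y => wave (levyExponent σ) F (t, y, k)) x k
      = scattering σ (fun q => wave (levyExponent σ) F (t, x, q)) k := by
  set Ψ := levyExponent σ with hΨ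
  have hD := hσ.hasFDerivAt_wave hθ hθ1 hlow hF (y := (t, x, k)) ht
  set D := ∫ ζ, (Complex.exp (wavePhase Ψ ζ (t, x, k)) * F ζ) • wavePhaseDeriv Ψ ζ (t, x, k)
  have h1 : deriv (fun s => wave Ψ F (s, x, k)) t = D (1, 0, 0) := by
    have hc : HasDerivAt (fun s : ℝ => (s, x, k)) ((1 : ℝ), (0 : Space d), (0 : Space d)) t :=
      (hasDerivAt_id t).prodMk (hasDerivAt_const t (x, k))
    exact (hD.comp_hasDerivAt t hc).deriv
  have h2 : fderiv ℝ (fun y => wave Ψ F (t, y, k)) x k = D (0, k, 0) := by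
    have hc : HasFDerivAt (fun y : Space d => (t, y, k))
        ((0 : Space d →L[ℝ] ℝ).prod ((ContinuousLinearMap.id ℝ (Space d)).prod 0)) x :=
      (hasFDerivAt_const t x).prodMk ((hasFDerivAt_id x).prodMk (hasFDerivAt_const k x))
    have hcomp := (HasFDerivAt.comp (g := wave Ψ F) x hD hc).fderiv
    simp only [Function.comp_def] at hcomp
    rw [hcomp]
    simp
  obtain ⟨g, hg, s, hs, hb⟩ := hσ.exists_wave_bound hθ hθ1 hlow hF (y₀ := (t, x, k)) ht
  have hDint : Integrable fun ζ => (Complex.exp (wavePhase Ψ ζ (t, x, k)) * F ζ)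
      • wavePhaseDeriv Ψ ζ (t, x, k) :=
    hg.mono' (hσ.aestronglyMeasurable_waveDeriv hF _)
      (.of_forall fun ζ => (hb _ (mem_of_mem_nhds hs) ζ).2.1)
  rw [h1, h2, ← map_add, (hσ.scattering_wave hθ hθ1 hlow hF ht x k).2,
    ContinuousLinearMap.integral_apply hDint]
  refine integral_congr_ae (.of_forall fun ζ => ?_)
  simp only [smul_apply, wavePhaseDeriv_apply, smul_eq_mul]
  simp
  ring

end Wave

/-! ### The stochastic representation solves the equation classically -/

section Representation

variable {Ω : Type*} [MeasurableSpace Ω] {P : Measure Ω} {L : ℝ≥0 → Ω → Space d}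

lemma ae_tendsto_displacement_zero (hL : IsLevyProcess L P) :
    ∀ᵐ ω ∂P, Tendsto (fun t => displacement L t ω) (𝓝 0) (𝓝 0) := by
  filter_upwards [hL.cadlag, hL.zero] with ω hω h0
  have h1 : Tendsto (fun t => L t ω) (𝓝 0) (𝓝 0) := by
    have h := (hω 0).1
    rw [ContinuousWithinAt, h0] at h
    have hI : Ici (0 : ℝ≥0) = univ := by ext; simp
    rwa [hI, nhdsWithin_univ] at h
  refine Tendsto.prodMk_nhds ?_ h1
  rw [Metric.tendsto_nhds] at h1
  obtain ⟨δ, hδ, hball⟩ := Metric.eventually_nhds_iff.1 (h1 1 one_pos)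
  have hcoe : Tendsto (fun t : ℝ≥0 => (t : ℝ)) (𝓝 0) (𝓝 0) := by
    simpa using NNReal.continuous_coe.tendsto 0
  refine squeeze_zero_norm' ?_ hcoe
  filter_upwards [Metric.ball_mem_nhds (0 : ℝ≥0) hδ] with t ht
  have ht' : (t : ℝ) < δ := by
    have := ht
    rw [Metric.mem_ball, NNReal.dist_eq] at this
    simpa using this
  rw [norm_neg]
  have := intervalIntegral.norm_integral_le_of_norm_le_const (a := 0) (b := (t : ℝ))
    (f := fun s => L s.toNNReal ω) (C := 1) fun s hs => by
      rw [uIoc_of_le t.coe_nonneg] at hs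
      have := hball (y := s.toNNReal) (by
        rw [NNReal.dist_eq, Real.coe_toNNReal _ hs.1.le, NNReal.coe_zero, sub_zero,
          abs_of_pos hs.1]
        exact hs.2.trans_lt ht')
      simpa using this.le
  simpa using this

variable [IsProbabilityMeasure P] {σ : Space d → ℝ} {Ψ : Space d → ℂ} {θ : ℝ}

instance (P : Measure Ω) [IsFiniteMeasure P] (L : ℝ≥0 → Ω → Space d) (t : ℝ≥0) :
    IsFiniteMeasure (displacementLaw P L t) :=
  inferInstanceAs (IsFiniteMeasure (P.map (displacement L t)))

/-- The family of `L²` functions given by the stochastic representation. -/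
def levySolution (P : Measure Ω) [IsFiniteMeasure P] (L : ℝ≥0 → Ω → Space d) (f : PhaseL2 d)
    (t : ℝ≥0) : PhaseL2 d :=
  evolve (displacementLaw P L t) t f

lemma ae_levySolution_eq_expectation (hL : IsLevyProcess L P) (f : PhaseL2 d) (t : ℝ≥0) :
    ∀ᵐ z : Space d × Space d,
      Integrable (fun ω => f (z.1 - (t : ℝ) • z.2 - (∫ s in (0 : ℝ)..t, L s.toNNReal ω),
        z.2 + L t ω)) P ∧
      levySolution P L f t z = ∫ ω, f (z.1 - (t : ℝ) • z.2 - (∫ s in (0 : ℝ)..t, L s.toNNReal ω),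
        z.2 + L t ω) ∂P := by
  have hD := aemeasurable_displacement hL t
  filter_upwards [coeFn_evolve (displacementLaw P L t) t f,
    (measurePreserving_shear (d := d) t).quasiMeasurePreserving.ae
      (ae_integrable_add (displacementLaw P L t) (Lp.memLp f))] with z hz hint
  have he : (fun ω => f (z.1 - (t : ℝ) • z.2 - (∫ s in (0 : ℝ)..t, L s.toNNReal ω), z.2 + L t ω))
      = fun ω => f (shear t z + displacement L t ω) := by
    ext ω
    simp only [shear, displacement, Prod.mk_add_mk, sub_eq_add_neg]
  rw [he]
  refine ⟨Integrable.comp_aemeasurable (f := displacement L t) hint hD, ?_⟩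
  rw [levySolution, hz]
  exact integral_map hD hint.1

lemma displacementLaw_eq {Ω' : Type*} [MeasurableSpace Ω'] {P' : Measure Ω'}
    [IsProbabilityMeasure P'] {L' : ℝ≥0 → Ω' → Space d} (hc : Continuous Ψ)
    (hL : IsLevyProcess L P) (hΨ : HasCharExponent L P Ψ)
    (hL' : IsLevyProcess L' P') (hΨ' : HasCharExponent L' P' Ψ) (t : ℝ≥0) :
    displacementLaw P L t = displacementLaw P' L' t :=
  ext_of_phaseChar fun ζ => by
    rw [phaseChar_displacementLaw hL hΨ hc, phaseChar_displacementLaw hL' hΨ' hc]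

lemma levySolution_eq {Ω' : Type*} [MeasurableSpace Ω'] {P' : Measure Ω'}
    [IsProbabilityMeasure P'] {L' : ℝ≥0 → Ω' → Space d} (hc : Continuous Ψ)
    (hL : IsLevyProcess L P) (hΨ : HasCharExponent L P Ψ)
    (hL' : IsLevyProcess L' P') (hΨ' : HasCharExponent L' P' Ψ) (f : PhaseL2 d) :
    levySolution P L f = levySolution P' L' f := by
  funext t
  simp only [levySolution, displacementLaw_eq hc hL hΨ hL' hΨ' t]

lemma norm_levySolution_le (hL : IsLevyProcess L P) (f : PhaseL2 d) (t : ℝ≥0) :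
    ‖levySolution P L f t‖ ≤ ‖f‖ := by
  have := isProbabilityMeasure_displacementLaw hL t
  exact norm_evolve_le _ _ _

lemma levySolution_sub (f g : PhaseL2 d) (t : ℝ≥0) :
    levySolution P L (f - g) t = levySolution P L f t - levySolution P L g t :=
  evolve_sub _ _ _ _

lemma levySolution_zero (hL : IsLevyProcess L P) (f : PhaseL2 d) :
    levySolution P L f 0 = f := by
  have hD : displacementLaw P L 0 = Measure.dirac 0 := by
    have h0 : displacement L 0 =ᵐ[P] fun _ => (0 : Space d × Space d) := by
      filter_upwards [hL.zero] with ω hω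
      simp [displacement, hω]
    rw [displacementLaw, Measure.map_congr h0, Measure.map_const]
    simp
  refine Lp.ext ?_
  filter_upwards [coeFn_evolve (displacementLaw P L 0) (0 : ℝ≥0) f] with z hz
  rw [levySolution, hz, hD]
  simp [shear]

/-- The pairing of two continuous functions with compact support, one of them moved by the free
transport and a displacement. -/
def shiftPairing (φ f : Space d × Space d → ℂ) (w : ℝ × Space d × Space d) : ℂ :=
  ∫ z, conj (φ z) * f (shear w.1 z + w.2)

lemma norm_shiftPairing_le {φ f : Space d × Space d → ℂ} {C : ℝ} (hφ : Integrable φ)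
    (hC : ∀ z, ‖f z‖ ≤ C) (w : ℝ × Space d × Space d) :
    ‖shiftPairing φ f w‖ ≤ ∫ z, ‖φ z‖ * C := by
  refine norm_integral_le_of_norm_le (hφ.norm.mul_const C) (.of_forall fun z => ?_)
  rw [norm_mul, RCLike.norm_conj]
  gcongr
  exact hC _

lemma continuous_shiftPairing {φ f : Space d × Space d → ℂ} (hφ : Continuous φ)
    (hφ' : Integrable φ) (hf : Continuous f) {C : ℝ} (hC : ∀ z, ‖f z‖ ≤ C) :
    Continuous (shiftPairing φ f) := by
  have h : Continuous fun p : (ℝ × Space d × Space d) × (Space d × Space d) =>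
      conj (φ p.2) * f (shear p.1.1 p.2 + p.1.2) := by
    unfold shear; fun_prop
  refine continuous_of_dominated (bound := fun z => ‖φ z‖ * C)
    (fun w => (h.comp (by fun_prop : Continuous fun z => (w, z))).aestronglyMeasurable)
    (fun w => .of_forall fun z => ?_) (hφ'.norm.mul_const C)
    (.of_forall fun z => h.comp (by fun_prop : Continuous fun w => (w, z)))
  rw [norm_mul, RCLike.norm_conj]
  gcongr
  exact hC _

lemma inner_evolve_eq_integral_shiftPairing {φ f : PhaseL2 d} {φ' f' : Space d × Space d → ℂ}
    (hφφ' : φ =ᵐ[volume] φ') (hff' : f =ᵐ[volume] f') (hφ : Continuous φ')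
    (hφ' : Integrable φ') (hf : Continuous f') {C : ℝ} (hC : ∀ z, ‖f' z‖ ≤ C)
    (μ : Measure (Space d × Space d)) [IsFiniteMeasure μ] (t : ℝ) :
    inner ℂ φ (evolve μ t f) = ∫ η, shiftPairing φ' f' (t, η) ∂μ := by
  rw [L2.inner_def]
  have h1 : (fun z => ∫ η, f (shear t z + η) ∂μ) =ᵐ[volume] fun z => ∫ η, f' (shear t z + η) ∂μ :=
    (measurePreserving_shear t).quasiMeasurePreserving.ae (integral_add_congr_ae μ hff')
  have h2 : ∀ᵐ z, inner ℂ (φ z) (evolve μ t f z)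
      = ∫ η, conj (φ' z) * f' (shear t z + η) ∂μ := by
    filter_upwards [coeFn_evolve μ t f, h1, hφφ'] with z hz hz' hzφ
    rw [hz, hz', hzφ, integral_const_mul, RCLike.inner_apply, mul_comm]
  rw [integral_congr_ae h2, integral_integral_swap]
  · rfl
  · have hcont : Continuous fun p : (Space d × Space d) × (Space d × Space d) =>
        conj (φ' p.1) * f' (shear t p.1 + p.2) := by
      unfold shear; fun_prop
    refine ((hφ'.norm.mul_prod (integrable_const (μ := μ) C))).mono' hcont.aestronglyMeasurable
      (.of_forall fun p => ?_)
    simp only [Function.uncurry]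
    rw [norm_mul, RCLike.norm_conj]
    gcongr
    exact hC _

lemma tendsto_inner_levySolution_of_continuous (hL : IsLevyProcess L P)
    {φ f : PhaseL2 d} {φ' f' : Space d × Space d → ℂ}
    (hφφ' : φ =ᵐ[volume] φ') (hff' : f =ᵐ[volume] f') (hφ : Continuous φ')
    (hφ' : Integrable φ') (hf : Continuous f') {C : ℝ} (hC : ∀ z, ‖f' z‖ ≤ C) :
    Tendsto (fun t => inner ℂ φ (levySolution P L f t)) (𝓝 0) (𝓝 (inner ℂ φ f)) := by
  have hcont := continuous_shiftPairing hφ hφ' hf hC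
  have hrep : ∀ t, inner ℂ φ (levySolution P L f t)
      = ∫ ω, shiftPairing φ' f' ((t : ℝ), displacement L t ω) ∂P := fun t => by
    rw [levySolution, inner_evolve_eq_integral_shiftPairing hφφ' hff' hφ hφ' hf hC,
      displacementLaw, integral_map (aemeasurable_displacement hL t)]
    exact (hcont.comp (by fun_prop : Continuous fun η : Space d × Space d =>
      ((t : ℝ), η))).aestronglyMeasurable
  have hlim : inner ℂ φ f = ∫ _ω, shiftPairing φ' f' ((0 : ℝ), 0) ∂P := by
    rw [L2.inner_def, integral_const]
    simp only [shiftPairing, shear, probReal_univ, one_smul, zero_smul, sub_zero, add_zero]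
    refine integral_congr_ae ?_
    filter_upwards [hφφ', hff'] with z h1 h2
    rw [h1, h2, RCLike.inner_apply, mul_comm]
  rw [hlim]
  simp_rw [hrep]
  refine tendsto_integral_filter_of_dominated_convergence (fun _ => ∫ z, ‖φ' z‖ * C)
    (.of_forall fun t => ?_) (.of_forall fun t => .of_forall fun ω => ?_)
    (integrable_const _) ?_
  · exact hcont.comp_aestronglyMeasurable
      (aestronglyMeasurable_const.prodMk (aemeasurable_displacement hL t).aestronglyMeasurable)
  · exact norm_shiftPairing_le hφ' hC _
  · filter_upwards [ae_tendsto_displacement_zero hL] with ω hω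
    refine (hcont.tendsto _).comp (Tendsto.prodMk_nhds ?_ hω)
    simpa using NNReal.continuous_coe.tendsto 0

lemma exists_continuous_approx (f : PhaseL2 d) {ε : ℝ} (hε : 0 < ε) :
    ∃ (g : PhaseL2 d) (g' : Space d × Space d → ℂ), ‖f - g‖ ≤ ε ∧ g =ᵐ[volume] g' ∧
      Continuous g' ∧ HasCompactSupport g' := by
  obtain ⟨g', hsupp, hle, hcont, hmem⟩ := (Lp.memLp f).exists_hasCompactSupport_eLpNorm_sub_le
    (by norm_num) (ε := ENNReal.ofReal ε) (by simpa using hε)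
  refine ⟨hmem.toLp g', g', ?_, hmem.coeFn_toLp, hcont, hsupp⟩
  rw [Lp.norm_def]
  refine ENNReal.toReal_le_of_le_ofReal hε.le ?_
  refine le_trans (le_of_eq (eLpNorm_congr_ae ?_)) hle
  filter_upwards [Lp.coeFn_sub f (hmem.toLp g'), hmem.coeFn_toLp] with z h1 h2
  rw [h1, Pi.sub_apply, Pi.sub_apply, h2]

lemma tendsto_inner_levySolution (hL : IsLevyProcess L P) (φ f : PhaseL2 d) :
    Tendsto (fun t => inner ℂ φ (levySolution P L f t)) (𝓝 0) (𝓝 (inner ℂ φ f)) := by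
  rw [Metric.tendsto_nhds]
  intro ε hε
  obtain ⟨φ₁, φ', hφ₁, hφφ', hφc, hφs⟩ := exists_continuous_approx φ
    (ε := ε / (8 * (‖f‖ + 1))) (by positivity)
  obtain ⟨f₁, f', hf₁, hff', hfc, hfs⟩ := exists_continuous_approx f
    (ε := ε / (8 * (‖φ₁‖ + 1))) (by positivity)
  obtain ⟨C, hC⟩ := hfs.exists_bound_of_continuous hfc
  have h := tendsto_inner_levySolution_of_continuous hL hφφ' hff' hφc
    (hφc.integrable_of_hasCompactSupport hφs) hfc hC
  filter_upwards [Metric.tendsto_nhds.1 h (ε / 2) (by positivity)] with t ht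
  set W := levySolution P L f t
  set W₁ := levySolution P L f₁ t
  have hW : ‖W - f‖ ≤ 2 * ‖f‖ := by
    have := (norm_sub_le W f).trans (add_le_add_left (norm_levySolution_le hL f t) _)
    linarith
  have hW₁ : ‖W - W₁‖ ≤ ‖f - f₁‖ := by
    rw [← levySolution_sub]
    exact norm_levySolution_le hL _ t
  have hdec : inner ℂ φ W - inner ℂ φ f = inner ℂ (φ - φ₁) (W - f)
      + (inner ℂ φ₁ (W - W₁) - inner ℂ φ₁ (f - f₁)) + (inner ℂ φ₁ W₁ - inner ℂ φ₁ f₁) := by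
    simp only [inner_sub_left, inner_sub_right]
    ring
  rw [dist_eq_norm] at ht ⊢
  rw [hdec]
  have e1 : ‖inner ℂ (φ - φ₁) (W - f)‖ ≤ ε / 4 := by
    calc _ ≤ ‖φ - φ₁‖ * ‖W - f‖ := norm_inner_le_norm _ _
      _ ≤ ε / (8 * (‖f‖ + 1)) * (2 * (‖f‖ + 1)) := by
        gcongr
        linarith
      _ = ε / 4 := by field_simp; norm_num
  have e2 : ∀ v : PhaseL2 d, ‖v‖ ≤ ‖f - f₁‖ → ‖inner ℂ φ₁ v‖ ≤ ε / 8 := fun v hv => by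
    calc _ ≤ ‖φ₁‖ * ‖v‖ := norm_inner_le_norm _ _
      _ ≤ (‖φ₁‖ + 1) * (ε / (8 * (‖φ₁‖ + 1))) := by
        gcongr
        · linarith
        · exact hv.trans hf₁
      _ = ε / 8 := by field_simp
  calc _ ≤ ‖inner ℂ (φ - φ₁) (W - f)‖ + (‖inner ℂ φ₁ (W - W₁)‖ + ‖inner ℂ φ₁ (f - f₁)‖)
        + ‖inner ℂ φ₁ W₁ - inner ℂ φ₁ f₁‖ :=
        (norm_add_le _ _).trans (add_le_add_left ((norm_add_le _ _).trans
          (add_le_add_right (norm_sub_le _ _) _)) _)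
    _ < ε := by linarith [e2 _ hW₁, e2 _ le_rfl]

lemma IsJumpKernel.memLp_exp_phaseExponent (hσ : IsJumpKernel σ)
    (hθ : 0 < θ) (hθ1 : θ ≤ 1) (hlow : HasStableLowerBound σ θ) {t : ℝ} (ht : 0 < t) :
    MemLp (fun ζ => Complex.exp (phaseExponent (levyExponent σ) t ζ)) 2 volume := by
  obtain ⟨K, hK⟩ := exists_memLp_one_add_norm_pow (d := d)
  obtain ⟨C, hC, hb⟩ := hσ.exists_exp_phaseExponent_le hθ hθ1 hlow ht K
  refine hK.of_le_mul (c := C) (Continuous.aestronglyMeasurable ?_) (.of_forall fun ζ => ?_)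
  · exact Complex.continuous_exp.comp (continuous_phaseExponent hσ.continuous_levyExponent t)
  · have h1 := hb t le_rfl ζ
    have hpos : 0 < (1 + ‖ζ‖) ^ K := by positivity
    rw [Real.norm_of_nonneg (by positivity), ← div_eq_mul_inv, le_div_iff₀ hpos, mul_comm]
    exact h1

lemma IsJumpKernel.exists_levySolution_ae_eq_wave (hσ : IsJumpKernel σ)
    (hθ : 0 < θ) (hθ1 : θ ≤ 1) (hlow : HasStableLowerBound σ θ) (hL : IsLevyProcess L P)
    (hΨ : HasCharExponent L P (levyExponent σ)) (f : PhaseL2 d) :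
    ∃ F : Space d × Space d → ℂ, MemLp F 2 volume ∧ ∀ t : ℝ≥0, 0 < t →
      levySolution P L f t =ᵐ[volume] fun z => wave (levyExponent σ) F (t, z) := by
  obtain ⟨F, hF, hrep⟩ := exists_fourier_average f
  refine ⟨F, hF, fun t ht => ?_⟩
  have hprob := isProbabilityMeasure_displacementLaw hL t
  have hchar := phaseChar_displacementLaw hL hΨ hσ.continuous_levyExponent t
  have hmem : MemLp (phaseChar (displacementLaw P L t)) 2 volume := by
    rw [funext hchar]
    exact hσ.memLp_exp_phaseExponent hθ hθ1 hlow (by exact_mod_cast ht)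
  filter_upwards [coeFn_evolve (displacementLaw P L t) t f,
    (measurePreserving_shear (d := d) t).quasiMeasurePreserving.ae
      (hrep (displacementLaw P L t) hmem)] with z h1 h2
  rw [levySolution, h1, h2, wave]
  refine integral_congr_ae (.of_forall fun ζ => ?_)
  simp only
  rw [hchar, wavePhase, Complex.exp_add]

/-- For positive times the stochastic representation has a smooth Fourier representation, because
the characteristic function of the displacement decays rapidly. -/
theorem IsJumpKernel.isClassicalSolution_levySolution (hσ : IsJumpKernel σ)
    (hθ : 0 < θ) (hθ1 : θ ≤ 1) (hlow : HasStableLowerBound σ θ) (hL : IsLevyProcess L P)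
    (hΨ : HasCharExponent L P (levyExponent σ)) (f : PhaseL2 d) :
    IsClassicalSolution σ f (levySolution P L f) where
  bounded := ⟨‖f‖, norm_levySolution_le hL f⟩
  initial := levySolution_zero hL f
  weakly_continuous_zero φ := tendsto_inner_levySolution hL φ f
  classical := by
    obtain ⟨F, hF, hae⟩ := hσ.exists_levySolution_ae_eq_wave hθ hθ1 hlow hL hΨ f
    exact ⟨wave (levyExponent σ) F, hσ.contDiffOn_wave hθ hθ1 hlow hF, hae, fun t x k ht =>
      ⟨(hσ.scattering_wave hθ hθ1 hlow hF ht x k).1, hσ.wave_equation hθ hθ1 hlow hF ht x k⟩⟩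

end Representation

/-! ### The kinetic generator and its Green identity -/

section Generator

variable {G : Type*} [NormedAddCommGroup G]

lemma HasCompactSupport.exists_radius {h : Space d × Space d → G} (hc : HasCompactSupport h) :
    ∃ r ≥ 0, ∀ z, r < ‖z‖ → h z = 0 := by
  obtain ⟨r, hr⟩ := hc.isBounded.subset_closedBall (0 : Space d × Space d)
  refine ⟨max r 0, le_max_right _ _, fun z hz => image_eq_zero_of_notMem_tsupport fun hmem => ?_⟩
  have := hr hmem
  rw [mem_closedBall_zero_iff] at this
  exact absurd hz (not_lt.2 (this.trans (le_max_left _ _)))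

variable [NormedSpace ℝ G] {σ : Space d → ℝ}

/-- The transport term `k · ∇ₓh`. -/
def transport (h : Space d × Space d → G) (z : Space d × Space d) : G := fderiv ℝ h z (z.2, 0)

/-- The scattering operator acting on the second variable, written with the jump `y = p - k` as
integration variable. -/
def collision (σ : Space d → ℝ) (h : Space d × Space d → G) (z : Space d × Space d) : G :=
  ∫ y, σ y • (h (z + (0, y)) - h z)

lemma scattering_eq_collision (σ : Space d → ℝ) (h : Space d × Space d → ℂ) (x k : Space d) :
    scattering σ (fun q => h (x, q)) k = collision σ h (x, k) := by
  have htr : (fun p => (σ (p - k) : ℂ) * (h (x, p) - h (x, k)))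
      = fun p => (fun y => σ y • (h ((x, k) + (0, y)) - h (x, k))) (p - k) := by
    ext p
    simp [Complex.real_smul]
  rw [scattering, htr, integral_sub_right_eq_self
    (fun y => σ y • (h ((x, k) + (0, y)) - h (x, k))) k]
  rfl

lemma fderiv_fst_section {h : Space d × Space d → G} {x k : Space d}
    (hh : DifferentiableAt ℝ h (x, k)) (v : Space d) :
    fderiv ℝ (fun y => h (y, k)) x v = fderiv ℝ h (x, k) (v, 0) := by
  have hc : HasFDerivAt (fun y : Space d => (y, k))
      ((ContinuousLinearMap.id ℝ (Space d)).prod 0) x :=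
    (hasFDerivAt_id x).prodMk (hasFDerivAt_const k x)
  have hcomp := (HasFDerivAt.comp (g := h) x hh.hasFDerivAt hc).fderiv
  simp only [Function.comp_def] at hcomp
  rw [hcomp]
  simp

lemma dualGenerator_eq (σ : Space d → ℝ) {lam : Space d × Space d → ℂ}
    (h : Differentiable ℝ lam) (z : Space d × Space d) :
    dualGenerator σ lam z = transport lam z + collision σ lam z := by
  rw [dualGenerator, scattering_eq_collision, fderiv_fst_section (h (z.1, z.2))]
  rfl

lemma exists_lipschitz_on_ball {h : Space d × Space d → G} (hh : ContDiff ℝ 1 h) (r R : ℝ) :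
    ∃ K ≥ 0, ∀ z, ‖z‖ ≤ r → ∀ y : Space d, ‖y‖ ≤ R → ‖h (z + (0, y)) - h z‖ ≤ K * ‖y‖ := by
  have hK := isCompact_closedBall (0 : Space d × Space d) (r + R)
  obtain ⟨C, hC⟩ := hK.exists_bound_of_continuousOn (hh.continuous_fderiv one_ne_zero).continuousOn
  refine ⟨max C 0, le_max_right _ _, fun z hz y hy => ?_⟩
  have hR : 0 ≤ R := (norm_nonneg y).trans hy
  have hzy : ‖((0 : Space d), y)‖ = ‖y‖ := by simp [Prod.norm_def]
  have := (convex_closedBall (0 : Space d × Space d) (r + R)).norm_image_sub_le_of_norm_fderiv_le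
    (f := h) (C := max C 0) (𝕜 := ℝ) (fun x _ => (hh.differentiable one_ne_zero).differentiableAt)
    (fun x hx => (hC x hx).trans (le_max_left _ _))
    (x := z) (y := z + (0, y)) (by simpa using by linarith)
    (by
      rw [mem_closedBall_zero_iff]
      exact (norm_add_le _ _).trans (add_le_add hz (hzy.trans_le hy)))
  simpa only [add_sub_cancel_left, hzy] using this

lemma IsJumpKernel.exists_jump_bound (hσ : IsJumpKernel σ) {h : Space d × Space d → G}
    (hh : ContDiff ℝ 1 h) (r : ℝ) :
    ∃ K ≥ 0, ∀ z, ‖z‖ ≤ r → ∀ y, ‖σ y • (h (z + (0, y)) - h z)‖ ≤ K * (σ y * ‖y‖) := by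
  obtain ⟨R, hR, hsupp⟩ := hσ.supp
  obtain ⟨K, hK, hb⟩ := exists_lipschitz_on_ball hh r R
  refine ⟨K, hK, fun z hz y => ?_⟩
  rcases lt_or_ge R ‖y‖ with hy | hy
  · simp [hsupp y hy]
  · rw [norm_smul, Real.norm_of_nonneg (hσ.nonneg y)]
    calc _ ≤ σ y * (K * ‖y‖) := mul_le_mul_of_nonneg_left (hb z hz y hy) (hσ.nonneg y)
      _ = _ := by ring

lemma IsJumpKernel.aestronglyMeasurable_jump (hσ : IsJumpKernel σ) {h : Space d × Space d → G}
    (hh : Continuous h) (z : Space d × Space d) :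
    AEStronglyMeasurable (fun y => σ y • (h (z + (0, y)) - h z)) volume :=
  hσ.aesm.smul (Continuous.aestronglyMeasurable (by fun_prop))

lemma IsJumpKernel.integrable_jump (hσ : IsJumpKernel σ) {h : Space d × Space d → G}
    (hh : ContDiff ℝ 1 h) (z : Space d × Space d) :
    Integrable fun y => σ y • (h (z + (0, y)) - h z) := by
  obtain ⟨K, _, hb⟩ := hσ.exists_jump_bound hh ‖z‖
  exact (hσ.int.const_mul K).mono' (hσ.aestronglyMeasurable_jump hh.continuous z)
    (.of_forall (hb z le_rfl))

lemma IsJumpKernel.continuous_collision (hσ : IsJumpKernel σ) {h : Space d × Space d → G}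
    (hh : ContDiff ℝ 1 h) : Continuous (collision σ h) := by
  refine continuous_iff_continuousAt.2 fun z => ?_
  obtain ⟨K, _, hb⟩ := hσ.exists_jump_bound hh (‖z‖ + 1)
  refine continuousAt_of_dominated (bound := fun y => K * (σ y * ‖y‖))
    (.of_forall (hσ.aestronglyMeasurable_jump hh.continuous)) ?_ (hσ.int.const_mul K)
    (.of_forall fun y => ?_)
  · filter_upwards [Metric.ball_mem_nhds z one_pos] with z' hz'
    refine .of_forall (hb z' ?_)
    have := norm_sub_norm_le z' z
    rw [mem_ball_iff_norm] at hz'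
    linarith
  · have := hh.continuous
    exact Continuous.continuousAt (by fun_prop)

lemma continuous_transport {h : Space d × Space d → G} (hh : ContDiff ℝ 1 h) :
    Continuous (transport h) :=
  (hh.continuous_fderiv one_ne_zero).clm_apply (by fun_prop)

lemma hasCompactSupport_transport {h : Space d × Space d → G} (hc : HasCompactSupport h) :
    HasCompactSupport (transport h) := by
  refine (hc.fderiv ℝ).mono fun z hz => ?_
  contrapose! hz
  simp only [Function.mem_support, not_not] at hz ⊢
  simp [transport, hz]

lemma le_norm_add_snd {R r : ℝ} {z : Space d × Space d} {y : Space d} (hz : r + R < ‖z‖)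
    (hy : ‖y‖ ≤ R) : r < ‖z + ((0 : Space d), y)‖ := by
  have h1 := norm_sub_norm_le z (-((0 : Space d), y))
  rw [sub_neg_eq_add, norm_neg] at h1
  have hzy : ‖((0 : Space d), y)‖ = ‖y‖ := by simp [Prod.norm_def]
  linarith

lemma IsJumpKernel.hasCompactSupport_collision (hσ : IsJumpKernel σ)
    {h : Space d × Space d → G} (hc : HasCompactSupport h) :
    HasCompactSupport (collision σ h) := by
  obtain ⟨R, hR, hsupp⟩ := hσ.supp
  obtain ⟨r, hr, hr0⟩ := HasCompactSupport.exists_radius hc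
  refine HasCompactSupport.intro (isCompact_closedBall 0 (r + R)) fun z hz => ?_
  rw [mem_closedBall_zero_iff, not_le] at hz
  refine integral_eq_zero_of_ae (.of_forall fun y => ?_)
  rcases lt_or_ge R ‖y‖ with hy | hy
  · simp [hsupp y hy]
  · simp [hr0 z (by linarith), hr0 _ (le_norm_add_snd hz hy)]

variable {𝕜 : Type*} [RCLike 𝕜]

lemma integral_transport_eq_zero {h : Space d × Space d → 𝕜} (hh : ContDiff ℝ 1 h)
    (hc : HasCompactSupport h) : ∫ z, transport h z = 0 := by
  have hint : Integrable (transport h) ((volume : Measure (Space d)).prod volume) :=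
    (continuous_transport hh).integrable_of_hasCompactSupport (hasCompactSupport_transport hc)
  have : ∫ z, transport h z = ∫ k, ∫ x, transport h (x, k) := integral_prod_symm _ hint
  rw [this]
  refine integral_eq_zero_of_ae (.of_forall fun k => ?_)
  have hsec : ContDiff ℝ 1 fun x => h (x, k) := hh.comp (by fun_prop)
  have hsupp : HasCompactSupport fun x => h (x, k) :=
    hc.comp_isClosedEmbedding (IsClosedEmbedding.of_continuous_injective_isClosedMap
      (by fun_prop) (Prod.mk_left_injective k) (isClosedMap_prodMk_right k))
  have hd : ∀ x, transport h (x, k) = fderiv ℝ (fun x => h (x, k)) x k := fun x =>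
    (fderiv_fst_section (hh.differentiable one_ne_zero).differentiableAt k).symm
  have h1 : Integrable fun x => fderiv ℝ (fun x => h (x, k)) x k := by
    refine Continuous.integrable_of_hasCompactSupport
      ((hsec.continuous_fderiv one_ne_zero).clm_apply continuous_const) ?_
    exact (hsupp.fderiv ℝ).comp_left (g := fun T : Space d →L[ℝ] 𝕜 => T k) rfl
  have := integral_smul_fderiv_eq_neg_fderiv_smul_of_integrable (μ := (volume : Measure (Space d)))
    (𝕜 := ℝ) (f := fun _ => (1 : ℝ)) (g := fun x => h (x, k)) (v := k) (by simp)
    (by simpa using h1)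
    (by simpa using hsec.continuous.integrable_of_hasCompactSupport hsupp)
    (fun _ _ => differentiableAt_const _)
    (fun x _ => (hsec.differentiable one_ne_zero).differentiableAt)
  simp only [Pi.zero_apply]
  simp_rw [hd]
  simpa using this

/-- The two-point form of the Green identity for the scattering term: the integrand is
antisymmetric under the exchange of `z` and `z + (0, y)`, because `σ` is even. -/
lemma IsJumpKernel.integral_exchange_eq_zero (hσ : IsJumpKernel σ) (g χ : Space d × Space d → 𝕜) :
    ∫ p : (Space d × Space d) × Space d,
      σ p.2 • (χ p.1 * g (p.1 + (0, p.2)) - g p.1 * χ (p.1 + (0, p.2))) = 0 := by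
  set H : (Space d × Space d) × Space d → 𝕜 := fun p =>
    σ p.2 • (χ p.1 * g (p.1 + (0, p.2)) - g p.1 * χ (p.1 + (0, p.2))) with hH
  set T : (Space d × Space d) × Space d → (Space d × Space d) × Space d :=
    fun p => (p.1 + (0, p.2), -p.2) with hT
  have hTmp : MeasurePreserving T volume volume := by
    have h1 : MeasurePreserving (fun p : Space d × (Space d × Space d) => (-p.1, p.2 + (0, p.1)))
        ((volume : Measure (Space d)).prod volume) (volume.prod volume) :=
      MeasurePreserving.skew_product (f := fun y => -y)
        (g := fun (y : Space d) (z : Space d × Space d) => z + (0, y))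
        (Measure.measurePreserving_neg volume) (by fun_prop)
        (.of_forall fun y => map_add_right_eq_self volume ((0 : Space d), y))
    exact (Measure.measurePreserving_swap.comp h1).comp Measure.measurePreserving_swap
  have hTT : ∀ p, T (T p) = p := fun p => by
    ext <;> simp [hT]
  have hTm : MeasurableEmbedding T := by
    have hc : Measurable T := by fun_prop
    exact (MeasurableEquiv.mk ⟨T, T, hTT, hTT⟩ hc hc).measurableEmbedding
  have hodd : ∀ p, H (T p) = - H p := fun p => by
    simp only [hH, hT, hσ.even, add_assoc, Prod.mk_add_mk, add_zero, add_neg_cancel]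
    rw [← smul_neg]
    congr 1
    have : p.1 + ((0 : Space d), (0 : Space d)) = p.1 := by simp
    rw [this]
    ring
  have h2 := hTmp.integral_comp hTm H
  simp_rw [hodd] at h2
  rw [integral_neg] at h2
  exact self_eq_neg.1 h2.symm

lemma IsJumpKernel.integrable_collision_left (hσ : IsJumpKernel σ) {g χ : Space d × Space d → 𝕜}
    (hg : ContDiff ℝ 1 g) (hχ : Continuous χ) (hc : HasCompactSupport χ) :
    Integrable fun p : (Space d × Space d) × Space d =>
      χ p.1 * (σ p.2 • (g (p.1 + (0, p.2)) - g p.1)) := by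
  obtain ⟨r, hr, hr0⟩ := HasCompactSupport.exists_radius hc
  obtain ⟨K, hK, hb⟩ := hσ.exists_jump_bound hg r
  have hgc := hg.continuous
  refine Integrable.mono' (((hχ.integrable_of_hasCompactSupport hc).norm.const_mul K).mul_prod
    hσ.int) ?_ (.of_forall fun p => ?_)
  · refine AEStronglyMeasurable.mul (Continuous.aestronglyMeasurable (by fun_prop)) ?_
    exact (AEStronglyMeasurable.comp_snd hσ.aesm).smul
      (Continuous.aestronglyMeasurable (by fun_prop))
  · rw [norm_mul]
    rcases lt_or_ge r ‖p.1‖ with hz | hz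
    · simp [hr0 _ hz]
    · calc _ ≤ ‖χ p.1‖ * (K * (σ p.2 * ‖p.2‖)) := by gcongr; exact hb _ hz _
        _ = _ := by ring

lemma IsJumpKernel.integrable_collision_right (hσ : IsJumpKernel σ)
    {g χ : Space d × Space d → 𝕜} (hg : Continuous g) (hχ : ContDiff ℝ 1 χ)
    (hc : HasCompactSupport χ) :
    Integrable fun p : (Space d × Space d) × Space d =>
      g p.1 * (σ p.2 • (χ (p.1 + (0, p.2)) - χ p.1)) := by
  obtain ⟨R, hR, hsupp⟩ := hσ.supp
  obtain ⟨r, hr, hr0⟩ := HasCompactSupport.exists_radius hc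
  obtain ⟨K, hK, hb⟩ := hσ.exists_jump_bound hχ (r + R)
  have hχc := hχ.continuous
  have hint : Integrable ((Metric.closedBall (0 : Space d × Space d) (r + R)).indicator
      fun z => K * ‖g z‖) := by
    refine (IntegrableOn.integrable_indicator ?_ Metric.isClosed_closedBall.measurableSet)
    exact (Continuous.continuousOn (by fun_prop)).integrableOn_compact (isCompact_closedBall _ _)
  refine Integrable.mono' (hint.mul_prod hσ.int) ?_ (.of_forall fun p => ?_)
  · refine AEStronglyMeasurable.mul (Continuous.aestronglyMeasurable (by fun_prop)) ?_
    exact (AEStronglyMeasurable.comp_snd hσ.aesm).smul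
      (Continuous.aestronglyMeasurable (by fun_prop))
  · rw [norm_mul]
    rcases lt_or_ge (r + R) ‖p.1‖ with hz | hz
    · have h0 : σ p.2 • (χ (p.1 + (0, p.2)) - χ p.1) = 0 := by
        rcases lt_or_ge R ‖p.2‖ with hy | hy
        · simp [hsupp _ hy]
        · simp [hr0 p.1 (by linarith), hr0 _ (le_norm_add_snd hz hy)]
      rw [h0, norm_zero, mul_zero]
      exact mul_nonneg (indicator_nonneg (fun _ _ => by positivity) _)
        (mul_nonneg (hσ.nonneg _) (norm_nonneg _))
    · rw [indicator_of_mem (by simpa using hz)]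
      calc _ ≤ ‖g p.1‖ * (K * (σ p.2 * ‖p.2‖)) := by gcongr; exact hb _ hz _
        _ = _ := by ring

lemma IsJumpKernel.integral_mul_collision (hσ : IsJumpKernel σ) {g χ : Space d × Space d → 𝕜}
    (hg : ContDiff ℝ 1 g) (hχ : ContDiff ℝ 1 χ) (hc : HasCompactSupport χ) :
    ∫ z, χ z * collision σ g z = ∫ z, g z * collision σ χ z := by
  have h1 := hσ.integrable_collision_left hg hχ.continuous hc
  have h2 := hσ.integrable_collision_right hg.continuous hχ hc
  have e1 : ∫ z, χ z * collision σ g z = ∫ p : (Space d × Space d) × Space d,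
      χ p.1 * (σ p.2 • (g (p.1 + (0, p.2)) - g p.1)) := by
    refine Eq.trans ?_ (integral_prod _ h1).symm
    exact integral_congr_ae (.of_forall fun z => (integral_const_mul _ _).symm)
  have e2 : ∫ z, g z * collision σ χ z = ∫ p : (Space d × Space d) × Space d,
      g p.1 * (σ p.2 • (χ (p.1 + (0, p.2)) - χ p.1)) := by
    refine Eq.trans ?_ (integral_prod _ h2).symm
    exact integral_congr_ae (.of_forall fun z => (integral_const_mul _ _).symm)
  rw [e1, e2, ← sub_eq_zero, ← integral_sub h1 h2, ← hσ.integral_exchange_eq_zero g χ]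
  refine integral_congr_ae (.of_forall fun p => ?_)
  beta_reduce
  rw [mul_smul_comm, mul_smul_comm, ← smul_sub]
  congr 1
  ring

/-- The Green identity: `k · ∇ₓ + ℒ` is the formal adjoint of `-k · ∇ₓ + ℒ`. -/
lemma IsJumpKernel.green_identity (hσ : IsJumpKernel σ) {g χ : Space d × Space d → 𝕜}
    (hg : ContDiff ℝ 1 g) (hχ : ContDiff ℝ 1 χ) (hc : HasCompactSupport χ) :
    ∫ z, χ z * (collision σ g z - transport g z)
      = ∫ z, g z * (transport χ z + collision σ χ z) := by
  have hgc := hg.continuous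
  have hχc := hχ.continuous
  have htr : ∀ z, transport (g * χ) z = g z * transport χ z + χ z * transport g z := fun z => by
    have := fderiv_mul (𝕜 := ℝ) (hg.differentiable one_ne_zero).differentiableAt
      (hχ.differentiable one_ne_zero).differentiableAt (x := z)
    rw [transport, this]
    simp [transport]
  have i1 : Integrable fun z => g z * transport χ z :=
    (hgc.mul (continuous_transport hχ)).integrable_of_hasCompactSupport
      (hasCompactSupport_transport hc).mul_left
  have i2 : Integrable fun z => χ z * transport g z :=
    (hχc.mul (continuous_transport hg)).integrable_of_hasCompactSupport hc.mul_right
  have i3 : Integrable fun z => χ z * collision σ g z :=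
    (hχc.mul (hσ.continuous_collision hg)).integrable_of_hasCompactSupport hc.mul_right
  have i4 : Integrable fun z => g z * collision σ χ z :=
    (hgc.mul (hσ.continuous_collision hχ)).integrable_of_hasCompactSupport
      (hσ.hasCompactSupport_collision hc).mul_left
  have hprod : ∫ z, (g z * transport χ z + χ z * transport g z) = 0 := by
    rw [← integral_transport_eq_zero (hg.mul hχ) hc.mul_left]
    exact integral_congr_ae (.of_forall fun z => (htr z).symm)
  rw [integral_add i1 i2] at hprod
  simp_rw [mul_sub, mul_add]
  rw [integral_sub i3 i2, integral_add i1 i4, hσ.integral_mul_collision hg hχ hc,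
    eq_neg_of_add_eq_zero_left hprod]
  ring

end Generator

/-! ### Classical solutions are weak solutions -/

section ClassicalWeak

variable {σ : Space d → ℝ} {W₀ : PhaseL2 d} {W : ℝ≥0 → PhaseL2 d}

lemma pairing_eq_inner (f : PhaseL2 d) {φ : Space d × Space d → ℂ} (hφ : MemLp φ 2 volume) :
    pairing f φ = inner ℂ (hφ.toLp φ) f := by
  rw [L2.inner_def]
  refine integral_congr_ae ?_
  filter_upwards [hφ.coeFn_toLp] with z hz
  rw [hz, RCLike.inner_apply]

lemma norm_pairing_le (f : PhaseL2 d) {φ : Space d × Space d → ℂ} (hφ : MemLp φ 2 volume) :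
    ‖pairing f φ‖ ≤ ‖hφ.toLp φ‖ * ‖f‖ := by
  rw [pairing_eq_inner f hφ]
  exact norm_inner_le_norm _ _

lemma IsJumpKernel.continuous_dualGenerator (hσ : IsJumpKernel σ)
    {lam : Space d × Space d → ℂ} (h : ContDiff ℝ 1 lam) : Continuous (dualGenerator σ lam) := by
  rw [funext (dualGenerator_eq σ (h.differentiable one_ne_zero))]
  exact (continuous_transport h).add (hσ.continuous_collision h)

lemma IsJumpKernel.hasCompactSupport_dualGenerator (hσ : IsJumpKernel σ)
    {lam : Space d × Space d → ℂ} (h : ContDiff ℝ 1 lam) (hc : HasCompactSupport lam) :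
    HasCompactSupport (dualGenerator σ lam) := by
  rw [funext (dualGenerator_eq σ (h.differentiable one_ne_zero))]
  exact (hasCompactSupport_transport hc).add (hσ.hasCompactSupport_collision hc)

lemma IsJumpKernel.memLp_dualGenerator (hσ : IsJumpKernel σ)
    {lam : Space d × Space d → ℂ} (h : ContDiff ℝ 1 lam) (hc : HasCompactSupport lam) :
    MemLp (dualGenerator σ lam) 2 volume :=
  (hσ.continuous_dualGenerator h).memLp_of_hasCompactSupport
    (hσ.hasCompactSupport_dualGenerator h hc)

lemma transport_conj {lam : Space d × Space d → ℂ} (z : Space d × Space d) :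
    transport (fun w => conj (lam w)) z = conj (transport lam z) := by
  have := Complex.conjCLE.comp_fderiv (f := lam) (x := z)
  rw [transport, transport]
  exact congrArg (fun T : Space d × Space d →L[ℝ] ℂ => T (z.2, 0)) this

lemma collision_conj {lam : Space d × Space d → ℂ} (z : Space d × Space d) :
    collision σ (fun w => conj (lam w)) z = conj (collision σ lam z) := by
  rw [collision, collision, ← integral_conj]
  refine integral_congr_ae (.of_forall fun y => ?_)
  simp [Complex.real_smul]

lemma IsJumpKernel.integral_eq_integral_dualGenerator (hσ : IsJumpKernel σ)
    {g lam : Space d × Space d → ℂ} (hg : ContDiff ℝ 1 g) (h : ContDiff ℝ 1 lam)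
    (hc : HasCompactSupport lam) :
    ∫ z, (collision σ g z - transport g z) * conj (lam z)
      = ∫ z, g z * conj (dualGenerator σ lam z) := by
  have hχ : ContDiff ℝ 1 fun w => conj (lam w) := Complex.conjCLE.contDiff.comp h
  have hχc : HasCompactSupport fun w => conj (lam w) := hc.comp_left (map_zero _)
  have := hσ.green_identity hg hχ hχc
  simp only [transport_conj, collision_conj, ← map_add,
    ← dualGenerator_eq σ (h.differentiable one_ne_zero)] at this
  rw [← this]
  exact integral_congr_ae (.of_forall fun z => mul_comm _ _)

/-- Differentiation in time of the pairing of a `C¹` function with a test function. -/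
lemma hasDerivAt_integral_mul {u : ℝ × Space d × Space d → ℂ}
    (hu : ContDiffOn ℝ 1 u (Ioi 0 ×ˢ univ)) {φ : Space d × Space d → ℂ} (hφ : Continuous φ)
    (hc : HasCompactSupport φ) {s : ℝ} (hs : 0 < s) :
    HasDerivAt (fun r => ∫ z, u (r, z) * φ z) (∫ z, deriv (fun r => u (r, z)) s * φ z) s := by
  have hopen : IsOpen ((Ioi 0 : Set ℝ) ×ˢ (univ : Set (Space d × Space d))) :=
    isOpen_Ioi.prod isOpen_univ
  have hfd : ContinuousOn (fderiv ℝ u) (Ioi 0 ×ˢ univ) :=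
    hu.continuousOn_fderiv_of_isOpen hopen le_rfl
  have hdiff : ∀ r > 0, ∀ z, HasDerivAt (fun r => u (r, z)) (fderiv ℝ u (r, z) (1, 0)) r := by
    intro r hr z
    have h1 : DifferentiableAt ℝ u (r, z) := (hu.differentiableOn one_ne_zero).differentiableAt
      (hopen.mem_nhds ⟨hr, mem_univ _⟩)
    exact h1.hasFDerivAt.comp_hasDerivAt r ((hasDerivAt_id r).prodMk (hasDerivAt_const r z))
  have hucont : ∀ r > 0, Continuous fun z => u (r, z) := fun r hr =>
    hu.continuousOn.comp_continuous (by fun_prop) fun z => ⟨hr, mem_univ _⟩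
  have hK : IsCompact (Icc (s / 2) (2 * s) ×ˢ tsupport φ) := isCompact_Icc.prod hc
  obtain ⟨B, hB⟩ := hK.exists_bound_of_continuousOn (hfd.mono (prod_mono
    (fun r hr => (half_pos hs).trans_le hr.1) (subset_univ _)))
  have hnhds : Ioo (s / 2) (2 * s) ∈ 𝓝 s := Ioo_mem_nhds (by linarith) (by linarith)
  have hpos : ∀ r ∈ Ioo (s / 2) (2 * s), 0 < r := fun r hr => (half_pos hs).trans hr.1
  refine (hasDerivAt_integral_of_dominated_loc_of_deriv_le
    (F := fun r z => u (r, z) * φ z) (F' := fun r z => deriv (fun r => u (r, z)) r * φ z)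
    (bound := fun z => B * ‖((1 : ℝ), (0 : Space d × Space d))‖ * ‖φ z‖) hnhds ?_ ?_ ?_ ?_ ?_ ?_).2
  · filter_upwards [hnhds] with r hr
    exact ((hucont r (hpos r hr)).mul hφ).aestronglyMeasurable
  · exact ((hucont s hs).mul hφ).integrable_of_hasCompactSupport hc.mul_left
  · simp_rw [(hdiff s hs _).deriv]
    refine (Continuous.mul ?_ hφ).aestronglyMeasurable
    exact (hfd.comp_continuous (f := fun z => (s, z)) (by fun_prop)
      fun z => ⟨hs, mem_univ _⟩).clm_apply continuous_const
  · refine .of_forall fun z r hr => ?_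
    rw [(hdiff r (hpos r hr) z).deriv, norm_mul]
    by_cases hz : z ∈ tsupport φ
    · gcongr
      exact (ContinuousLinearMap.le_opNorm _ _).trans (mul_le_mul_of_nonneg_right
        (hB (r, z) ⟨⟨hr.1.le, hr.2.le⟩, hz⟩) (norm_nonneg _))
    · simp [image_eq_zero_of_notMem_tsupport hz]
  · exact (hφ.integrable_of_hasCompactSupport hc).norm.const_mul _
  · exact .of_forall fun z r hr => ((hdiff r (hpos r hr) z).differentiableAt.hasDerivAt).mul_const _

lemma IsClassicalSolution.hasDerivAt_pairing (hσ : IsJumpKernel σ)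
    (h : IsClassicalSolution σ W₀ W) {lam : Space d × Space d → ℂ} (hlam : ContDiff ℝ 1 lam)
    (hc : HasCompactSupport lam) {s : ℝ} (hs : 0 < s) :
    HasDerivAt (fun r : ℝ => pairing (W r.toNNReal) lam)
      (pairing (W s.toNNReal) (dualGenerator σ lam)) s := by
  obtain ⟨u, hu, hWu, heq⟩ := h.classical
  have hae : ∀ r > 0, W (Real.toNNReal r) =ᵐ[volume] fun z => u (r, z) := fun r hr => by
    have := hWu r.toNNReal (Real.toNNReal_pos.2 hr)
    rwa [Real.coe_toNNReal _ hr.le] at this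
  have hpair : ∀ r > 0, ∀ φ, pairing (W (Real.toNNReal r)) φ = ∫ z, u (r, z) * conj (φ z) :=
    fun r hr φ => integral_congr_ae ((hae r hr).mono fun z hz => by simp only [hz])
  have hcont : ContDiff ℝ 1 fun z => u (s, z) := contDiff_iff_contDiffAt.2 fun z => by
    have hmem : (s, z) ∈ (Ioi 0 : Set ℝ) ×ˢ (univ : Set (Space d × Space d)) := ⟨hs, mem_univ z⟩
    exact (hu.contDiffAt ((isOpen_Ioi.prod isOpen_univ).mem_nhds hmem)).comp z
      (by fun_prop : ContDiffAt ℝ 1 (fun z : Space d × Space d => (s, z)) z)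
  have hd := hasDerivAt_integral_mul hu (φ := fun z => conj (lam z))
    (Complex.continuous_conj.comp hlam.continuous) (hc.comp_left (map_zero _)) hs
  have hval : ∫ z, deriv (fun r => u (r, z)) s * conj (lam z)
      = pairing (W s.toNNReal) (dualGenerator σ lam) := by
    rw [hpair s hs, ← hσ.integral_eq_integral_dualGenerator hcont hlam hc]
    refine integral_congr_ae (.of_forall fun z => ?_)
    have h1 := (heq s z.1 z.2 hs).2
    rw [scattering_eq_collision σ (fun z => u (s, z)), fderiv_fst_section (h := fun z => u (s, z))
      (hcont.differentiable one_ne_zero).differentiableAt] at h1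
    simp only
    rw [eq_sub_of_add_eq h1]
    rfl
  rw [← hval]
  refine hd.congr_of_eventuallyEq ?_
  filter_upwards [Ioi_mem_nhds hs] with r hr using hpair r hr lam

theorem IsClassicalSolution.isWeakSolution (hσ : IsJumpKernel σ)
    (h : IsClassicalSolution σ W₀ W) : IsWeakSolution σ W₀ W := by
  obtain ⟨C, hC⟩ := h.bounded
  have hC0 : 0 ≤ C := (norm_nonneg _).trans (hC 0)
  have hint : ∀ lam : Space d × Space d → ℂ, ContDiff ℝ 1 lam → HasCompactSupport lam →
      ∀ t : ℝ≥0, IntervalIntegrable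
        (fun s : ℝ => pairing (W s.toNNReal) (dualGenerator σ lam)) volume 0 t := by
    intro lam hlam hc t
    rw [intervalIntegrable_iff_integrableOn_Ioc_of_le t.coe_nonneg]
    have hmem := hσ.memLp_dualGenerator hlam hc
    refine Integrable.of_bound ?_ (‖hmem.toLp _‖ * C)
      (.of_forall fun s => (norm_pairing_le _ hmem).trans (by gcongr; exact hC _))
    refine AEStronglyMeasurable.congr (f := deriv fun r : ℝ => pairing (W r.toNNReal) lam)
      (measurable_deriv _).aestronglyMeasurable ?_
    filter_upwards [ae_restrict_mem measurableSet_Ioc] with s hs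
    exact (h.hasDerivAt_pairing hσ hlam hc hs.1).deriv
  refine ⟨h.bounded, fun lam hlam => hint lam (hlam.of_le (by exact_mod_cast le_top)),
    fun lam hlam hc t => ?_⟩
  have hlam1 : ContDiff ℝ 1 lam := hlam.of_le (by exact_mod_cast le_top)
  rcases eq_zero_or_pos t with rfl | ht
  · simp [h.initial]
  have ht' : (0 : ℝ) < t := by exact_mod_cast ht
  have hmem : MemLp lam 2 volume := hlam1.continuous.memLp_of_hasCompactSupport hc
  have hlim0 : Tendsto (fun r : ℝ => pairing (W r.toNNReal) lam) (𝓝[>] 0)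
      (𝓝 (pairing W₀ lam)) := by
    simp_rw [pairing_eq_inner _ hmem]
    refine (h.weakly_continuous_zero _).comp (Tendsto.mono_left ?_ nhdsWithin_le_nhds)
    simpa using continuous_real_toNNReal.tendsto 0
  have hlimt : Tendsto (fun r : ℝ => pairing (W r.toNNReal) lam) (𝓝[<] (t : ℝ))
      (𝓝 (pairing (W t) lam)) := by
    have := (h.hasDerivAt_pairing hσ hlam1 hc ht').continuousAt.tendsto
    rw [Real.toNNReal_coe] at this
    exact this.mono_left nhdsWithin_le_nhds
  rw [intervalIntegral.integral_eq_sub_of_hasDerivAt_of_tendsto ht'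
    (fun s hs => h.hasDerivAt_pairing hσ hlam1 hc hs.1) (hint lam hlam1 hc t) hlim0 hlimt]
  ring

end ClassicalWeak

/-! ### Weak solutions and their regularization -/

section Regularization

open scoped Convolution

variable {σ : Space d → ℝ} {W₀ W₀' : PhaseL2 d} {W W' : ℝ≥0 → PhaseL2 d}

instance : (volume : Measure (Space d × Space d)).IsNegInvariant :=
  ⟨((Measure.measurePreserving_neg (volume : Measure (Space d))).prod
    (Measure.measurePreserving_neg (volume : Measure (Space d)))).map_eq⟩

lemma pairing_sub (f g : PhaseL2 d) {φ : Space d × Space d → ℂ} (hφ : MemLp φ 2 volume) :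
    pairing (f - g : PhaseL2 d) φ = pairing f φ - pairing g φ := by
  rw [pairing_eq_inner _ hφ, pairing_eq_inner _ hφ, pairing_eq_inner _ hφ, inner_sub_right]

lemma IsWeakSolution.sub (hσ : IsJumpKernel σ) (h : IsWeakSolution σ W₀ W)
    (h' : IsWeakSolution σ W₀' W') : IsWeakSolution σ (W₀ - W₀') (fun t => W t - W' t) := by
  obtain ⟨C, hC⟩ := h.bounded
  obtain ⟨C', hC'⟩ := h'.bounded
  have key : ∀ lam : Space d × Space d → ℂ, ContDiff ℝ ((⊤ : ℕ∞) : WithTop ℕ∞) lam →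
      HasCompactSupport lam → ∀ s : ℝ≥0, pairing (W s - W' s : PhaseL2 d) (dualGenerator σ lam)
        = pairing (W s) (dualGenerator σ lam) - pairing (W' s) (dualGenerator σ lam) :=
    fun lam hlam hc s => pairing_sub _ _
      (hσ.memLp_dualGenerator (hlam.of_le (by exact_mod_cast le_top)) hc)
  refine ⟨⟨C + C', fun t => (norm_sub_le _ _).trans (add_le_add (hC t) (hC' t))⟩,
    fun lam hlam hc t => ?_, fun lam hlam hc t => ?_⟩
  · simp_rw [key lam hlam hc]
    exact (h.intervalIntegrable lam hlam hc t).sub (h'.intervalIntegrable lam hlam hc t)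
  · have hmem : MemLp lam 2 volume := hlam.continuous.memLp_of_hasCompactSupport hc
    simp_rw [key lam hlam hc]
    rw [intervalIntegral.integral_sub (h.intervalIntegrable lam hlam hc t)
      (h'.intervalIntegrable lam hlam hc t), pairing_sub _ _ hmem, pairing_sub _ _ hmem]
    linear_combination h.weak_eq lam hlam hc t - h'.weak_eq lam hlam hc t

/-- Weak solutions are weakly continuous in `L²`. -/
lemma IsWeakSolution.continuous_inner (hσ : IsJumpKernel σ) (h : IsWeakSolution σ W₀ W)
    (φ : PhaseL2 d) : Continuous fun s => inner ℂ φ (W s) := by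
  obtain ⟨C, hC⟩ := h.bounded
  have hC0 : 0 ≤ C := (norm_nonneg _).trans (hC 0)
  have htest : ∀ lam : Space d × Space d → ℂ, ContDiff ℝ ((⊤ : ℕ∞) : WithTop ℕ∞) lam →
      HasCompactSupport lam → Continuous fun s => pairing (W s) lam := by
    intro lam hlam hc
    have hmem := hσ.memLp_dualGenerator (hlam.of_le (by exact_mod_cast le_top)) hc
    have hle : ∀ r : ℝ, ‖pairing (W r.toNNReal) (dualGenerator σ lam)‖ ≤ ‖hmem.toLp _‖ * C :=
      fun r => (norm_pairing_le _ hmem).trans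
        (mul_le_mul_of_nonneg_left (hC _) (norm_nonneg _))
    refine LipschitzWith.continuous (K := ⟨‖hmem.toLp _‖ * C, by positivity⟩)
      (LipschitzWith.of_dist_le_mul fun s t => ?_)
    have hst : pairing (W s) lam - pairing (W t) lam
        = ∫ r in (t : ℝ)..s, pairing (W r.toNNReal) (dualGenerator σ lam) := by
      rw [← intervalIntegral.integral_interval_sub_left (h.intervalIntegrable lam hlam hc s)
        (h.intervalIntegrable lam hlam hc t)]
      linear_combination h.weak_eq lam hlam hc s - h.weak_eq lam hlam hc t
    rw [dist_eq_norm, hst, NNReal.dist_eq]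
    exact intervalIntegral.norm_integral_le_of_norm_le_const fun r _ => hle r
  refine continuous_of_uniform_approx_of_continuous fun u hu => ?_
  obtain ⟨ε, hε, hεu⟩ := Metric.mem_uniformity_dist.1 hu
  obtain ⟨φ', hφ', lam, hae, hc, hlam⟩ := Metric.dense_iff.1
    (Lp.dense_hasCompactSupport_contDiff (F := ℂ) (μ := (volume : Measure (Space d × Space d)))
      (p := 2) (by norm_num)) φ (ε / (C + 1)) (by positivity)
  have hmem : MemLp lam 2 volume := hlam.continuous.memLp_of_hasCompactSupport hc
  refine ⟨fun s => inner ℂ φ' (W s), ?_, fun s => hεu ?_⟩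
  · have heq : φ' = hmem.toLp lam := Lp.ext (hae.trans hmem.coeFn_toLp.symm)
    simp_rw [heq, ← pairing_eq_inner _ hmem]
    exact htest lam hlam hc
  · rw [dist_eq_norm, ← inner_sub_left]
    rw [mem_ball_iff_norm'] at hφ'
    calc _ ≤ ‖φ - φ'‖ * ‖W s‖ := norm_inner_le_norm _ _
      _ ≤ ‖φ - φ'‖ * (C + 1) := by gcongr; linarith [hC s]
      _ < ε / (C + 1) * (C + 1) := by gcongr
      _ = ε := by field_simp

lemma IsWeakSolution.continuous_pairing (hσ : IsJumpKernel σ) (h : IsWeakSolution σ W₀ W)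
    {φ : Space d × Space d → ℂ} (hφ : MemLp φ 2 volume) :
    Continuous fun s : ℝ => pairing (W s.toNNReal) φ := by
  simp_rw [pairing_eq_inner _ hφ]
  exact (h.continuous_inner hσ _).comp continuous_real_toNNReal

lemma IsWeakSolution.hasDerivAt_pairing (hσ : IsJumpKernel σ) (h : IsWeakSolution σ W₀ W)
    {lam : Space d × Space d → ℂ} (hlam : ContDiff ℝ ((⊤ : ℕ∞) : WithTop ℕ∞) lam)
    (hc : HasCompactSupport lam) {s : ℝ} (hs : 0 < s) :
    HasDerivAt (fun r : ℝ => pairing (W r.toNNReal) lam)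
      (pairing (W s.toNNReal) (dualGenerator σ lam)) s := by
  have hcont := h.continuous_pairing hσ
    (hσ.memLp_dualGenerator (hlam.of_le (by exact_mod_cast le_top)) hc)
  have hd := (intervalIntegral.integral_hasDerivAt_right (hcont.intervalIntegrable 0 s)
    (hcont.stronglyMeasurableAtFilter _ _) hcont.continuousAt).const_add (pairing W₀ lam)
  refine hd.congr_of_eventuallyEq ?_
  filter_upwards [Ioi_mem_nhds hs] with r hr
  have := h.weak_eq lam hlam hc r.toNNReal
  rw [Real.coe_toNNReal _ (le_of_lt hr)] at this
  linear_combination this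

/-- The regularization of `f` by the kernel `κ`. -/
def mollify (f κ : Space d × Space d → ℂ) : Space d × Space d → ℂ :=
  f ⋆[ContinuousLinearMap.mul ℝ ℂ, volume] κ

lemma mollify_apply (f κ : Space d × Space d → ℂ) (z : Space d × Space d) :
    mollify f κ z = ∫ w, f w * κ (z - w) := by
  simp [mollify, convolution_def]

lemma mollify_eq_pairing (f κ : Space d × Space d → ℂ) (z : Space d × Space d) :
    mollify f κ z = pairing f (fun w => conj (κ (z - w))) := by
  simp [mollify_apply, pairing]

lemma locallyIntegrable_phaseL2 (f : PhaseL2 d) : LocallyIntegrable f volume :=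
  (Lp.memLp f).locallyIntegrable (by norm_num)

section

variable {E : Type*} [NormedAddCommGroup E]

lemma HasCompactSupport.sub_left {κ : Space d × Space d → E} (hc : HasCompactSupport κ)
    (z : Space d × Space d) : HasCompactSupport fun w => κ (z - w) :=
  hc.comp_homeomorph (Homeomorph.subLeft z)

lemma integral_mul_norm_le (f : PhaseL2 d) {ψ : Space d × Space d → E} (hψ : Continuous ψ)
    (hc : HasCompactSupport ψ) (z : Space d × Space d) :
    Integrable (fun w => ‖f w‖ * ‖ψ (z - w)‖) ∧
    ∫ w, ‖f w‖ * ‖ψ (z - w)‖ ≤ (‖f‖ ^ 2 + ∫ w, ‖ψ w‖ ^ 2) / 2 := by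
  have hf2 : Integrable fun w => ‖f w‖ ^ 2 := (Lp.memLp f).integrable_norm_pow (by norm_num)
  have hcz := HasCompactSupport.sub_left hc z
  have hψz : Continuous fun w => ψ (z - w) := by fun_prop
  have hψ2 : Integrable fun w => ‖ψ (z - w)‖ ^ 2 :=
    (hψz.memLp_of_hasCompactSupport (p := 2) hcz).integrable_norm_pow (by norm_num)
  have hint : Integrable fun w => ‖f w‖ * ‖ψ (z - w)‖ :=
    (Lp.memLp f).norm.integrable_mul (hψz.memLp_of_hasCompactSupport (p := 2) hcz).norm
  refine ⟨hint, ?_⟩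
  have hnorm : ‖f‖ ^ 2 = ∫ w, ‖f w‖ ^ 2 := by
    rw [← inner_self_eq_norm_sq (𝕜 := ℂ), L2.inner_def, ← integral_re (L2.integrable_inner f f)]
    exact integral_congr_ae (.of_forall fun w => inner_self_eq_norm_sq _)
  have hshift : ∫ w, ‖ψ w‖ ^ 2 = ∫ w, ‖ψ (z - w)‖ ^ 2 :=
    (integral_sub_left_eq_self (fun w => ‖ψ w‖ ^ 2) volume z).symm
  rw [hnorm, hshift, ← integral_add hf2 hψ2, ← integral_div]
  refine integral_mono hint ((hf2.add hψ2).div_const 2) fun w => ?_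
  nlinarith [sq_nonneg (‖f w‖ - ‖ψ (z - w)‖)]

end

section

variable {κ ρ : Space d × Space d → ℂ} (f : PhaseL2 d)

lemma continuous_mollify (hκ : Continuous κ) (hc : HasCompactSupport κ) :
    Continuous (mollify f κ) :=
  hc.continuous_convolution_right _ (locallyIntegrable_phaseL2 f) hκ

lemma integrable_mollify_integrand (hκ : Continuous κ) (hc : HasCompactSupport κ)
    (z : Space d × Space d) : Integrable fun w => f w * κ (z - w) := by
  refine (integral_mul_norm_le f hκ hc z).1.mono'
    ((Lp.aestronglyMeasurable f).mul (Continuous.aestronglyMeasurable (by fun_prop)))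
    (.of_forall fun w => (norm_mul _ _).le)

lemma norm_mollify_le (hκ : Continuous κ) (hc : HasCompactSupport κ) (z : Space d × Space d) :
    ‖mollify f κ z‖ ≤ (‖f‖ ^ 2 + ∫ w, ‖κ w‖ ^ 2) / 2 := by
  rw [mollify_apply]
  refine le_trans (norm_integral_le_of_norm_le (integral_mul_norm_le f hκ hc z).1
    (.of_forall fun w => (norm_mul _ _).le)) (integral_mul_norm_le f hκ hc z).2

lemma contDiff_mollify (hρ : ContDiff ℝ 1 ρ) (hc : HasCompactSupport ρ) :
    ContDiff ℝ 1 (mollify f ρ) :=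
  hc.contDiff_convolution_right (n := 1) _ (locallyIntegrable_phaseL2 f) hρ

lemma fderiv_mollify_apply (hρ : ContDiff ℝ 1 ρ) (hc : HasCompactSupport ρ)
    (z v : Space d × Space d) :
    fderiv ℝ (mollify f ρ) z v = mollify f (fun y => fderiv ℝ ρ y v) z := by
  rw [mollify, (hc.hasFDerivAt_convolution_right _ (locallyIntegrable_phaseL2 f) hρ z).fderiv,
    convolution_precompR_apply _ (locallyIntegrable_phaseL2 f) (hc.fderiv ℝ)
      (hρ.continuous_fderiv one_ne_zero)]
  rfl

lemma norm_fderiv_mollify_le (hρ : ContDiff ℝ 1 ρ) (hc : HasCompactSupport ρ)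
    (z v : Space d × Space d) :
    ‖fderiv ℝ (mollify f ρ) z v‖ ≤ (‖f‖ ^ 2 + ∫ w, ‖fderiv ℝ ρ w‖ ^ 2) / 2 * ‖v‖ := by
  have hb := integral_mul_norm_le f (hρ.continuous_fderiv one_ne_zero) (hc.fderiv ℝ) z
  rw [fderiv_mollify_apply f hρ hc, mollify_apply]
  refine le_trans (norm_integral_le_of_norm_le (hb.1.mul_const ‖v‖) (.of_forall fun w => ?_)) ?_
  · rw [norm_mul, mul_assoc]
    gcongr
    exact ContinuousLinearMap.le_opNorm _ _
  · rw [integral_mul_const]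
    gcongr
    exact hb.2

lemma IsJumpKernel.collision_mollify (hσ : IsJumpKernel σ) (hρ : ContDiff ℝ 1 ρ)
    (hc : HasCompactSupport ρ) (z : Space d × Space d) :
    collision σ (mollify f ρ) z = mollify f (collision σ ρ) z := by
  obtain ⟨R, hR, hsupp⟩ := hσ.supp
  obtain ⟨r, hr, hr0⟩ := HasCompactSupport.exists_radius hc
  obtain ⟨K, hK, hb⟩ := hσ.exists_jump_bound hρ (r + R)
  have hρc := hρ.continuous
  have hint : Integrable (Function.uncurry fun (y : Space d) (w : Space d × Space d) =>
      σ y • (f w * (ρ (z - w + (0, y)) - ρ (z - w)))) (volume.prod volume) := by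
    have hloc : Integrable ((Metric.closedBall z (r + R)).indicator fun w => K * ‖f w‖) := by
      refine IntegrableOn.integrable_indicator ?_ Metric.isClosed_closedBall.measurableSet
      exact ((locallyIntegrable_phaseL2 f).integrableOn_isCompact
        (isCompact_closedBall z (r + R))).norm.const_mul K
    refine (hσ.int.mul_prod hloc).mono' ?_ (.of_forall fun p => ?_)
    · exact (AEStronglyMeasurable.comp_fst hσ.aesm).smul
        ((AEStronglyMeasurable.comp_snd (Lp.aestronglyMeasurable f)).mul
          (Continuous.aestronglyMeasurable (by fun_prop)))
    · simp only [Function.uncurry]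
      rw [← mul_smul_comm, norm_mul]
      rcases lt_or_ge (r + R) ‖z - p.2‖ with hz | hz
      · have h0 : σ p.1 • (ρ (z - p.2 + (0, p.1)) - ρ (z - p.2)) = 0 := by
          rcases lt_or_ge R ‖p.1‖ with hy | hy
          · simp [hsupp _ hy]
          · simp [hr0 (z - p.2) (by linarith), hr0 _ (le_norm_add_snd hz hy)]
        rw [h0, norm_zero, mul_zero]
        exact mul_nonneg (mul_nonneg (hσ.nonneg _) (norm_nonneg _))
          (indicator_nonneg (fun _ _ => by positivity) _)
      · rw [indicator_of_mem (by rwa [mem_closedBall_iff_norm'])]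
        calc _ ≤ ‖f p.2‖ * (K * (σ p.1 * ‖p.1‖)) := by gcongr; exact hb _ hz _
          _ = _ := by ring
  have h1 : ∀ y : Space d, σ y • (mollify f ρ (z + (0, y)) - mollify f ρ z)
      = ∫ w, σ y • (f w * (ρ (z - w + (0, y)) - ρ (z - w))) := fun y => by
    rw [integral_smul, mollify_apply, mollify_apply, ← integral_sub
      (integrable_mollify_integrand f hρc hc _) (integrable_mollify_integrand f hρc hc _)]
    congr 1
    refine integral_congr_ae (.of_forall fun w => ?_)
    simp only
    rw [mul_sub, add_sub_right_comm]
  rw [collision, mollify_apply f (collision σ ρ)]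
  simp_rw [h1]
  rw [integral_integral_swap hint]
  refine integral_congr_ae (.of_forall fun w => ?_)
  simp only [collision]
  rw [← integral_const_mul]
  exact integral_congr_ae (.of_forall fun y => (mul_smul_comm _ _ _).symm)

/-- Testing with a reflected kernel gives the generator applied to the regularization, up to the
commutator `f ⋆ (y₂ · ∇ₓρ)`: transport acts with the velocity `w₂` and not `z₂`. -/
lemma IsJumpKernel.pairing_dualGenerator_reflect (hσ : IsJumpKernel σ)
    (hρ : ContDiff ℝ 1 ρ) (hc : HasCompactSupport ρ) (z : Space d × Space d) :
    pairing f (dualGenerator σ fun w => conj (ρ (z - w)))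
      = collision σ (mollify f ρ) z - transport (mollify f ρ) z + mollify f (transport ρ) z := by
  have hd := hρ.differentiable one_ne_zero
  have hlam : Differentiable ℝ fun w => conj (ρ (z - w)) :=
    Complex.conjCLE.differentiable.comp (hd.comp (by fun_prop))
  have htr : ∀ w, transport (fun w => ρ (z - w)) w
      = transport ρ (z - w) - fderiv ℝ ρ (z - w) (z.2, 0) := fun w => by
    have h1 : HasFDerivAt (fun w : Space d × Space d => z - w)
        (-ContinuousLinearMap.id ℝ (Space d × Space d)) w := (hasFDerivAt_id w).const_sub z
    have h2 := (HasFDerivAt.comp (g := ρ) w hd.differentiableAt.hasFDerivAt h1).fderiv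
    simp only [Function.comp_def] at h2
    rw [transport, h2, transport, ← map_sub]
    change fderiv ℝ ρ (z - w) (-(w.2, 0)) = _
    congr 1
    simp
  have hco : ∀ w, collision σ (fun w => ρ (z - w)) w = collision σ ρ (z - w) := fun w => by
    rw [collision, collision, ← integral_neg_eq_self
      (fun y => σ y • (ρ (z - (w + (0, y))) - ρ (z - w)))]
    refine integral_congr_ae (.of_forall fun y => ?_)
    simp only [hσ.even]
    congr 3
    ext <;> simp [sub_add_eq_sub_sub]
  have hgen : ∀ w, conj (dualGenerator σ (fun w => conj (ρ (z - w))) w)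
      = collision σ ρ (z - w) - fderiv ℝ ρ (z - w) (z.2, 0) + transport ρ (z - w) := fun w => by
    rw [dualGenerator_eq σ hlam, transport_conj, collision_conj, map_add, Complex.conj_conj,
      Complex.conj_conj, htr, hco]
    ring
  have i1 := integrable_mollify_integrand f (hσ.continuous_collision hρ)
    (hσ.hasCompactSupport_collision hc) z
  have i2 := integrable_mollify_integrand f (κ := fun y => fderiv ℝ ρ y (z.2, 0))
    ((hρ.continuous_fderiv one_ne_zero).clm_apply continuous_const)
    ((hc.fderiv ℝ).comp_left (g := fun T : Space d × Space d →L[ℝ] ℂ => T (z.2, 0)) rfl) z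
  have i3 := integrable_mollify_integrand f (continuous_transport hρ)
    (hasCompactSupport_transport hc) z
  have i12 : Integrable fun w => f w * collision σ ρ (z - w)
      - f w * fderiv ℝ ρ (z - w) (z.2, 0) := i1.sub i2
  rw [hσ.collision_mollify f hρ hc, transport, fderiv_mollify_apply f hρ hc, mollify_apply,
    mollify_apply, mollify_apply, ← integral_sub i1 i2, ← integral_add i12 i3, pairing]
  refine integral_congr_ae (.of_forall fun w => ?_)
  simp only
  rw [hgen]
  ring

/-- Young's inequality for regularizations. -/
lemma integral_sq_mollify_le (hκ : Continuous κ) (hc : HasCompactSupport κ) :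
    Integrable (fun z => ‖mollify f κ z‖ ^ 2) ∧
    ∫ z, ‖mollify f κ z‖ ^ 2 ≤ ((∫ y, ‖κ y‖) * ‖f‖) ^ 2 := by
  have hκi : Integrable κ := hκ.integrable_of_hasCompactSupport hc
  set μ : Measure (Space d × Space d) := volume.withDensity fun y => ‖κ (-y)‖ₑ with hμ
  have hmeas : Measurable fun y => ‖κ (-y)‖ₑ :=
    (hκ.comp continuous_neg).measurable.enorm
  have hμuniv : μ univ = ENNReal.ofReal (∫ y, ‖κ y‖) := by
    rw [hμ, withDensity_apply _ MeasurableSet.univ, Measure.restrict_univ,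
      lintegral_neg_eq_self fun y => ‖κ y‖ₑ]
    exact (ofReal_integral_norm_eq_lintegral_enorm hκi).symm
  have : IsFiniteMeasure μ := ⟨by rw [hμuniv]; exact ENNReal.ofReal_lt_top⟩
  have hb : ∀ z, ‖mollify f κ z‖ₑ ≤ ∫⁻ η, ‖f (z + η)‖ₑ ∂μ := fun z => by
    rw [hμ, lintegral_withDensity_eq_lintegral_mul₀' hmeas.aemeasurable, mollify_apply]
    · refine (enorm_integral_le_lintegral_enorm _).trans (le_of_eq ?_)
      rw [← lintegral_add_left_eq_self (fun w => ‖f w * κ (z - w)‖ₑ) z]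
      refine lintegral_congr fun η => ?_
      simp [enorm_mul, mul_comm]
    · refine AEMeasurable.mono_ac ?_ (withDensity_absolutelyContinuous _ _)
      exact ((Lp.aestronglyMeasurable f).comp_quasiMeasurePreserving
        (measurePreserving_add_left volume z).quasiMeasurePreserving).enorm
  have hl : ∫⁻ z, ‖mollify f κ z‖ₑ ^ 2 ≤ ENNReal.ofReal (((∫ y, ‖κ y‖) * ‖f‖) ^ 2) := by
    calc _ ≤ ∫⁻ z, (∫⁻ η, ‖f (z + η)‖ₑ ∂μ) ^ 2 := lintegral_mono fun z => by gcongr; exact hb z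
      _ ≤ μ univ ^ 2 * ∫⁻ z, ‖f z‖ₑ ^ 2 :=
        lintegral_sq_lintegral_add_le μ (Lp.aestronglyMeasurable f)
      _ = _ := by
        rw [← sq_eLpNorm_two, hμuniv, ← mul_pow, ← ENNReal.ofReal_toReal (Lp.eLpNorm_ne_top f),
          ← Lp.norm_def, ← ENNReal.ofReal_mul (by positivity), ← ENNReal.ofReal_pow (by positivity)]
  have hcont := continuous_mollify f hκ hc
  have hsq : ∀ z, ENNReal.ofReal (‖mollify f κ z‖ ^ 2) = ‖mollify f κ z‖ₑ ^ 2 := fun z => by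
    rw [ENNReal.ofReal_pow (norm_nonneg _), ofReal_norm]
  have hsm : AEStronglyMeasurable (fun z => ‖mollify f κ z‖ ^ 2) volume :=
    Continuous.aestronglyMeasurable (by fun_prop)
  constructor
  · refine ⟨hsm, ?_⟩
    rw [hasFiniteIntegral_iff_ofReal (.of_forall fun z => by positivity)]
    simp_rw [hsq]
    exact hl.trans_lt ENNReal.ofReal_lt_top
  · rw [integral_eq_lintegral_of_nonneg_ae (.of_forall fun z => by positivity) hsm]
    simp_rw [hsq]
    exact ENNReal.toReal_le_of_le_ofReal (by positivity) hl

end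

end Regularization

/-! ### The energy estimate for regularized solutions -/

section Energy

variable {σ : Space d → ℝ} {W₀ : PhaseL2 d} {V : ℝ≥0 → PhaseL2 d} {ρ : Space d × Space d → ℂ}
  {C : ℝ}

lemma HasCompactSupport.conj_sub_left (hc : HasCompactSupport ρ) (z : Space d × Space d) :
    HasCompactSupport fun w => conj (ρ (z - w)) :=
  (HasCompactSupport.sub_left hc z).comp_left (map_zero _)

lemma IsWeakSolution.continuous_mollify (hσ : IsJumpKernel σ) (h : IsWeakSolution σ W₀ V)
    (hρ : Continuous ρ) (hc : HasCompactSupport ρ) (z : Space d × Space d) :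
    Continuous fun r : ℝ => mollify (V r.toNNReal) ρ z := by
  simp_rw [mollify_eq_pairing]
  have hcont : Continuous fun w => conj (ρ (z - w)) :=
    Complex.continuous_conj.comp (by fun_prop)
  exact h.continuous_pairing hσ
    (hcont.memLp_of_hasCompactSupport (HasCompactSupport.conj_sub_left hc z))

/-- A regularized weak solution solves the equation up to a commutator. -/
lemma IsWeakSolution.hasDerivAt_mollify (hσ : IsJumpKernel σ) (h : IsWeakSolution σ W₀ V)
    (hρ : ContDiff ℝ ((⊤ : ℕ∞) : WithTop ℕ∞) ρ) (hc : HasCompactSupport ρ)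
    (z : Space d × Space d) {s : ℝ} (hs : 0 < s) :
    HasDerivAt (fun r : ℝ => mollify (V r.toNNReal) ρ z)
      (collision σ (mollify (V s.toNNReal) ρ) z - transport (mollify (V s.toNNReal) ρ) z
        + mollify (V s.toNNReal) (transport ρ) z) s := by
  rw [← hσ.pairing_dualGenerator_reflect _ (hρ.of_le (by exact_mod_cast le_top)) hc]
  simp_rw [mollify_eq_pairing]
  exact h.hasDerivAt_pairing hσ (Complex.conjCLE.contDiff.comp (hρ.comp (by fun_prop)))
    (HasCompactSupport.conj_sub_left hc z) hs

lemma transport_norm_sq {f : Space d × Space d → ℂ} (hf : ContDiff ℝ 1 f)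
    (z : Space d × Space d) :
    transport (fun w => ‖f w‖ ^ 2) z = 2 * ⟪f z, transport f z⟫ := by
  have := (hf.differentiable one_ne_zero z).hasFDerivAt.norm_sq.fderiv
  rw [transport, this]
  change (2 • (innerSL ℝ (f z)).comp (fderiv ℝ f z)) (z.2, 0) = 2 * ⟪f z, fderiv ℝ f z (z.2, 0)⟫
  rw [smul_apply, nsmul_eq_mul]
  rfl

/-- The convexity inequality `2 Re (f̄ ℒf) ≤ ℒ|f|²`. -/
lemma IsJumpKernel.two_mul_inner_collision_le (hσ : IsJumpKernel σ) {f : Space d × Space d → ℂ}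
    (hf : ContDiff ℝ 1 f) (z : Space d × Space d) :
    2 * ⟪f z, collision σ f z⟫ ≤ collision σ (fun w => ‖f w‖ ^ 2) z := by
  have hint := hσ.integrable_jump hf z
  have h1 : 2 * ⟪f z, collision σ f z⟫
      = ∫ y, 2 * ⟪f z, σ y • (f (z + (0, y)) - f z)⟫ := by
    rw [integral_const_mul]
    congr 1
    exact ((innerSL ℝ (f z)).integral_comp_comm hint).symm
  rw [h1]
  refine integral_mono (((innerSL ℝ (f z)).integrable_comp hint).const_mul 2)
    (hσ.integrable_jump (hf.norm_sq ℝ) z) fun y => ?_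
  simp only [real_inner_smul_right, inner_sub_right, real_inner_self_eq_norm_sq, smul_eq_mul]
  have h2 := norm_sub_sq_real (f z) (f (z + (0, y)))
  have h3 : 0 ≤ ‖f z - f (z + (0, y))‖ ^ 2 := by positivity
  nlinarith [mul_le_mul_of_nonneg_left (by linarith :
    2 * (⟪f z, f (z + (0, y))⟫ - ‖f z‖ ^ 2) ≤ ‖f (z + (0, y))‖ ^ 2 - ‖f z‖ ^ 2) (hσ.nonneg y)]

lemma hasDerivAt_energy (hσ : IsJumpKernel σ) (h : IsWeakSolution σ W₀ V)
    (hC : ∀ t, ‖V t‖ ≤ C) (hρ : ContDiff ℝ ((⊤ : ℕ∞) : WithTop ℕ∞) ρ) (hc : HasCompactSupport ρ)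
    {χ : Space d × Space d → ℝ} (hχ : Continuous χ) (hχc : HasCompactSupport χ) {s : ℝ}
    (hs : 0 < s) :
    HasDerivAt (fun r : ℝ => ∫ z, χ z * ‖mollify (V r.toNNReal) ρ z‖ ^ 2)
      (∫ z, χ z * (2 * ⟪mollify (V s.toNNReal) ρ z,
        collision σ (mollify (V s.toNNReal) ρ) z - transport (mollify (V s.toNNReal) ρ) z
          + mollify (V s.toNNReal) (transport ρ) z⟫)) s := by
  have hρ1 : ContDiff ℝ 1 ρ := hρ.of_le (by exact_mod_cast le_top)
  have hf : ∀ r : ℝ, ContDiff ℝ 1 (mollify (V r.toNNReal) ρ) := fun r => contDiff_mollify _ hρ1 hc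
  have hr : ∀ r : ℝ, Continuous (mollify (V r.toNNReal) (transport ρ)) := fun r =>
    continuous_mollify _ (continuous_transport hρ1) (hasCompactSupport_transport hc)
  set B₁ := (C ^ 2 + ∫ w, ‖ρ w‖ ^ 2) / 2
  set B₂ := (C ^ 2 + ∫ w, ‖collision σ ρ w‖ ^ 2) / 2
  set B₃ := (C ^ 2 + ∫ w, ‖fderiv ℝ ρ w‖ ^ 2) / 2
  set B₄ := (C ^ 2 + ∫ w, ‖transport ρ w‖ ^ 2) / 2
  have hb₁ : ∀ t z, ‖mollify (V t) ρ z‖ ≤ B₁ := fun t z =>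
    (norm_mollify_le _ hρ.continuous hc z).trans (by simp only [B₁]; gcongr; exact hC t)
  have hb₂ : ∀ t z, ‖collision σ (mollify (V t) ρ) z‖ ≤ B₂ := fun t z => by
    rw [hσ.collision_mollify _ hρ1 hc]
    exact (norm_mollify_le _ (hσ.continuous_collision hρ1) (hσ.hasCompactSupport_collision hc) z).trans
      (by simp only [B₂]; gcongr; exact hC t)
  have hb₃ : ∀ t z, ‖transport (mollify (V t) ρ) z‖ ≤ B₃ * ‖(z.2, (0 : Space d))‖ := fun t z =>
    (norm_fderiv_mollify_le _ hρ1 hc z _).trans (by simp only [B₃]; gcongr; exact hC t)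
  have hb₄ : ∀ t z, ‖mollify (V t) (transport ρ) z‖ ≤ B₄ := fun t z =>
    (norm_mollify_le _ (continuous_transport hρ1) (hasCompactSupport_transport hc) z).trans
      (by simp only [B₄]; gcongr; exact hC t)
  have hB₁ : 0 ≤ B₁ := (norm_nonneg _).trans (hb₁ 0 0)
  refine (hasDerivAt_integral_of_dominated_loc_of_deriv_le
    (F := fun (r : ℝ) z => χ z * ‖mollify (V r.toNNReal) ρ z‖ ^ 2)
    (F' := fun r z => χ z * (2 * ⟪mollify (V r.toNNReal) ρ z,
        collision σ (mollify (V r.toNNReal) ρ) z - transport (mollify (V r.toNNReal) ρ) z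
          + mollify (V r.toNNReal) (transport ρ) z⟫))
    (bound := fun z => ‖χ z‖ * (2 * (B₁ * (B₂ + B₃ * ‖(z.2, (0 : Space d))‖ + B₄))))
    (Ioi_mem_nhds hs) ?_ ?_ ?_ ?_ ?_ ?_).2
  · refine .of_forall fun r => ?_
    have := (hf r).continuous
    exact Continuous.aestronglyMeasurable (by fun_prop)
  · have := (hf s).continuous
    exact Continuous.integrable_of_hasCompactSupport (by fun_prop) hχc.mul_right
  · have h1 := (hf s).continuous
    have h2 := hσ.continuous_collision (hf s)
    have h3 := continuous_transport (hf s)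
    have h4 := hr s
    exact Continuous.aestronglyMeasurable (by fun_prop)
  · refine .of_forall fun z r _ => ?_
    rw [norm_mul, norm_mul, Real.norm_ofNat]
    gcongr
    refine (norm_inner_le_norm _ _).trans ?_
    gcongr
    · exact hb₁ _ z
    · refine (norm_add_le _ _).trans (add_le_add ((norm_sub_le _ _).trans
        (add_le_add (hb₂ _ z) (hb₃ _ z))) (hb₄ _ z))
  · exact Continuous.integrable_of_hasCompactSupport (by fun_prop) hχc.norm.mul_right
  · refine .of_forall fun z r hr => ?_
    exact (h.hasDerivAt_mollify hσ hρ hc z hr).norm_sq.const_mul (χ z)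

lemma continuous_energy (hσ : IsJumpKernel σ) (h : IsWeakSolution σ W₀ V)
    (hC : ∀ t, ‖V t‖ ≤ C) (hρ : Continuous ρ) (hc : HasCompactSupport ρ)
    {χ : Space d × Space d → ℝ} (hχ : Continuous χ) (hχc : HasCompactSupport χ) :
    Continuous fun r : ℝ => ∫ z, χ z * ‖mollify (V r.toNNReal) ρ z‖ ^ 2 := by
  refine continuous_of_dominated
    (bound := fun z => ‖χ z‖ * ((C ^ 2 + ∫ w, ‖ρ w‖ ^ 2) / 2) ^ 2) (fun r => ?_)
    (fun r => .of_forall fun z => ?_) ((hχ.integrable_of_hasCompactSupport hχc).norm.mul_const _)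
    (.of_forall fun z => ?_)
  · have := RadiativeTransfer.continuous_mollify (V r.toNNReal) hρ hc
    exact Continuous.aestronglyMeasurable (by fun_prop)
  · rw [norm_mul, norm_pow, norm_norm]
    gcongr
    refine (norm_mollify_le _ hρ hc z).trans ?_
    gcongr
    exact hC _
  · have := h.continuous_mollify hσ hρ hc z
    fun_prop

/-- Dissipation of the localized energy. The commutator `r` enters through
`2 Re (f̄ r) ≤ δ |f|² + δ⁻¹ |r|²`. -/
lemma energy_deriv_le (hσ : IsJumpKernel σ) (f : PhaseL2 d) (hC : ‖f‖ ≤ C)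
    (hρ : ContDiff ℝ 1 ρ) (hc : HasCompactSupport ρ) (hρ1 : ∫ y, ‖ρ y‖ ≤ 1)
    {δ : ℝ} (hδ : 0 < δ) (hρδ : ∫ y, ‖transport ρ y‖ ≤ δ)
    {χ : Space d × Space d → ℝ} (hχ : ContDiff ℝ 1 χ) (hχc : HasCompactSupport χ)
    (hχ0 : ∀ z, 0 ≤ χ z) (hχ1 : ∀ z, χ z ≤ 1) {ε : ℝ} (hε1 : 0 ≤ ε)
    (hε : ∀ z, transport χ z + collision σ χ z ≤ ε) :
    ∫ z, χ z * (2 * ⟪mollify f ρ z, collision σ (mollify f ρ) z - transport (mollify f ρ) z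
      + mollify f (transport ρ) z⟫) ≤ (ε + 2 * δ) * C ^ 2 := by
  set u := mollify f ρ with hu_def
  set r := mollify f (transport ρ) with hr_def
  have hu : ContDiff ℝ 1 u := contDiff_mollify _ hρ hc
  have huc := hu.continuous
  have hr : Continuous r :=
    continuous_mollify _ (continuous_transport hρ) (hasCompactSupport_transport hc)
  obtain ⟨hui, hule⟩ := integral_sq_mollify_le f hρ.continuous hc
  obtain ⟨hri, hrle⟩ := integral_sq_mollify_le f (continuous_transport hρ)
    (hasCompactSupport_transport hc)
  have hC0 : 0 ≤ C := (norm_nonneg f).trans hC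
  have hule' : ∫ z, ‖u z‖ ^ 2 ≤ C ^ 2 := hule.trans (by
    have : (∫ y, ‖ρ y‖) * ‖f‖ ≤ 1 * C := by gcongr
    rw [one_mul] at this
    gcongr)
  have hrle' : ∫ z, ‖r z‖ ^ 2 ≤ (δ * C) ^ 2 := hrle.trans (by gcongr)
  have hG : ContDiff ℝ 1 fun w => ‖u w‖ ^ 2 := hu.norm_sq ℝ
  have hcoll := hσ.continuous_collision hu
  have htr := continuous_transport hu
  have hcollG := hσ.continuous_collision hG
  have htrG := continuous_transport hG
  have hχcont := hχ.continuous
  have i1 : Integrable fun z => χ z * (collision σ (fun w => ‖u w‖ ^ 2) z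
      - transport (fun w => ‖u w‖ ^ 2) z) :=
    Continuous.integrable_of_hasCompactSupport (by fun_prop) hχc.mul_right
  have i2 : Integrable fun z => δ * ‖u z‖ ^ 2 + δ⁻¹ * ‖r z‖ ^ 2 :=
    (hui.const_mul δ).add (hri.const_mul δ⁻¹)
  have hε0 : ∀ z, ‖u z‖ ^ 2 * (transport χ z + collision σ χ z) ≤ ε * ‖u z‖ ^ 2 := fun z => by
    rw [mul_comm]
    exact mul_le_mul_of_nonneg_right (hε z) (by positivity)
  have hχtr := continuous_transport hχ
  have hχco := hσ.continuous_collision hχ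
  calc ∫ z, χ z * (2 * ⟪u z, collision σ u z - transport u z + r z⟫)
      ≤ ∫ z, (χ z * (collision σ (fun w => ‖u w‖ ^ 2) z - transport (fun w => ‖u w‖ ^ 2) z)
          + (δ * ‖u z‖ ^ 2 + δ⁻¹ * ‖r z‖ ^ 2)) := by
        refine integral_mono
          (Continuous.integrable_of_hasCompactSupport (by fun_prop) hχc.mul_right) (i1.add i2)
          fun z => ?_
        have h1 := hσ.two_mul_inner_collision_le hu z
        have h2 := transport_norm_sq hu z
        have h3 : 2 * ⟪u z, r z⟫ ≤ δ * ‖u z‖ ^ 2 + δ⁻¹ * ‖r z‖ ^ 2 := by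
          have h4 := real_inner_le_norm (u z) (r z)
          have h5 : 0 ≤ δ⁻¹ * (δ * ‖u z‖ - ‖r z‖) ^ 2 := by positivity
          have h6 : δ⁻¹ * (δ * ‖u z‖ - ‖r z‖) ^ 2
              = δ * ‖u z‖ ^ 2 + δ⁻¹ * ‖r z‖ ^ 2 - 2 * (‖u z‖ * ‖r z‖) := by
            field_simp
            ring
          linarith
        have h7 : 0 ≤ δ * ‖u z‖ ^ 2 + δ⁻¹ * ‖r z‖ ^ 2 := by positivity
        simp only [inner_add_right, inner_sub_right]
        have h8 := mul_le_mul_of_nonneg_left (by linarith :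
          2 * (⟪u z, collision σ u z⟫ - ⟪u z, transport u z⟫ + ⟪u z, r z⟫)
            ≤ (collision σ (fun w => ‖u w‖ ^ 2) z - transport (fun w => ‖u w‖ ^ 2) z)
              + (δ * ‖u z‖ ^ 2 + δ⁻¹ * ‖r z‖ ^ 2)) (hχ0 z)
        nlinarith [mul_le_mul_of_nonneg_right (hχ1 z) h7]
    _ = (∫ z, ‖u z‖ ^ 2 * (transport χ z + collision σ χ z))
          + (δ * ∫ z, ‖u z‖ ^ 2) + δ⁻¹ * ∫ z, ‖r z‖ ^ 2 := by
        rw [integral_add i1 i2, hσ.green_identity hG hχ hχc,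
          integral_add (hui.const_mul δ) (hri.const_mul δ⁻¹), integral_const_mul,
          integral_const_mul, add_assoc]
    _ ≤ ε * (∫ z, ‖u z‖ ^ 2) + (δ * ∫ z, ‖u z‖ ^ 2) + δ⁻¹ * ∫ z, ‖r z‖ ^ 2 := by
        gcongr
        rw [← integral_const_mul]
        refine integral_mono ?_ (hui.const_mul ε) hε0
        exact Continuous.integrable_of_hasCompactSupport (by fun_prop)
          (((hasCompactSupport_transport hχc).add
            (hσ.hasCompactSupport_collision hχc)).mul_left)
    _ ≤ ε * C ^ 2 + δ * C ^ 2 + δ⁻¹ * (δ * C) ^ 2 := by gcongr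
    _ = (ε + 2 * δ) * C ^ 2 := by field_simp; ring

lemma energy_le (hσ : IsJumpKernel σ) (h : IsWeakSolution σ 0 V)
    (hC : ∀ t, ‖V t‖ ≤ C) (hρ : ContDiff ℝ ((⊤ : ℕ∞) : WithTop ℕ∞) ρ) (hc : HasCompactSupport ρ)
    (hρ1 : ∫ y, ‖ρ y‖ ≤ 1) {δ : ℝ} (hδ : 0 < δ) (hρδ : ∫ y, ‖transport ρ y‖ ≤ δ)
    {χ : Space d × Space d → ℝ} (hχ : ContDiff ℝ 1 χ) (hχc : HasCompactSupport χ)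
    (hχ0 : ∀ z, 0 ≤ χ z) (hχ1 : ∀ z, χ z ≤ 1) {ε : ℝ} (hε1 : 0 ≤ ε)
    (hε : ∀ z, transport χ z + collision σ χ z ≤ ε) (t : ℝ≥0) :
    ∫ z, χ z * ‖mollify (V t) ρ z‖ ^ 2 ≤ (ε + 2 * δ) * C ^ 2 * t := by
  have hd := fun {s : ℝ} (hs : 0 < s) => hasDerivAt_energy hσ h hC hρ hc hχ.continuous hχc hs
  have hmv := (convex_Icc (0 : ℝ) t).image_sub_le_mul_sub_of_deriv_le
    (continuous_energy hσ h hC hρ.continuous hc hχ.continuous hχc).continuousOn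
    (fun s hs => (hd (s := s)
      (by rw [interior_Icc] at hs; exact hs.1)).differentiableAt.differentiableWithinAt)
    (C := (ε + 2 * δ) * C ^ 2)
    (fun s hs => by
      rw [(hd (s := s) (by rw [interior_Icc] at hs; exact hs.1)).deriv]
      exact energy_deriv_le hσ _ (hC _) (hρ.of_le (by exact_mod_cast le_top)) hc hρ1 hδ hρδ hχ hχc
        hχ0 hχ1 hε1 hε)
    0 (left_mem_Icc.2 t.coe_nonneg) t (right_mem_Icc.2 t.coe_nonneg) t.coe_nonneg
  have h0 : ∀ z, mollify (V 0) ρ z = 0 := fun z => by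
    have h1 : ContDiff ℝ ((⊤ : ℕ∞) : WithTop ℕ∞) fun w => conj (ρ (z - w)) :=
      Complex.conjCLE.contDiff.comp (hρ.comp (by fun_prop))
    have h2 := HasCompactSupport.conj_sub_left hc z
    have := h.weak_eq _ h1 h2 0
    rw [mollify_eq_pairing]
    have h3 : pairing (0 : PhaseL2 d) (fun w => conj (ρ (z - w))) = 0 := by
      rw [pairing_eq_inner _ (h1.continuous.memLp_of_hasCompactSupport h2), inner_zero_right]
    rw [h3, NNReal.coe_zero, intervalIntegral.integral_same] at this
    simpa using this
  simpa [h0] using hmv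

end Energy

/-! ### Anisotropic cutoffs and mollifiers, uniqueness of weak solutions -/

section Uniqueness

variable {σ : Space d → ℝ}

/-- The anisotropic dilation `(x, k) ↦ (a x, b k)`. -/
def dilate (a b : ℝ) (z : Space d × Space d) : Space d × Space d := (a • z.1, b • z.2)

lemma contDiff_dilate {n : WithTop ℕ∞} (a b : ℝ) : ContDiff ℝ n (dilate (d := d) a b) := by
  unfold dilate; fun_prop

lemma min_mul_norm_le_norm_dilate {a b : ℝ} (ha : 0 < a) (hb : 0 < b) (z : Space d × Space d) :
    min a b * ‖z‖ ≤ ‖dilate a b z‖ := by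
  have h1 : ‖dilate a b z‖ = max (a * ‖z.1‖) (b * ‖z.2‖) := by
    simp [dilate, Prod.norm_def, norm_smul, abs_of_pos ha, abs_of_pos hb]
  rw [h1, Prod.norm_def]
  rcases max_choice ‖z.1‖ ‖z.2‖ with h | h <;> rw [h]
  · exact le_max_of_le_left (mul_le_mul_of_nonneg_right (min_le_left _ _) (norm_nonneg _))
  · exact le_max_of_le_right (mul_le_mul_of_nonneg_right (min_le_right _ _) (norm_nonneg _))

lemma exists_integral_dilate {a b : ℝ} (ha : 0 < a) (hb : 0 < b) :
    ∃ J > 0, ∀ h : Space d × Space d → ℝ, ∫ z, h (dilate a b z) = J * ∫ z, h z := by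
  set e : (Space d × Space d) ≃ₗ[ℝ] (Space d × Space d) :=
    (LinearEquiv.smulOfNeZero ℝ (Space d) a ha.ne').prodCongr
      (LinearEquiv.smulOfNeZero ℝ (Space d) b hb.ne') with he
  have hdet : LinearMap.det (e : (Space d × Space d) →ₗ[ℝ] (Space d × Space d)) ≠ 0 :=
    e.isUnit_det'.ne_zero
  have hmap := Measure.map_linearMap_addHaar_eq_smul_addHaar
    (volume : Measure (Space d × Space d)) hdet
  refine ⟨|(LinearMap.det (e : (Space d × Space d) →ₗ[ℝ] (Space d × Space d)))⁻¹|,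
    abs_pos.2 (inv_ne_zero hdet), fun h => ?_⟩
  have hemb := e.toContinuousLinearEquiv.toHomeomorph.measurableEmbedding
  have h1 := hemb.integral_map (μ := volume) h
  have h2 : Measure.map e.toContinuousLinearEquiv.toHomeomorph volume
      = Measure.map (e : (Space d × Space d) →ₗ[ℝ] (Space d × Space d)) volume := rfl
  rw [h2, hmap, integral_smul_measure, ENNReal.toReal_ofReal (abs_nonneg _), smul_eq_mul] at h1
  exact h1.symm

/-- A smooth bump function, equal to `1` on the unit ball and supported in the ball of radius
`2`. -/
def phaseBump : ContDiffBump (0 : Space d × Space d) := ⟨1, 2, one_pos, one_lt_two⟩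

lemma exists_norm_fderiv_phaseBump_le :
    ∃ B ≥ 0, ∀ z, ‖fderiv ℝ (phaseBump (d := d)) z‖ ≤ B := by
  obtain ⟨B, hB⟩ := (phaseBump.hasCompactSupport.fderiv ℝ).exists_bound_of_continuous
    ((phaseBump (d := d)).contDiff (n := 1) |>.continuous_fderiv one_ne_zero)
  exact ⟨B, (norm_nonneg _).trans (hB 0), hB⟩

lemma hasCompactSupport_phaseBump_dilate {a b : ℝ} (ha : 0 < a) (hb : 0 < b) :
    HasCompactSupport fun z => phaseBump (d := d) (dilate a b z) := by
  have hm : 0 < min a b := lt_min ha hb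
  refine HasCompactSupport.intro (isCompact_closedBall 0 (2 / min a b)) fun z hz => ?_
  rw [mem_closedBall_zero_iff, not_le, div_lt_iff₀ hm] at hz
  refine phaseBump.zero_of_le_dist ?_
  rw [dist_zero_right]
  exact (hz.le.trans (by rw [mul_comm])).trans (min_mul_norm_le_norm_dilate ha hb z)

/-- On the support of the dilated bump the velocity is at most `2 / b`. -/
lemma norm_transport_phaseBump_dilate_le {a b : ℝ} (ha : 0 < a) (hb : 0 < b)
    (z : Space d × Space d) :
    ‖transport (fun z => phaseBump (d := d) (dilate a b z)) z‖
      ≤ 2 * a / b * ‖fderiv ℝ (phaseBump (d := d)) (dilate a b z)‖ := by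
  have hd : HasFDerivAt (dilate (d := d) a b)
      ((a • ContinuousLinearMap.fst ℝ (Space d) (Space d)).prod
        (b • ContinuousLinearMap.snd ℝ (Space d) (Space d))) z :=
    (hasFDerivAt_fst.const_smul a).prodMk (hasFDerivAt_snd.const_smul b)
  have hb1 : DifferentiableAt ℝ (phaseBump (d := d)) (dilate a b z) :=
    ((phaseBump (d := d)).contDiff (n := 1)).differentiable one_ne_zero _
  have h1 := (HasFDerivAt.comp (g := phaseBump (d := d)) z hb1.hasFDerivAt hd).fderiv
  simp only [Function.comp_def] at h1
  have h2 : transport (fun z => phaseBump (d := d) (dilate a b z)) z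
      = fderiv ℝ (phaseBump (d := d)) (dilate a b z) (a • z.2, 0) := by
    rw [transport, h1]
    simp
  rw [h2]
  by_cases hz : dilate a b z ∈ tsupport (phaseBump (d := d))
  · refine (ContinuousLinearMap.le_opNorm _ _).trans ?_
    rw [mul_comm]
    gcongr
    rw [phaseBump.tsupport_eq, mem_closedBall_zero_iff] at hz
    have h3 : ‖b • z.2‖ ≤ 2 := (norm_snd_le (dilate a b z)).trans hz
    rw [norm_smul, Real.norm_of_nonneg hb.le] at h3
    have h4 : ‖(a • z.2, (0 : Space d))‖ = a * ‖z.2‖ := by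
      rw [Prod.norm_def, norm_zero, max_eq_left (norm_nonneg _), norm_smul,
        Real.norm_of_nonneg ha.le]
    rw [h4, le_div_iff₀ hb]
    nlinarith
  · have h0 : fderiv ℝ (phaseBump (d := d)) (dilate a b z) = 0 := by
      by_contra hne
      exact hz (support_fderiv_subset ℝ hne)
    simp [h0]

/-- Cutoffs that are almost invariant under the generator: at scale `n` in velocity, the scale `n²`
in position compensates for the growth of the velocity. -/
lemma IsJumpKernel.exists_cutoff_bound (hσ : IsJumpKernel σ) : ∃ K ≥ 0, ∀ n : ℝ, 1 ≤ n → ∀ z,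
    transport (fun z => phaseBump (d := d) (dilate (n ^ 2)⁻¹ n⁻¹ z)) z
      + collision σ (fun z => phaseBump (d := d) (dilate (n ^ 2)⁻¹ n⁻¹ z)) z ≤ K / n := by
  obtain ⟨B, hB0, hB⟩ := exists_norm_fderiv_phaseBump_le (d := d)
  have hI : 0 ≤ ∫ y, σ y * ‖y‖ := integral_nonneg fun y => mul_nonneg (hσ.nonneg y) (norm_nonneg y)
  refine ⟨2 * B + B * ∫ y, σ y * ‖y‖, by positivity, fun n hn z => ?_⟩
  have hn0 : 0 < n := by linarith
  have h1 : transport (fun z => phaseBump (d := d) (dilate (n ^ 2)⁻¹ n⁻¹ z)) z ≤ 2 * B / n := by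
    refine (le_abs_self _).trans ((norm_transport_phaseBump_dilate_le (by positivity)
      (by positivity) z).trans ?_)
    calc _ ≤ 2 * (n ^ 2)⁻¹ / n⁻¹ * B := by gcongr; exact hB _
      _ = 2 * B / n := by field_simp
  have hlip : ∀ x w : Space d × Space d, ‖phaseBump (d := d) w - phaseBump x‖ ≤ B * ‖w - x‖ :=
    fun x w => Convex.norm_image_sub_le_of_norm_fderiv_le (𝕜 := ℝ) (f := ⇑(phaseBump (d := d)))
      (s := univ) (C := B)
      (fun x _ => ((phaseBump (d := d)).contDiff (n := 1)).differentiable one_ne_zero x)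
      (fun x _ => hB x) convex_univ (mem_univ x) (mem_univ w)
  have h2 : collision σ (fun z => phaseBump (d := d) (dilate (n ^ 2)⁻¹ n⁻¹ z)) z
      ≤ (B * ∫ y, σ y * ‖y‖) / n := by
    refine (le_abs_self _).trans ?_
    have h3 : (B * ∫ y, σ y * ‖y‖) / n = ∫ y, B / n * (σ y * ‖y‖) := by
      rw [integral_const_mul]; ring
    rw [h3]
    rw [← Real.norm_eq_abs]
    refine norm_integral_le_of_norm_le (hσ.int.const_mul _) (.of_forall fun y => ?_)
    rw [norm_smul, Real.norm_of_nonneg (hσ.nonneg y)]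
    have h4 : dilate (n ^ 2)⁻¹ n⁻¹ (z + (0, y)) - dilate (n ^ 2)⁻¹ n⁻¹ z = (0, n⁻¹ • y) := by
      simp [dilate]
    have h5 : ‖((0 : Space d), n⁻¹ • y)‖ = ‖y‖ / n := by
      rw [Prod.norm_def, norm_zero, max_eq_right (norm_nonneg _), norm_smul,
        Real.norm_of_nonneg (by positivity)]
      ring
    calc _ ≤ σ y * (B * (‖y‖ / n)) := by
          refine mul_le_mul_of_nonneg_left ?_ (hσ.nonneg y)
          rw [← h5, ← h4]
          exact hlip _ _
      _ = _ := by ring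
  calc _ ≤ 2 * B / n + (B * ∫ y, σ y * ‖y‖) / n := add_le_add h1 h2
    _ = _ := by ring

lemma transport_ofReal {h : Space d × Space d → ℝ} (hh : Differentiable ℝ h)
    (z : Space d × Space d) :
    transport (fun w => (h w : ℂ)) z = ((transport h z : ℝ) : ℂ) := by
  have := (Complex.ofRealCLM.hasFDerivAt.comp z (hh z).hasFDerivAt).fderiv
  rw [transport, transport]
  exact congrArg (fun T : Space d × Space d →L[ℝ] ℂ => T (z.2, 0)) this

lemma transport_const_mul {h : Space d × Space d → ℝ} (hh : Differentiable ℝ h) (c : ℝ)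
    (z : Space d × Space d) : transport (fun w => c * h w) z = c * transport h z := by
  rw [transport, fderiv_const_mul (hh z)]
  rfl

/-- Mollifiers whose commutator with transport is small in `L¹`: they are much more concentrated
in velocity than in position. -/
lemma exists_mollifier {δ : ℝ} (hδ : 0 < δ) : ∃ ρ : Space d × Space d → ℝ,
    ContDiff ℝ ((⊤ : ℕ∞) : WithTop ℕ∞) ρ ∧ HasCompactSupport ρ ∧ (∀ y, 0 ≤ ρ y) ∧
    ∫ y, ρ y = 1 ∧ (∀ y, δ < ‖y‖ → ρ y = 0) ∧ ∫ y, ‖transport ρ y‖ ≤ δ := by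
  set β : Space d × Space d → ℝ := ⇑(phaseBump (d := d)) with hβ
  set I := ∫ z, β z with hI
  set D := ∫ z, ‖fderiv ℝ β z‖ with hD
  have hIpos : 0 < I := (phaseBump (d := d)).integral_pos
  have hD0 : 0 ≤ D := integral_nonneg fun _ => norm_nonneg _
  set m : ℝ := max 1 (max (2 / δ) (2 * D / (I * δ))) with hm
  have hm1 : 1 ≤ m := le_max_left _ _
  have hm0 : 0 < m := by linarith
  have hm2 : 2 ≤ m * δ := by
    rw [← div_le_iff₀ hδ]
    exact (le_max_left _ _).trans (le_max_right _ _)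
  have hm3 : 2 * D ≤ m * (I * δ) := by
    rw [← div_le_iff₀ (by positivity)]
    exact (le_max_right _ _).trans (le_max_right _ _)
  have ha : 0 < m := hm0
  have hb : 0 < m ^ 2 := by positivity
  obtain ⟨J, hJ, hJint⟩ := exists_integral_dilate (d := d) ha hb
  set c := (J * I)⁻¹ with hc
  have hc0 : 0 < c := by positivity
  have hcd : ContDiff ℝ ((⊤ : ℕ∞) : WithTop ℕ∞) fun z => β (dilate m (m ^ 2) z) :=
    (phaseBump (d := d)).contDiff.comp (contDiff_dilate _ _)
  have hcs := hasCompactSupport_phaseBump_dilate (d := d) ha hb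
  refine ⟨fun z => c * β (dilate m (m ^ 2) z), contDiff_const.mul hcd, hcs.mul_left,
    fun y => mul_nonneg hc0.le (phaseBump (d := d)).nonneg, ?_, fun y hy => ?_, ?_⟩
  · rw [integral_const_mul, hJint]
    exact inv_mul_cancel₀ (by positivity)
  · have hmin : min m (m ^ 2) = m := min_eq_left (by nlinarith)
    have h1 := min_mul_norm_le_norm_dilate ha hb y
    rw [hmin] at h1
    have h2 : β (dilate m (m ^ 2) y) = 0 := by
      refine (phaseBump (d := d)).zero_of_le_dist ?_
      rw [dist_zero_right]
      calc (2 : ℝ) ≤ m * δ := hm2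
        _ ≤ m * ‖y‖ := by gcongr
        _ ≤ _ := h1
    simp only [h2, mul_zero]
  · have hdiff : Differentiable ℝ fun z => β (dilate m (m ^ 2) z) :=
      hcd.differentiable (by simp)
    have hfd : Integrable fun z => ‖fderiv ℝ β (dilate m (m ^ 2) z)‖ := by
      refine Continuous.integrable_of_hasCompactSupport ?_ ?_
      · exact ((((phaseBump (d := d)).contDiff (n := 1)).continuous_fderiv one_ne_zero).comp
          (contDiff_dilate (n := 1) _ _).continuous).norm
      · refine HasCompactSupport.intro (isCompact_closedBall 0 (2 / min m (m ^ 2))) fun z hz => ?_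
        rw [mem_closedBall_zero_iff, not_le, div_lt_iff₀ (lt_min ha hb), mul_comm] at hz
        rw [norm_eq_zero]
        by_contra hne
        have hmem := support_fderiv_subset ℝ hne
        rw [hβ, (phaseBump (d := d)).tsupport_eq, mem_closedBall_zero_iff] at hmem
        exact absurd (hz.trans_le (min_mul_norm_le_norm_dilate ha hb z)) (not_lt.2 hmem)
    calc ∫ y, ‖transport (fun z => c * β (dilate m (m ^ 2) z)) y‖
        ≤ ∫ y, c * (2 * m / m ^ 2 * ‖fderiv ℝ β (dilate m (m ^ 2) y)‖) := by
          refine integral_mono_of_nonneg (.of_forall fun _ => norm_nonneg _)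
            ((hfd.const_mul _).const_mul c) (.of_forall fun y => ?_)
          simp only
          rw [transport_const_mul hdiff, norm_mul, Real.norm_of_nonneg hc0.le]
          exact mul_le_mul_of_nonneg_left (norm_transport_phaseBump_dilate_le ha hb y) hc0.le
      _ = 2 * D / (m * I) := by
          rw [integral_const_mul, integral_const_mul, hJint fun z => ‖fderiv ℝ β z‖, ← hD, hc]
          field_simp
      _ ≤ δ := by
          rw [div_le_iff₀ (by positivity)]
          linarith

lemma integral_norm_sq_mollify_le (hσ : IsJumpKernel σ) {V : ℝ≥0 → PhaseL2 d} {C : ℝ}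
    (h : IsWeakSolution σ 0 V) (hC : ∀ t, ‖V t‖ ≤ C) {ρ : Space d × Space d → ℂ}
    (hρ : ContDiff ℝ ((⊤ : ℕ∞) : WithTop ℕ∞) ρ) (hc : HasCompactSupport ρ)
    (hρ1 : ∫ y, ‖ρ y‖ ≤ 1) {δ : ℝ} (hδ : 0 < δ) (hρδ : ∫ y, ‖transport ρ y‖ ≤ δ) (t : ℝ≥0) :
    ∫ z, ‖mollify (V t) ρ z‖ ^ 2 ≤ 2 * δ * C ^ 2 * t := by
  obtain ⟨K, hK, hb⟩ := hσ.exists_cutoff_bound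
  set χ : ℕ → Space d × Space d → ℝ := fun n z =>
    phaseBump (d := d) (dilate ((n + 1 : ℝ) ^ 2)⁻¹ (n + 1 : ℝ)⁻¹ z) with hχ
  have hle : ∀ n, ∫ z, χ n z * ‖mollify (V t) ρ z‖ ^ 2 ≤ (K / (n + 1) + 2 * δ) * C ^ 2 * t :=
    fun n => energy_le hσ h hC hρ hc hρ1 hδ hρδ
      ((phaseBump (d := d)).contDiff.comp (contDiff_dilate _ _))
      (hasCompactSupport_phaseBump_dilate (by positivity) (by positivity))
      (fun z => (phaseBump (d := d)).nonneg) (fun z => (phaseBump (d := d)).le_one)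
      (by positivity) (hb _ (by linarith [(Nat.cast_nonneg n : (0 : ℝ) ≤ n)])) t
  have hcont := continuous_mollify (V t) hρ.continuous hc
  have hlim : Tendsto (fun n => ∫ z, χ n z * ‖mollify (V t) ρ z‖ ^ 2) atTop
      (𝓝 (∫ z, ‖mollify (V t) ρ z‖ ^ 2)) := by
    refine tendsto_integral_of_dominated_convergence (fun z => ‖mollify (V t) ρ z‖ ^ 2)
      (fun n => ?_) (integral_sq_mollify_le (V t) hρ.continuous hc).1
      (fun n => .of_forall fun z => ?_) (.of_forall fun z => ?_)
    · have : Continuous (χ n) := (phaseBump (d := d)).continuous.comp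
        (contDiff_dilate (n := 1) _ _).continuous
      exact Continuous.aestronglyMeasurable (by fun_prop)
    · rw [norm_mul, Real.norm_of_nonneg (phaseBump (d := d)).nonneg, norm_pow, norm_norm]
      exact mul_le_of_le_one_left (by positivity) (phaseBump (d := d)).le_one
    · have h1 : Tendsto (fun n : ℕ => (n + 1 : ℝ)⁻¹) atTop (𝓝 0) := by
        simpa [one_div] using tendsto_one_div_add_atTop_nhds_zero_nat (𝕜 := ℝ)
      have h2 : Tendsto (fun n : ℕ => dilate ((n + 1 : ℝ) ^ 2)⁻¹ (n + 1 : ℝ)⁻¹ z) atTop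
          (𝓝 0) := by
        have h3 : Tendsto (fun n : ℕ => ((n + 1 : ℝ) ^ 2)⁻¹) atTop (𝓝 0) := by
          simpa [inv_pow] using h1.pow 2
        have h4 := (h3.smul_const z.1).prodMk_nhds (h1.smul_const z.2)
        rw [zero_smul, zero_smul] at h4
        exact h4
      refine tendsto_const_nhds.congr' ?_
      filter_upwards [h2 (Metric.closedBall_mem_nhds 0 one_pos)] with n hn
      have h5 : χ n z = 1 := (phaseBump (d := d)).one_of_mem_closedBall hn
      rw [h5, one_mul]
  have hK0 : Tendsto (fun n : ℕ => K / ((n : ℝ) + 1)) atTop (𝓝 0) := by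
    simpa [div_eq_mul_inv] using (tendsto_one_div_add_atTop_nhds_zero_nat (𝕜 := ℝ)).const_mul K
  have hlim' : Tendsto (fun n : ℕ => (K / ((n : ℝ) + 1) + 2 * δ) * C ^ 2 * t) atTop
      (𝓝 ((0 + 2 * δ) * C ^ 2 * t)) :=
    ((hK0.add_const _).mul_const _).mul_const _
  simpa using le_of_tendsto_of_tendsto' hlim hlim' hle

/-- Moving the mollifier to the test function. -/
lemma integral_mollify_mul (f : PhaseL2 d) {ρ φ : Space d × Space d → ℂ} (hρ : Continuous ρ)
    (hρc : HasCompactSupport ρ) (hφ : Continuous φ) (hφc : HasCompactSupport φ) :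
    Integrable (fun w => f w * ∫ y, ρ y * φ (y + w)) ∧
    ∫ z, mollify f ρ z * φ z = ∫ w, f w * ∫ y, ρ y * φ (y + w) := by
  obtain ⟨r, hr0, hr⟩ := HasCompactSupport.exists_radius hρc
  obtain ⟨R, hR0, hR⟩ := HasCompactSupport.exists_radius hφc
  obtain ⟨B, hB⟩ := hρc.exists_bound_of_continuous hρ
  have hB0 : 0 ≤ B := (norm_nonneg _).trans (hB 0)
  have hint : Integrable (Function.uncurry fun z w => f w * ρ (z - w) * φ z)
      (volume.prod volume) := by
    have hloc : Integrable ((Metric.closedBall (0 : Space d × Space d) (r + R)).indicator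
        fun w => B * ‖f w‖) := by
      refine IntegrableOn.integrable_indicator ?_ Metric.isClosed_closedBall.measurableSet
      exact ((locallyIntegrable_phaseL2 f).integrableOn_isCompact
        (isCompact_closedBall _ _)).norm.const_mul B
    refine ((hφ.integrable_of_hasCompactSupport hφc).norm.mul_prod hloc).mono' ?_
      (.of_forall fun p => ?_)
    · exact ((AEStronglyMeasurable.comp_snd (Lp.aestronglyMeasurable f)).mul
        (Continuous.aestronglyMeasurable (by fun_prop))).mul
          (Continuous.aestronglyMeasurable (by fun_prop))
    · simp only [Function.uncurry]
      have hind : 0 ≤ (Metric.closedBall (0 : Space d × Space d) (r + R)).indicator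
          (fun w => B * ‖f w‖) p.2 := indicator_nonneg (fun _ _ => by positivity) _
      rcases lt_or_ge R ‖p.1‖ with h1 | h1
      · simp [hR _ h1]
      rcases lt_or_ge r ‖p.1 - p.2‖ with h2 | h2
      · rw [hr _ h2, mul_zero, zero_mul, norm_zero]
        positivity
      · have h3 : p.2 ∈ Metric.closedBall (0 : Space d × Space d) (r + R) := by
          rw [mem_closedBall_zero_iff]
          have := norm_sub_norm_le p.2 p.1
          rw [norm_sub_rev] at this
          linarith
        rw [indicator_of_mem h3, norm_mul, norm_mul]
        calc _ ≤ ‖f p.2‖ * B * ‖φ p.1‖ := by gcongr; exact hB _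
          _ = _ := by ring
  have h1 : ∀ z, mollify f ρ z * φ z = ∫ w, f w * ρ (z - w) * φ z := fun z => by
    rw [mollify_apply, integral_mul_const]
  have h2 : ∀ w, ∫ z, f w * ρ (z - w) * φ z = f w * ∫ y, ρ y * φ (y + w) := fun w => by
    rw [← integral_const_mul, ← integral_sub_right_eq_self (fun y => f w * (ρ y * φ (y + w))) w]
    refine integral_congr_ae (.of_forall fun z => ?_)
    simp only
    rw [sub_add_cancel, mul_assoc]
  constructor
  · simpa only [Function.uncurry, h2] using hint.integral_prod_right
  · simp_rw [h1]
    rw [integral_integral_swap hint]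
    exact integral_congr_ae (.of_forall h2)

/-- Weak solutions with zero datum vanish: their regularizations are small in `L²`. -/
lemma IsWeakSolution.pairing_eq_zero (hσ : IsJumpKernel σ) {V : ℝ≥0 → PhaseL2 d}
    (h : IsWeakSolution σ 0 V) (t : ℝ≥0) {φ : Space d × Space d → ℂ} (hφ : Continuous φ)
    (hφc : HasCompactSupport φ) : ∫ w, V t w * φ w = 0 := by
  obtain ⟨C, hC⟩ := h.bounded
  obtain ⟨R, hR0, hR⟩ := HasCompactSupport.exists_radius hφc
  set A := ∫ z, ‖φ z‖ ^ 2 with hA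
  have hA0 : 0 ≤ A := integral_nonneg fun _ => by positivity
  have hφ2 : Integrable fun z => ‖φ z‖ ^ 2 :=
    (hφ.memLp_of_hasCompactSupport (p := 2) hφc).integrable_norm_pow (by norm_num)
  have hloc : IntegrableOn (fun w => ‖V t w‖) (Metric.closedBall 0 (R + 1)) :=
    ((locallyIntegrable_phaseL2 (V t)).integrableOn_isCompact (isCompact_closedBall _ _)).norm
  set B := ∫ w in Metric.closedBall 0 (R + 1), ‖V t w‖ with hB
  have hB0 : 0 ≤ B := integral_nonneg fun _ => norm_nonneg _
  have key : ∀ η > 0, ‖∫ w, V t w * φ w‖ ≤ η * (C ^ 2 * t + A / 2 + B) := by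
    intro η hη
    obtain ⟨δ', hδ', huc⟩ := Metric.uniformContinuous_iff.1
      (hφc.uniformContinuous_of_continuous hφ) η hη
    set δ := min (min (δ' / 2) (η ^ 2)) 1 with hδ_def
    have hδ : 0 < δ := by positivity
    have hδ1 : δ ≤ δ' / 2 := (min_le_left _ _).trans (min_le_left _ _)
    have hδ2 : δ ≤ η ^ 2 := (min_le_left _ _).trans (min_le_right _ _)
    have hδ3 : δ ≤ 1 := min_le_right _ _
    obtain ⟨ρ₀, hρ₀, hρ₀c, hρ₀0, hρ₀1, hρ₀s, hρ₀t⟩ := exists_mollifier (d := d) hδ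
    set ρ : Space d × Space d → ℂ := fun y => (ρ₀ y : ℂ) with hρ_def
    have hρ : ContDiff ℝ ((⊤ : ℕ∞) : WithTop ℕ∞) ρ := Complex.ofRealCLM.contDiff.comp hρ₀
    have hρc : HasCompactSupport ρ := hρ₀c.comp_left Complex.ofReal_zero
    have hρn : ∀ y, ‖ρ y‖ = ρ₀ y := fun y => by
      rw [hρ_def, Complex.norm_real, Real.norm_of_nonneg (hρ₀0 y)]
    have hρ1 : ∫ y, ‖ρ y‖ ≤ 1 := by simp_rw [hρn]; exact hρ₀1.le
    have hρt : ∫ y, ‖transport ρ y‖ ≤ δ := by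
      simp_rw [hρ_def, transport_ofReal (hρ₀.differentiable (by simp)), Complex.norm_real]
      exact hρ₀t
    have hρint : Integrable ρ₀ := hρ₀.continuous.integrable_of_hasCompactSupport hρ₀c
    set u := mollify (V t) ρ with hu
    have hu2 := (integral_sq_mollify_le (V t) hρ.continuous hρc).1
    have hule := integral_norm_sq_mollify_le hσ h hC hρ hρc hρ1 hδ hρt t
    have e1 : ‖∫ z, u z * φ z‖ ≤ η * (C ^ 2 * t + A / 2) := by
      have h1 : ∀ z, ‖u z * φ z‖ ≤ (2 * η)⁻¹ * ‖u z‖ ^ 2 + η / 2 * ‖φ z‖ ^ 2 := fun z => by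
        rw [norm_mul]
        have h2 : 0 ≤ (2 * η)⁻¹ * (‖u z‖ - η * ‖φ z‖) ^ 2 := by positivity
        have h3 : (2 * η)⁻¹ * (‖u z‖ - η * ‖φ z‖) ^ 2
            = (2 * η)⁻¹ * ‖u z‖ ^ 2 + η / 2 * ‖φ z‖ ^ 2 - ‖u z‖ * ‖φ z‖ := by
          field_simp
          ring
        linarith
      refine (norm_integral_le_of_norm_le ((hu2.const_mul _).add (hφ2.const_mul _))
        (.of_forall h1)).trans ?_
      simp only [Pi.add_apply]
      rw [integral_add (hu2.const_mul _) (hφ2.const_mul _), integral_const_mul,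
        integral_const_mul]
      calc (2 * η)⁻¹ * (∫ z, ‖u z‖ ^ 2) + η / 2 * A
          ≤ (2 * η)⁻¹ * (2 * η ^ 2 * C ^ 2 * t) + η / 2 * A := by
            gcongr
            exact hule.trans (by gcongr)
        _ = η * (C ^ 2 * t + A / 2) := by field_simp
    have hφR : ∀ w, R + 1 < ‖w‖ → φ w = 0 := fun w hw => hR w (by linarith)
    have hsm : ∀ w, ‖φ w - ∫ y, ρ y * φ (y + w)‖ ≤
        (Metric.closedBall (0 : Space d × Space d) (R + 1)).indicator (fun _ => η) w := by
      intro w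
      have hi : Integrable fun y => ρ y * φ (y + w) :=
        Continuous.integrable_of_hasCompactSupport
          (hρ.continuous.mul (by fun_prop)) hρc.mul_right
      have hi' : Integrable fun y => ρ y * φ w :=
        Continuous.integrable_of_hasCompactSupport
          (hρ.continuous.mul continuous_const) hρc.mul_right
      have h1 : φ w = ∫ y, ρ y * φ w := by
        rw [integral_mul_const, hρ_def, integral_complex_ofReal, hρ₀1]
        simp
      have h2 : φ w - ∫ y, ρ y * φ (y + w) = ∫ y, ρ y * (φ w - φ (y + w)) := by
        conv_lhs => rw [h1]
        rw [← integral_sub hi' hi]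
        exact integral_congr_ae (.of_forall fun y => (mul_sub _ _ _).symm)
      rw [h2]
      rcases lt_or_ge (R + 1) ‖w‖ with hw | hw
      · refine (norm_integral_le_of_norm_le (g := fun _ => 0) (by simp)
          (.of_forall fun y => ?_)).trans ?_
        · rcases lt_or_ge δ ‖y‖ with hy | hy
          · simp [hρ_def, hρ₀s y hy]
          · have h3 : φ (y + w) = 0 := by
              refine hR _ ?_
              have := norm_sub_norm_le w (-y)
              rw [sub_neg_eq_add, norm_neg, add_comm w] at this
              linarith
            rw [h3, hφR w hw]
            simp
        · simpa using indicator_nonneg (fun _ _ => hη.le) w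
      · rw [indicator_of_mem (by simpa using hw)]
        have h4 : ∫ y, ρ₀ y * η = η := by rw [integral_mul_const, hρ₀1, one_mul]
        rw [← h4]
        refine norm_integral_le_of_norm_le (hρint.mul_const η) (.of_forall fun y => ?_)
        rw [norm_mul, hρn]
        rcases lt_or_ge δ ‖y‖ with hy | hy
        · simp [hρ₀s y hy]
        · refine mul_le_mul_of_nonneg_left ?_ (hρ₀0 y)
          rw [← dist_eq_norm]
          refine (huc ?_).le
          rw [dist_eq_norm, sub_add_cancel_right, norm_neg]
          linarith
    have e2 : ‖∫ w, V t w * (φ w - ∫ y, ρ y * φ (y + w))‖ ≤ η * B := by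
      have hball : MeasurableSet (Metric.closedBall (0 : Space d × Space d) (R + 1)) :=
        Metric.isClosed_closedBall.measurableSet
      refine (norm_integral_le_of_norm_le (hloc.integrable_indicator hball |>.const_mul η)
        (.of_forall fun w => ?_)).trans (le_of_eq ?_)
      · rw [norm_mul]
        refine (mul_le_mul_of_nonneg_left (hsm w) (norm_nonneg _)).trans (le_of_eq ?_)
        by_cases hw : w ∈ Metric.closedBall (0 : Space d × Space d) (R + 1)
        · rw [indicator_of_mem hw, indicator_of_mem hw, mul_comm]
        · rw [indicator_of_notMem hw, indicator_of_notMem hw, mul_zero, mul_zero]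
      · rw [integral_const_mul, integral_indicator hball]
    obtain ⟨i2, hmol⟩ := integral_mollify_mul (V t) hρ.continuous hρc hφ hφc
    have i1 : Integrable fun w => V t w * φ w :=
      (Lp.memLp (V t)).integrable_mul (hφ.memLp_of_hasCompactSupport (p := 2) hφc)
    have hsplit : ∫ w, V t w * φ w = (∫ w, V t w * (φ w - ∫ y, ρ y * φ (y + w)))
        + ∫ z, u z * φ z := by
      rw [hu, hmol, ← integral_add ?_ i2]
      · exact integral_congr_ae (.of_forall fun w => by ring)
      · simp_rw [mul_sub]
        exact i1.sub i2
    rw [hsplit]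
    calc _ ≤ η * B + η * (C ^ 2 * t + A / 2) := (norm_add_le _ _).trans (add_le_add e2 e1)
      _ = _ := by ring
  set D := C ^ 2 * t + A / 2 + B with hD
  have hD0 : 0 ≤ D := by positivity
  rw [← norm_le_zero_iff]
  refine le_of_forall_pos_le_add fun ε hε => ?_
  calc _ ≤ ε / (D + 1) * D := key _ (by positivity)
    _ ≤ 0 + ε := by
      rw [zero_add, div_mul_eq_mul_div, div_le_iff₀ (by positivity)]
      nlinarith

theorem IsWeakSolution.unique (hσ : IsJumpKernel σ) {W₀ : PhaseL2 d} {W W' : ℝ≥0 → PhaseL2 d}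
    (h : IsWeakSolution σ W₀ W) (h' : IsWeakSolution σ W₀ W') : W = W' := by
  have hV := h.sub hσ h'
  rw [sub_self] at hV
  funext t
  rw [← sub_eq_zero]
  refine (Lp.dense_hasCompactSupport_contDiff (F := ℂ)
    (μ := (volume : Measure (Space d × Space d))) (p := 2) (by norm_num)).eq_zero_of_inner_right ℂ ?_
  rintro v ⟨φ, hae, hc, hφ⟩
  rw [L2.inner_def, ← hV.pairing_eq_zero hσ t (φ := fun w => conj (φ w))
    (Complex.continuous_conj.comp hφ.continuous) (hc.comp_left (map_zero _))]
  refine integral_congr_ae ?_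
  filter_upwards [hae] with w hw
  rw [hw, RCLike.inner_apply]

end Uniqueness

end RadiativeTransfer

end

theorem proposition4 (d : ℕ) (hd : 1 ≤ d)
    (R₀ g : RadiativeTransfer.Space d → ℝ) (θ σ₀ : ℝ)
    -- `R₀` is nonnegative, symmetric, integrable and compactly supported
    (hR₀_nonneg : ∀ p, 0 ≤ R₀ p) (hR₀_symm : ∀ p, R₀ (-p) = R₀ p)
    (hR₀_int : Integrable R₀) (hR₀_supp : HasCompactSupport R₀)
    -- `g` is nonnegative and symmetric
    (hg_meas : Measurable g) (hg_nonneg : ∀ p, 0 ≤ g p) (hg_symm : ∀ p, g (-p) = g p)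
    -- `∫ R₀(p) |p| / g(p) dp < ∞`, where a positive number divided by `0` is `∞`
    (h_int : ∫⁻ p, ENNReal.ofReal (R₀ p) * ‖p‖ₑ / ENNReal.ofReal (g p) < ⊤)
    -- `R₀(p) / g(p) ∼ σ₀ / |p|^(d + θ)` as `p → 0`
    (hθ : θ ∈ Set.Ioo (0 : ℝ) 1) (hσ₀ : 0 < σ₀)
    (h_asymp : Asymptotics.IsEquivalent (𝓝[≠] 0) (fun p => R₀ p / g p)
      (fun p => σ₀ / ‖p‖ ^ ((d : ℝ) + θ))) :
    -- there is a pure-jump Lévy process with jump measure `σ(p) dp` and exponent `Ψ`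
    (∃ (Ω : Type) (_ : MeasurableSpace Ω) (P : Measure Ω)
        (L : ℝ≥0 → Ω → RadiativeTransfer.Space d),
      IsProbabilityMeasure P ∧
      RadiativeTransfer.IsPureJumpLevyProcess L P
        (RadiativeTransfer.jumpMeasure (RadiativeTransfer.transferCoeff R₀ g)) ∧
      RadiativeTransfer.HasCharExponent L P
        (RadiativeTransfer.levyExponent (RadiativeTransfer.transferCoeff R₀ g))) ∧
    ∀ W₀ : RadiativeTransfer.PhaseL2 d, ∃ W : ℝ≥0 → RadiativeTransfer.PhaseL2 d,
      -- `W` is the unique weak solution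
      RadiativeTransfer.IsWeakSolution (RadiativeTransfer.transferCoeff R₀ g) W₀ W ∧
      (∀ W', RadiativeTransfer.IsWeakSolution (RadiativeTransfer.transferCoeff R₀ g) W₀ W' →
        W' = W) ∧
      -- it is represented by every Lévy process with exponent `Ψ`
      (∀ (Ω : Type*) [MeasurableSpace Ω] (P : Measure Ω) [IsProbabilityMeasure P]
          (L : ℝ≥0 → Ω → RadiativeTransfer.Space d),
        RadiativeTransfer.IsLevyProcess L P →
        RadiativeTransfer.HasCharExponent L P
          (RadiativeTransfer.levyExponent (RadiativeTransfer.transferCoeff R₀ g)) →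
        ∀ t : ℝ≥0, ∀ᵐ z : RadiativeTransfer.Space d × RadiativeTransfer.Space d,
          Integrable (fun ω => W₀ (z.1 - (t : ℝ) • z.2 - (∫ s in (0 : ℝ)..t, L s.toNNReal ω),
            z.2 + L t ω)) P ∧
          W t z = ∫ ω, W₀ (z.1 - (t : ℝ) • z.2 - (∫ s in (0 : ℝ)..t, L s.toNNReal ω),
            z.2 + L t ω) ∂P) ∧
      -- it is the unique classical solution
      RadiativeTransfer.IsClassicalSolution (RadiativeTransfer.transferCoeff R₀ g) W₀ W ∧
      (∀ W', RadiativeTransfer.IsClassicalSolution (RadiativeTransfer.transferCoeff R₀ g) W₀ W' →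
        W' = W) := by
  have hσ := RadiativeTransfer.isJumpKernel_transferCoeff hR₀_nonneg hR₀_symm hR₀_int hR₀_supp
    hg_meas hg_nonneg hg_symm h_int
  have hlow := RadiativeTransfer.hasStableLowerBound_transferCoeff hσ₀ h_asymp
  set σ := RadiativeTransfer.transferCoeff R₀ g
  set P := RadiativeTransfer.poissonLaw
    (RadiativeTransfer.jumpIntensity (RadiativeTransfer.jumpMeasure σ))
  have hpure := RadiativeTransfer.isPureJumpLevyProcess_jumpProcess hd hσ
  have hexp := RadiativeTransfer.hasCharExponent_jumpProcess hd hσ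
  refine ⟨⟨_, _, P, RadiativeTransfer.jumpProcess, inferInstance, hpure, hexp⟩, fun W₀ => ?_⟩
  set W := RadiativeTransfer.levySolution P RadiativeTransfer.jumpProcess W₀ with hW
  have hclass : RadiativeTransfer.IsClassicalSolution σ W₀ W :=
    hσ.isClassicalSolution_levySolution hθ.1 hθ.2.le hlow hpure.levy hexp W₀
  have hweak := hclass.isWeakSolution hσ
  refine ⟨W, hweak, fun W' hW' => hW'.unique hσ hweak, ?_, hclass,
    fun W' hW' => (hW'.isWeakSolution hσ).unique hσ hweak⟩
  intro Ω _ P' _ L hL hΨ t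
  rw [hW, RadiativeTransfer.levySolution_eq hσ.continuous_levyExponent hpure.levy hexp hL hΨ W₀]
  exact RadiativeTransfer.ae_levySolution_eq_expectation hL W₀ t
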